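/- Let $\mathfrak g=\mathfrak g_{\bar 0}\oplus\mathfrak g_{\bar 1}$ be a basic classical simple Lie superalgebra over $\mathbb C$ (finite-dimensional, simple, with $\mathfrak g_{\bar 1}$ completely reducible over $\mathfrak g_{\bar 0}$ and with a non-degenerate even invariant supersymmetric bilinear form), let $f\in\mathfrak g_{\bar 0}$ be a non-zero nilpotent element, and let $\Gamma\colon\mathfrak g=\bigoplus_{j\in\frac12\mathbb Z}\mathfrak g_j$ be a good grading for $f$: a grading of the Lie superalgebra $\mathfrak g$ with $f\in\mathfrak g_{-1}$ such that $\mathrm{ad}_f\colon\mathfrak g_j\to\mathfrak g_{j-1}$ is injective for $j\ge\frac12$ and surjective for $j\le\frac12$. Let $\{e,h,f\}\subset\mathfrak g_{\bar 0}$ be an $\mathfrak{sl}_2$-triple with $e\in\mathfrak g_1$, $h\in\mathfrak g_0$, put $\mathfrak g^e=\{X\in\mathfrak g\mid[e,X]=0\}$, and let $\mathcal S_f=f+\mathfrak g^e$ be the Slodowy slice. Put $\mathfrak g_{\ge-1/2}=\bigoplus_{j\ge-1/2}\mathfrak g_j$, $\mathfrak g_+=\bigoplus_{j>0}\mathfrak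 g_j$, and let $G_+$ be the unipotent algebraic supergroup with Lie superalgebra $\mathfrak g_+$, acting on the affine superspace $f+\mathfrak g_{\ge-1/2}$ by $(Z,\gamma)\mapsto\gamma^{-1}Z\gamma$. For an affine superspace $f+W$, with $W\subset\mathfrak g$ a graded subspace, $\mathbb C[f+W]$ denotes its coordinate superalgebra, the superpolynomials $S(W^*)=S(W_{\bar 0}^*)\otimes\Lambda(W_{\bar 1}^*)$. Then $\mathcal S_f\subset f+\mathfrak g_{\ge-1/2}$, restriction of functions to $\mathcal S_f$ is an isomorphism of algebras $\mathbb C[f+\mathfrak g_{\ge-1/2}]^{G_+}\xrightarrow{\sim}\mathbb C[\mathcal S_f]$, and the finite classical Miura map $$\bar\mu_{\mathrm{fin}}\colon\ \mathbb C[\mathcal S_f]\ \simeq\ \mathbb C[f+\mathfrak g_{\ge-1/2}]^{G_+}\ \longrightarrow\ \mathbb C[f+(\mathfrak g_{-1/2}\oplus\mathfrak g_0)],$$ the composition of the inverse of this isomorphism with restriction to $f+(\mathfrak g_{-1/2}\oplus\mathfrak g_0)$, is injective. -/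

import Mathlib

open scoped TensorProduct

universe u

noncomputable section

/-! ### Superspaces, superalgebras and Lie superalgebras over `ℂ` -/

/-- The Koszul sign `(-1)^(i j)` of two parities. -/
def superSign (i j : ZMod 2) : ℂ := if i = 1 ∧ j = 1 then -1 else 1

/-- The projection of a superspace `V = V₀ ⊕ V₁` onto its component of parity `i`. -/
def parityProj {V : Type*} [AddCommGroup V] [Module ℂ V] (𝒱 : ZMod 2 → Submodule ℂ V)
    [DirectSum.Decomposition 𝒱] (i : ZMod 2) : V →ₗ[ℂ] V :=
  (𝒱 i).subtype ∘ₗ DirectSum.component ℂ (ZMod 2) (fun j => 𝒱 j) i ∘ₗ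
    (DirectSum.decomposeLinearEquiv 𝒱).toLinearMap

/-- The parity involution `a₀ + a₁ ↦ a₀ - a₁`. -/
def parityInvolution {V : Type*} [AddCommGroup V] [Module ℂ V] (𝒱 : ZMod 2 → Submodule ℂ V)
    [DirectSum.Decomposition 𝒱] : V →ₗ[ℂ] V :=
  parityProj 𝒱 0 - parityProj 𝒱 1

/-- (Super)commutativity of a `ℤ/2`-graded algebra: `a b = (-1)^(|a||b|) b a`. -/
def IsSupercommutative {A : Type*} [Ring A] [Algebra ℂ A] (𝒜 : ZMod 2 → Submodule ℂ A) : Prop :=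
  ∀ i j : ZMod 2, ∀ a ∈ 𝒜 i, ∀ b ∈ 𝒜 j, a * b = superSign i j • (b * a)

theorem parityProj_same {V : Type*} [AddCommGroup V] [Module ℂ V] (𝒱 : ZMod 2 → Submodule ℂ V)
    [DirectSum.Decomposition 𝒱] {i : ZMod 2} {x : V} (hx : x ∈ 𝒱 i) : parityProj 𝒱 i x = x := by
  simp [parityProj, DirectSum.decomposeLinearEquiv_apply, ← DirectSum.apply_eq_component,
    DirectSum.decompose_of_mem 𝒱 hx]

theorem parityProj_ne {V : Type*} [AddCommGroup V] [Module ℂ V] (𝒱 : ZMod 2 → Submodule ℂ V)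
    [DirectSum.Decomposition 𝒱] {i j : ZMod 2} (hij : i ≠ j) {x : V} (hx : x ∈ 𝒱 i) :
    parityProj 𝒱 j x = 0 := by
  simp [parityProj, DirectSum.decomposeLinearEquiv_apply, ← DirectSum.apply_eq_component,
    DirectSum.decompose_of_mem 𝒱 hx, DirectSum.of_eq_of_ne _ _ _ hij.symm]

/-- A Lie superalgebra over `ℂ`. -/
class LieSuperalgebra (g : Type*) [AddCommGroup g] [Module ℂ g] where
  /-- The even part `parity 0` and the odd part `parity 1`. -/
  parity : ZMod 2 → Submodule ℂ g
  decomposition : DirectSum.Decomposition parity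
  /-- The superbracket. -/
  bracket : g →ₗ[ℂ] g →ₗ[ℂ] g
  bracket_mem : ∀ i j : ZMod 2, ∀ x ∈ parity i, ∀ y ∈ parity j, bracket x y ∈ parity (i + j)
  skew : ∀ i j : ZMod 2, ∀ x ∈ parity i, ∀ y ∈ parity j,
    bracket x y = -(superSign i j • bracket y x)
  jacobi : ∀ i j : ZMod 2, ∀ x ∈ parity i, ∀ y ∈ parity j, ∀ z : g,
    bracket x (bracket y z) = bracket (bracket x y) z + superSign i j • bracket y (bracket x z)

namespace LieSuperalgebra

attribute [reducible, instance] LieSuperalgebra.decomposition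

section Basic

variable (g : Type*) [AddCommGroup g] [Module ℂ g] [LieSuperalgebra g]

/-- Simplicity: the bracket is not zero and there are no graded ideals other than `0` and `g`. -/
def IsSimple : Prop :=
  (∃ x y : g, bracket x y ≠ 0) ∧
  ∀ I : Submodule ℂ g, (∀ i, ∀ x ∈ I, parityProj parity i x ∈ I) →
    (∀ x : g, ∀ y ∈ I, bracket x y ∈ I) → I = ⊥ ∨ I = ⊤

/-- The odd part is a completely reducible module over the even part: every submodule has a
complementary submodule. -/
def OddPartCompletelyReducible : Prop :=
  ∀ M : Submodule ℂ g, M ≤ parity 1 → (∀ x ∈ parity (g := g) 0, ∀ y ∈ M, bracket x y ∈ M) →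
    ∃ N : Submodule ℂ g, N ≤ parity 1 ∧ (∀ x ∈ parity (g := g) 0, ∀ y ∈ N, bracket x y ∈ N) ∧
      M ⊓ N = ⊥ ∧ M ⊔ N = parity 1

variable {g} in
/-- A non-degenerate even supersymmetric invariant bilinear form. -/
structure IsBasicForm (κ : g →ₗ[ℂ] g →ₗ[ℂ] ℂ) : Prop where
  even : ∀ i j : ZMod 2, i ≠ j → ∀ x ∈ parity (g := g) i, ∀ y ∈ parity (g := g) j, κ x y = 0
  symm : ∀ i j : ZMod 2, ∀ x ∈ parity (g := g) i, ∀ y ∈ parity (g := g) j,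
    κ x y = superSign i j * κ y x
  invariant : ∀ x y z : g, κ (bracket x y) z = κ x (bracket y z)
  nondegenerate : ∀ x : g, (∀ y : g, κ x y = 0) → x = 0

/-- Basic classical simple Lie superalgebras: finite-dimensional, simple, classical (the odd part
is a completely reducible module over the even part) and basic (there is a non-degenerate even
invariant supersymmetric form). -/
structure IsBasicClassical : Prop where
  finite : FiniteDimensional ℂ g
  simple : IsSimple g
  classical : OddPartCompletelyReducible g
  basic : ∃ κ : g →ₗ[ℂ] g →ₗ[ℂ] ℂ, IsBasicForm κ

variable {g}

/-- The centralizer `g^e`. -/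
def centralizer (e : g) : Submodule ℂ g := LinearMap.ker (bracket e)

/-- A good grading `g = ⨁ g_j`, `j ∈ ½ℤ`, for `f`. The grading is indexed by `n = 2j`, that is,
`Γ n` is `g_{n/2}`. -/
structure IsGoodGrading (Γ : ℤ → Submodule ℂ g) (f : g) : Prop where
  internal : DirectSum.IsInternal Γ
  homogeneous : ∀ n i, ∀ x ∈ Γ n, parityProj parity i x ∈ Γ n
  bracket_mem : ∀ m n, ∀ x ∈ Γ m, ∀ y ∈ Γ n, bracket x y ∈ Γ (m + n)
  mem : f ∈ Γ (-2)
  injective : ∀ n : ℤ, 1 ≤ n → ∀ x ∈ Γ n, bracket f x = 0 → x = 0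
  surjective : ∀ n : ℤ, n ≤ 1 → ∀ y ∈ Γ (n - 2), ∃ x ∈ Γ n, bracket f x = y

/-- An even `sl₂`-triple `{e, h, f}` adapted to the grading: `e ∈ g_1`, `h ∈ g_0` (and
`f ∈ g_{-1}`). -/
structure IsGradedSl2Triple (Γ : ℤ → Submodule ℂ g) (e h f : g) : Prop where
  e_even : e ∈ parity (g := g) 0
  h_even : h ∈ parity (g := g) 0
  f_even : f ∈ parity (g := g) 0
  e_mem : e ∈ Γ 2
  h_mem : h ∈ Γ 0
  f_mem : f ∈ Γ (-2)
  h_e : bracket h e = (2 : ℂ) • e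
  h_f : bracket h f = (-2 : ℂ) • f
  e_f : bracket e f = h

/-- `g_+ = ⨁_{j > 0} g_j`. -/
def gPos (Γ : ℤ → Submodule ℂ g) : Submodule ℂ g := ⨆ n : ℤ, ⨆ _ : 0 < n, Γ n

/-- `g_{≥ -1/2} = ⨁_{j ≥ -1/2} g_j`. -/
def gGe (Γ : ℤ → Submodule ℂ g) : Submodule ℂ g := ⨆ n : ℤ, ⨆ _ : -1 ≤ n, Γ n

/-- `g_{-1/2} ⊕ g_0`. -/
def gIni (Γ : ℤ → Submodule ℂ g) : Submodule ℂ g := Γ (-1) ⊔ Γ 0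

theorem gIni_le_gGe (Γ : ℤ → Submodule ℂ g) : gIni Γ ≤ gGe Γ :=
  sup_le (le_iSup₂_of_le (-1) le_rfl le_rfl) (le_iSup₂_of_le 0 (by norm_num) le_rfl)

/-! ### Coordinate rings -/

/-- The even (`i = 0`) and odd (`i = 1`) components of a graded subspace `W`. -/
abbrev component (W : Submodule ℂ g) (i : ZMod 2) : Submodule ℂ g := W ⊓ parity i

/-- The superalgebra `S(W*) = S(W₀*) ⊗ Λ(W₁*)` of superpolynomials on a graded subspace `W`.
It serves as coordinate ring of the affine superspace `W`, and also of each translate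
`f + W` (`f` even), a function on `f + W` being written as a function of `w ∈ W` through
`w ↦ f + w`. -/
abbrev CoordRing (W : Submodule ℂ g) : Type _ :=
  SymmetricAlgebra ℂ (Module.Dual ℂ (component W 0)) ⊗[ℂ]
    ExteriorAlgebra ℂ (Module.Dual ℂ (component W 1))

/-- The even linear coordinates. -/
def evenCoord (W : Submodule ℂ g) : Module.Dual ℂ (component W 0) →ₗ[ℂ] CoordRing W :=
  (Algebra.TensorProduct.includeLeft : _ →ₐ[ℂ] CoordRing W).toLinearMap ∘ₗ
    SymmetricAlgebra.ι ℂ _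

/-- The odd linear coordinates. -/
def oddCoord (W : Submodule ℂ g) : Module.Dual ℂ (component W 1) →ₗ[ℂ] CoordRing W :=
  (Algebra.TensorProduct.includeRight : _ →ₐ[ℂ] CoordRing W).toLinearMap ∘ₗ
    ExteriorAlgebra.ι ℂ

/-- The restriction of linear functions from `W_i` to `U_i`, for `U ≤ W`. -/
def dualRestrict {U W : Submodule ℂ g} (h : U ≤ W) (i : ZMod 2) :
    Module.Dual ℂ (component W i) →ₗ[ℂ] Module.Dual ℂ (component U i) :=
  (Submodule.inclusion (inf_le_inf_right (parity i) h)).dualMap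

/-- The restriction homomorphism `ℂ[f + W] → ℂ[f + U]` for `U ≤ W`. -/
def restrict {U W : Submodule ℂ g} (h : U ≤ W) : CoordRing W →ₐ[ℂ] CoordRing U :=
  Algebra.TensorProduct.map
    (SymmetricAlgebra.lift (SymmetricAlgebra.ι ℂ _ ∘ₗ dualRestrict h 0))
    (ExteriorAlgebra.map (dualRestrict h 1))

/-! ### Points with values in a commutative superalgebra -/

/-- An `A`-valued point of the affine superspace `W`: a homomorphism of superalgebras
`ℂ[W] → A` (it suffices that the generators are sent to elements of the right parity). -/
structure SuperPoint (W : Submodule ℂ g) {A : Type*} [Ring A] [Algebra ℂ A]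
    (𝒜 : ZMod 2 → Submodule ℂ A) where
  /-- Evaluation of functions at the point. -/
  eval : CoordRing W →ₐ[ℂ] A
  eval_even : ∀ ξ, eval (evenCoord W ξ) ∈ 𝒜 0
  eval_odd : ∀ ξ, eval (oddCoord W ξ) ∈ 𝒜 1

/-- The element `∑ x_α ⊗ x_α^*(p)` of `(W ⊗ A)₀ ⊆ g ⊗ A` corresponding to an `A`-valued point `p`
of `W`, where `x_α` is a homogeneous basis of `W` and `x_α^*` are the dual coordinates. -/
def SuperPoint.toTensor [FiniteDimensional ℂ g] {W : Submodule ℂ g} {A : Type*} [Ring A]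
    [Algebra ℂ A] {𝒜 : ZMod 2 → Submodule ℂ A} (p : SuperPoint W 𝒜) : g ⊗[ℂ] A :=
  TensorProduct.map (component W 0).subtype (p.eval.toLinearMap ∘ₗ evenCoord W)
      (coevaluation ℂ (component W 0) 1) +
    TensorProduct.map (component W 1).subtype (p.eval.toLinearMap ∘ₗ oddCoord W)
      (coevaluation ℂ (component W 1) 1)

/-- The bracket of `g ⊗ A`: `[x ⊗ a, y ⊗ b] = (-1)^(|a||y|) [x, y] ⊗ a b`
(see `tensorBracket_tmul`). -/
def tensorBracket {A : Type*} [Ring A] [Algebra ℂ A] (𝒜 : ZMod 2 → Submodule ℂ A)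
    [DirectSum.Decomposition 𝒜] : g ⊗[ℂ] A →ₗ[ℂ] g ⊗[ℂ] A →ₗ[ℂ] g ⊗[ℂ] A :=
  TensorProduct.map₂ (bracket.compl₂ (parityProj parity 0)) (LinearMap.mul ℂ A) +
    TensorProduct.map₂ (bracket.compl₂ (parityProj parity 1))
      (LinearMap.mul ℂ A ∘ₗ parityInvolution 𝒜)

theorem tensorBracket_tmul {A : Type*} [Ring A] [Algebra ℂ A] (𝒜 : ZMod 2 → Submodule ℂ A)
    [DirectSum.Decomposition 𝒜] {i j : ZMod 2} (x : g) {y : g} (hy : y ∈ parity (g := g) j)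
    {a : A} (ha : a ∈ 𝒜 i) (b : A) :
    tensorBracket 𝒜 (x ⊗ₜ[ℂ] a) (y ⊗ₜ[ℂ] b) =
      superSign i j • (bracket x y ⊗ₜ[ℂ] (a * b)) := by
  have key : ∀ k : ZMod 2, k = 0 ∨ k = 1 := by decide
  have h01 : (0 : ZMod 2) ≠ 1 := by decide
  have h10 : (1 : ZMod 2) ≠ 0 := by decide
  have hs := parityProj_same _ hy
  have ht := parityProj_same _ ha
  rcases key j with rfl | rfl
  · have hn := parityProj_ne _ h01 hy
    simp [tensorBracket, superSign, hs, hn]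
  · have hn := parityProj_ne _ h10 hy
    rcases key i with rfl | rfl
    · have hm := parityProj_ne _ h01 ha
      simp [tensorBracket, parityInvolution, superSign, hs, hn, ht, hm]
    · have hm := parityProj_ne _ h10 ha
      simp [tensorBracket, parityInvolution, superSign, hs, hn, ht, hm, TensorProduct.tmul_neg]

/-- `exp(-ad Y) Z = ∑ (-1)^n / n! (ad Y)^n Z` for `Y` with `ad Y` nilpotent on `g ⊗ A`; this is
`γ⁻¹ Z γ` for `γ = exp Y`. -/
def expNegAd {A : Type*} [Ring A] [Algebra ℂ A] (𝒜 : ZMod 2 → Submodule ℂ A)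
    [DirectSum.Decomposition 𝒜] (Y Z : g ⊗[ℂ] A) : g ⊗[ℂ] A :=
  ∑ n ∈ Finset.range (nilpotencyClass (tensorBracket 𝒜 Y : Module.End ℂ (g ⊗[ℂ] A))),
    ((-1 : ℂ) ^ n / (n.factorial : ℂ)) •
      ((tensorBracket 𝒜 Y : Module.End ℂ (g ⊗[ℂ] A)) ^ n) Z

end Basic

section Miura

variable {g : Type u} [AddCommGroup g] [Module ℂ g] [LieSuperalgebra g] [FiniteDimensional ℂ g]

/-- The algebra `ℂ[f + g_{≥ -1/2}]^{G_+}` of invariants of the unipotent supergroup `G_+` with Lie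
superalgebra `g_+`. Its coordinate ring is `S(g_+^*)`, so that an `A`-valued point of `G_+` is
`exp Y` for an `A`-valued point `Y` of `g_+`, and it acts on `f + g_{≥ -1/2}` by
`Z ↦ exp(Y)⁻¹ Z exp(Y) = exp(-ad Y) Z`. A function `F` is invariant when, for all commutative
superalgebras `A`, it takes the same value at `A`-valued points `p`, `q` of `f + g_{≥ -1/2}`
whenever `q` is the image of `p` under an `A`-valued point of `G_+`. -/
def invariants (Γ : ℤ → Submodule ℂ g) (f : g) : Subalgebra ℂ (CoordRing (gGe Γ)) where
  carrier := {F | ∀ (A : Type u) [Ring A] [Algebra ℂ A] (𝒜 : ZMod 2 → Submodule ℂ A)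
    [GradedAlgebra 𝒜], IsSupercommutative 𝒜 →
    ∀ (Y : SuperPoint (gPos Γ) 𝒜) (p q : SuperPoint (gGe Γ) 𝒜),
      f ⊗ₜ[ℂ] (1 : A) + q.toTensor =
        expNegAd 𝒜 Y.toTensor (f ⊗ₜ[ℂ] (1 : A) + p.toTensor) →
      q.eval F = p.eval F}
  mul_mem' := by
    intro a b ha hb A _ _ 𝒜 _ hA Y p q h
    rw [map_mul, map_mul, ha A 𝒜 hA Y p q h, hb A 𝒜 hA Y p q h]
  add_mem' := by
    intro a b ha hb A _ _ 𝒜 _ hA Y p q h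
    rw [map_add, map_add, ha A 𝒜 hA Y p q h, hb A 𝒜 hA Y p q h]
  algebraMap_mem' := by
    intro r A _ _ 𝒜 _ hA Y p q h
    rw [AlgHom.commutes, AlgHom.commutes]

/-- The restriction `ℂ[f + g_{≥ -1/2}]^{G_+} → ℂ[f + U]` for `U ≤ g_{≥ -1/2}`. -/
def restrictInvariants (Γ : ℤ → Submodule ℂ g) (f : g) {U : Submodule ℂ g} (hU : U ≤ gGe Γ) :
    invariants Γ f →ₐ[ℂ] CoordRing U :=
  (restrict hU).comp (invariants Γ f).val

/-- The finite classical Miura map `ℂ[S_f] ≅ ℂ[f + g_{≥ -1/2}]^{G_+} → ℂ[f + g_{-1/2} ⊕ g_0]`,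
where `S_f = f + g^e`, formed from the isomorphism `Φ : ℂ[f + g_{≥ -1/2}]^{G_+} ≅ ℂ[S_f]`. -/
def finiteMiura (Γ : ℤ → Submodule ℂ g) (e f : g)
    (Φ : invariants Γ f ≃ₐ[ℂ] CoordRing (centralizer e)) :
    CoordRing (centralizer e) →ₐ[ℂ] CoordRing (gIni Γ) :=
  (restrictInvariants Γ f (gIni_le_gGe Γ)).comp Φ.symm.toAlgHom

end Miura

end LieSuperalgebra

end

open LieSuperalgebra

/-!
# The finite classical Miura map is injective

For a commutative superalgebra `A` the even part of `g ⊗ A` (the Grassmann envelope) is an ordinary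
Lie algebra, the `A`-valued points of an affine superspace `f + W` are the even tensors in `W ⊗ A`,
and `ℂ[f + W]` is recovered from its points: its generic point has coefficients in `ℂ[f + W]`
itself. So everything reduces to statements about ordinary Lie algebras that are natural in `A`.

*Slices.* Suppose that `g_{≥ -1/2} = [f, g_+] ⊕ C`, compatibly with the grading. Then the iteration
`p ↦ exp(ad θ p)(f + p) - f`, where `θ` solves the linearised problem `p = [f, θ p] mod C`, moves
every point `f + p` along its `G_+`-orbit to a point of `f + C` in finitely many steps
(`LieSlice.SliceDatum.proj_mem`). Two points of one orbit lead to the same point of `f + C`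
(`LieSlice.SliceDatum.proj_eq_of_expAd`): the orbit map `t ↦ exp(-t ad Y)(f + p)` is a curve whose
derivative is an infinitesimal gauge transformation; the iteration, applied to the curve, preserves
this property, and a curve in `f + C` moved by infinitesimal gauge transformations is constant.
Applied with `C = g^e`, and to the generic points, this shows that restriction of invariants to the
Slodowy slice is bijective.

*Injectivity of the Miura map.* There is an even `z ∈ g_0` such that `ad z` is injective on `g_+`
(`exists_injective_bracket`). Then `g_{≥ -1/2} = [f + z, g_+] ⊕ (g_{-1/2} ⊕ g_0)`. This splitting
does not respect the grading, but the same iteration applies to points `f + z + τ p` with a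
nilpotent parameter `τ`, the filtration by powers of `τ` replacing the grading. Hence an invariant
function that vanishes on `f + g_{-1/2} ⊕ g_0` vanishes at `f + z + τ p` for a formal parameter `τ`;
being polynomial in `τ`, it vanishes at `f + z + p` for all `p`.

*The element `z`.* The even part `𝔞` of `g` has a faithful completely reducible module, its odd
part (or itself, if there is no odd part). So the radical of the trace form of this module is
central and meets `[𝔞, 𝔞]` trivially, and the degree derivation is inner on `𝔞`, given by some `z₀`
of degree `0` (`IsGoodGrading.exists_degree_eq_bracket`). Let `H` be a Cartan subalgebra of `𝔞`
containing and centralizing `z₀`, and let `z ∈ H` be a point where the non-zero weights of `H` on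
`g` do not vanish. The kernel of `ad z` consists of vectors of generalized weight zero. The even
ones lie in `H`, hence in degree `0`. An odd one of degree `n ≠ 0` is a generalized eigenvector,
for the eigenvalue `n`, of the derivation "degree minus `ad z₀`", which vanishes on `𝔞`. It is
zero: otherwise some root of `𝔞` would be a weight of this eigenspace and thus isotropic, which a
root of `𝔞` never is (`IsBasicForm.eq_zero_of_mem_genWeightSpace_zero`).
-/

noncomputable section

/-! ### Exponentials and slice data in a Lie algebra -/

namespace LieSlice

open Finset

/-- The exponential series truncated at order `N`; it is the exponential of `X` when `X ^ N = 0`. -/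
def expTrunc {A : Type*} [Ring A] [Algebra ℂ A] (N : ℕ) (X : A) : A :=
  ∑ n ∈ range N, ((n.factorial : ℂ)⁻¹) • X ^ n

/-- `exp X · T = (exp(ad X) T) · exp X` in an associative algebra. -/
theorem expTrunc_mul {A : Type*} [Ring A] [Algebra ℂ A] {N : ℕ} {X : A} (hX : X ^ N = 0) (T : A) :
    expTrunc N X * T = (∑ j ∈ range (N + N), ((j.factorial : ℂ)⁻¹) •
      ((LinearMap.mulLeft ℂ X - LinearMap.mulRight ℂ X) ^ j) T) * expTrunc N X := by
  let _ : Algebra ℚ (Module.End ℂ A) := Algebra.compHom _ (algebraMap ℚ ℂ)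
  have hsm : ∀ (q : ℚ) (x : Module.End ℂ A), q • x = (q : ℂ) • x := fun q x => rfl
  set l := LinearMap.mulLeft ℂ X
  set r := LinearMap.mulRight ℂ X
  have hl : l ^ N = 0 := by simp [l, LinearMap.pow_mulLeft, hX]
  have hr : r ^ N = 0 := by simp [r, LinearMap.pow_mulRight, hX]
  have hc : Commute l r := LinearMap.commute_mulLeft_right X X
  have hlr : Commute (l - r) r := hc.sub_left (Commute.refl r)
  have hd : (l - r) ^ (N + N) = 0 := by
    rw [sub_eq_add_neg]
    refine Commute.add_pow_eq_zero_of_add_le_succ_of_pow_eq_zero hc.neg_right hl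
      (n := N) (by rw [neg_pow, hr, mul_zero]) (by omega)
  have key : IsNilpotent.exp l = IsNilpotent.exp r * IsNilpotent.exp (l - r) := by
    rw [← IsNilpotent.exp_add_of_commute hlr.symm ⟨N, hr⟩ ⟨_, hd⟩]
    simp
  have := LinearMap.congr_fun key T
  rw [IsNilpotent.exp_eq_sum hl, IsNilpotent.exp_eq_sum hr, IsNilpotent.exp_eq_sum hd] at this
  simp only [hsm, l, r, LinearMap.pow_mulLeft, LinearMap.pow_mulRight, LinearMap.sum_apply,
    LinearMap.smul_apply, LinearMap.mulLeft_apply, LinearMap.mulRight_apply,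
    Module.End.mul_apply, map_sum, map_smul, Rat.cast_inv, Rat.cast_natCast] at this
  simp only [expTrunc, sum_mul, mul_sum, smul_mul_assoc, mul_smul_comm]
  simp only [this, smul_sum]
  rw [sum_comm]
  exact sum_congr rfl fun _ _ => sum_congr rfl fun _ _ => smul_comm _ _ _

/-- A curve `x` solving `∂ x = [v, x]` still solves such an equation after conjugation by
`exp W`. -/
theorem exists_derivation_expTrunc {K : Type*} [LieRing K] [LieAlgebra ℂ K] (d : K →ₗ[ℂ] K)
    (hd : ∀ x y, d ⁅x, y⁆ = ⁅d x, y⁆ + ⁅x, d y⁆) (G : Submodule ℂ K)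
    (hG : ∀ x ∈ G, ∀ y ∈ G, ⁅x, y⁆ ∈ G) (hdG : ∀ x ∈ G, d x ∈ G)
    {N : ℕ} {W : K} (hW : W ∈ G) (hN : (LieAlgebra.ad ℂ K W) ^ N = 0)
    {x : K} (hx : ∃ v ∈ G, d x = ⁅v, x⁆) :
    ∃ v ∈ G, d (expTrunc N (LieAlgebra.ad ℂ K W) x) = ⁅v, expTrunc N (LieAlgebra.ad ℂ K W) x⁆ := by
  obtain ⟨v, hv, hxv⟩ := hx
  set X : Module.End ℂ K := LieAlgebra.ad ℂ K W with hXdef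
  set T : Module.End ℂ K := d - LieAlgebra.ad ℂ K v with hT
  set u : K := -d W - ⁅W, v⁆ with hu
  have hu' : u ∈ G := sub_mem (neg_mem (hdG _ hW)) (hG _ hW _ hv)
  have hpow : ∀ j, (X ^ j) u ∈ G := by
    intro j
    induction j with
    | zero => simpa using hu'
    | succ j ih =>
      rw [pow_succ', Module.End.mul_apply]
      exact hG _ hW _ ih
  have hstep : ∀ j, ((LinearMap.mulLeft ℂ X - LinearMap.mulRight ℂ X) ^ (j + 1)) T =
      LieAlgebra.ad ℂ K ((X ^ j) u) := by
    intro j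
    induction j with
    | zero =>
      ext y
      simp only [X, T, u, hd, zero_add, pow_one, pow_zero, LinearMap.sub_apply,
        LinearMap.mulLeft_apply, LinearMap.mulRight_apply, Module.End.mul_apply,
        LieAlgebra.ad_apply, Module.End.one_apply, sub_lie, neg_lie, lie_sub, lie_lie W v]
      abel
    | succ j ih =>
      rw [pow_succ', Module.End.mul_apply, ih]
      ext y
      rw [pow_succ' X, Module.End.mul_apply]
      simp [X]
  have h := LinearMap.congr_fun (expTrunc_mul hN T) x
  have hTx : T x = 0 := by simp [T, hxv]
  rw [Module.End.mul_apply, hTx, map_zero, Module.End.mul_apply] at h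
  rcases Nat.eq_zero_or_pos N with hN0 | hN0
  · subst hN0
    exact ⟨0, zero_mem _, by simp [expTrunc]⟩
  obtain ⟨m, hm⟩ : ∃ m, N + N = m + 1 := ⟨N + N - 1, by omega⟩
  rw [hm, sum_range_succ'] at h
  refine ⟨v - ∑ j ∈ range m, ((j + 1).factorial : ℂ)⁻¹ • (X ^ j) u,
    sub_mem hv (sum_mem fun j _ => G.smul_mem _ (hpow j)), ?_⟩
  simp only [hstep, pow_zero, Nat.factorial_zero, Nat.cast_one, inv_one, one_smul,
    Module.End.one_apply] at h
  rw [LinearMap.add_apply, hT, LinearMap.sub_apply, LinearMap.sum_apply] at h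
  simp only [LinearMap.smul_apply, LieAlgebra.ad_apply] at h
  simp only [← smul_lie, ← sum_lie] at h
  rw [sub_lie, eq_sub_iff_add_eq', ← sub_eq_zero, h]
  abel

variable {L : Type*} [LieRing L] [LieAlgebra ℂ L]

/-- Data of an affine slice `f + C` to the action of a pronilpotent group on `f + P 1`.  The Lie
algebra of the group is `G 1`, filtered by the `G k`; the affine space is filtered by the `P k`.
The map `θ` solves the linearised problem `p ∈ ⁅f, θ p⁆ + C`. -/
structure SliceDatum (L : Type*) [LieRing L] [LieAlgebra ℂ L] where
  /-- The base point. -/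
  f : L
  /-- The filtration of the Lie algebra of the group. -/
  G : ℕ → Submodule ℂ L
  /-- The filtration of the directions of the affine space. -/
  P : ℕ → Submodule ℂ L
  /-- An exhaustive finite filtration that is raised by `G 1`. -/
  F : ℕ → Submodule ℂ L
  /-- The directions of the slice. -/
  C : Submodule ℂ L
  /-- The solution of the linearised problem. -/
  θ : L →ₗ[ℂ] L
  /-- A bound for the lengths of the filtrations. -/
  N : ℕ
  two_le : 2 ≤ N
  G_antitone : Antitone G
  P_antitone : Antitone P
  lie_GG : ∀ a b, ∀ x ∈ G a, ∀ y ∈ G b, ⁅x, y⁆ ∈ G (a + b)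
  lie_GP : ∀ a b, ∀ x ∈ G a, ∀ y ∈ P b, ⁅x, y⁆ ∈ P (a + b)
  lie_Gf : ∀ a, ∀ x ∈ G a, ⁅x, f⁆ ∈ P a
  lie_GF : ∀ b, ∀ x ∈ G 1, ∀ y ∈ F b, ⁅x, y⁆ ∈ F (b + 1)
  G_eq_bot : G N = ⊥
  F_zero : F 0 = ⊤
  F_eq_bot : F N = ⊥
  θ_mem : ∀ k, 1 ≤ k → ∀ x ∈ P k, θ x ∈ G k
  C_le : C ≤ P 1
  sub_lie_mem : ∀ x ∈ P 1, x - ⁅f, θ x⁆ ∈ C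
  θ_C : ∀ x ∈ C, θ x = 0
  θ_lie : ∀ y ∈ G 1, θ ⁅f, y⁆ = y

namespace SliceDatum

variable (D : SliceDatum L)

/-- The automorphism `exp (ad W)`. -/
def expAd (W : L) : Module.End ℂ L := expTrunc D.N (LieAlgebra.ad ℂ L W)

theorem expAd_zero : D.expAd 0 = 1 := by
  obtain ⟨m, hm⟩ : ∃ m, D.N = m + 1 := ⟨D.N - 1, by have := D.two_le; omega⟩
  simp [expAd, expTrunc, hm, sum_range_succ']

theorem ad_pow_eq_zero {W : L} (hW : W ∈ D.G 1) : (LieAlgebra.ad ℂ L W) ^ D.N = 0 := by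
  have h : ∀ n x, ((LieAlgebra.ad ℂ L W) ^ n) x ∈ D.F n := by
    intro n x
    induction n with
    | zero => simp [D.F_zero]
    | succ n ih =>
      rw [pow_succ', Module.End.mul_apply]
      exact D.lie_GF n _ hW _ ih
  ext x
  have := h D.N x
  rw [D.F_eq_bot] at this
  simpa using this

/-- One step of the iteration that moves `f + p` into the slice. -/
def step (p : L) : L := D.expAd (D.θ p) (D.f + p) - D.f

theorem f_add_step (p : L) : D.f + D.step p = D.expAd (D.θ p) (D.f + p) := by
  simp [step]

theorem expAd_sub_mem {k : ℕ} (hk : 1 ≤ k) {W p : L} (hW : W ∈ D.G k) (hp : p ∈ D.P 1) :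
    D.expAd W (D.f + p) - D.f - (p - ⁅D.f, W⁆) ∈ D.P (k + 1) := by
  obtain ⟨m, hm⟩ : ∃ m, D.N = m + 2 := ⟨D.N - 2, by have := D.two_le; omega⟩
  set X := LieAlgebra.ad ℂ L W with hX
  have h1 : ⁅W, p⁆ ∈ D.P (k + 1) := D.lie_GP _ _ _ hW _ hp
  have h2 : X (D.f + p) ∈ D.P k := by
    simp only [hX, LieAlgebra.ad_apply, lie_add]
    exact add_mem (D.lie_Gf _ _ hW) (D.P_antitone (by omega) h1)
  have h3 : ∀ n, (X ^ (n + 2)) (D.f + p) ∈ D.P (k + 1) := by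
    intro n
    induction n with
    | zero =>
      rw [zero_add, pow_two, Module.End.mul_apply]
      exact D.P_antitone (by omega) (D.lie_GP _ _ _ hW _ h2)
    | succ n ih =>
      rw [show n + 1 + 2 = (n + 2) + 1 by ring, pow_succ', Module.End.mul_apply]
      exact D.P_antitone (by omega) (D.lie_GP _ _ _ hW _ ih)
  have : D.expAd W (D.f + p) - D.f - (p - ⁅D.f, W⁆) =
      ∑ n ∈ range m, (((n + 2).factorial : ℂ)⁻¹) • (X ^ (n + 2)) (D.f + p) + ⁅W, p⁆ := by
    rw [expAd, expTrunc, hm, sum_range_succ', sum_range_succ', ← hX, ← lie_skew D.f W]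
    simp only [LinearMap.add_apply, LinearMap.sum_apply, LinearMap.smul_apply, zero_add, pow_one,
      pow_zero, Module.End.one_apply, Nat.factorial_zero, Nat.factorial_one, Nat.cast_one, inv_one,
      one_smul, add_assoc, one_add_one_eq_two]
    rw [show X (D.f + p) = ⁅W, D.f⁆ + ⁅W, p⁆ by simp [hX]]
    abel
  rw [this]
  exact add_mem (sum_mem fun n _ => Submodule.smul_mem _ _ (h3 n)) h1

theorem expAd_sub_mem_P {W p : L} (hW : W ∈ D.G 1) (hp : p ∈ D.P 1) :
    D.expAd W (D.f + p) - D.f ∈ D.P 1 := by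
  have h := D.P_antitone (show 1 ≤ 1 + 1 by omega) (D.expAd_sub_mem le_rfl hW hp)
  have h2 : p - ⁅D.f, W⁆ ∈ D.P 1 := by
    rw [← lie_skew]
    exact sub_mem hp (neg_mem (D.lie_Gf _ _ hW))
  simpa using add_mem h h2

theorem step_mem {p : L} (hp : p ∈ D.P 1) : D.step p ∈ D.P 1 :=
  D.expAd_sub_mem_P (D.θ_mem 1 le_rfl _ hp) hp

theorem θ_step_mem {k : ℕ} (hk : 1 ≤ k) {p : L} (hp : p ∈ D.P 1) (hθ : D.θ p ∈ D.G k) :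
    D.θ (D.step p) ∈ D.G (k + 1) := by
  have h := D.θ_mem _ (by omega) _ (D.expAd_sub_mem hk hθ hp)
  rw [map_sub, D.θ_C _ (D.sub_lie_mem _ hp), sub_zero] at h
  exact h

theorem iterate_step_mem {p : L} (hp : p ∈ D.P 1) (n : ℕ) : D.step^[n] p ∈ D.P 1 := by
  induction n with
  | zero => exact hp
  | succ n ih => rw [Function.iterate_succ_apply']; exact D.step_mem ih

theorem θ_iterate_step_mem {p : L} (hp : p ∈ D.P 1) (n : ℕ) :
    D.θ (D.step^[n] p) ∈ D.G (n + 1) := by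
  induction n with
  | zero => exact D.θ_mem 1 le_rfl _ hp
  | succ n ih =>
    rw [Function.iterate_succ_apply']
    exact D.θ_step_mem (by omega) (D.iterate_step_mem hp n) ih

/-- The point of the slice on the orbit of `f + p`, as the limit of the (stationary) iteration. -/
def proj (p : L) : L := D.step^[D.N] p

/-- The iteration reaches the slice. -/
theorem proj_mem {p : L} (hp : p ∈ D.P 1) : D.proj p ∈ D.C := by
  have h := D.G_antitone (Nat.le_succ D.N) (D.θ_iterate_step_mem hp D.N)
  rw [D.G_eq_bot, Submodule.mem_bot] at h
  have := D.sub_lie_mem _ (D.iterate_step_mem hp D.N)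
  rwa [h, lie_zero, sub_zero] at this

theorem step_of_mem_C {p : L} (hp : p ∈ D.C) : D.step p = p := by
  simp [step, D.θ_C p hp, expAd_zero]

theorem proj_of_mem_C {p : L} (hp : p ∈ D.C) : D.proj p = p :=
  Function.iterate_fixed (D.step_of_mem_C hp) _

section Naturality

variable {L' : Type*} [LieRing L'] [LieAlgebra ℂ L'] {D} {D' : SliceDatum L'}
  (φ : L →ₗ[ℂ] L') (hφ : ∀ x y, φ ⁅x, y⁆ = ⁅φ x, φ y⁆)
  (hN : D.N = D'.N)

include hφ hN in
theorem map_expAd (W x : L) : φ (D.expAd W x) = D'.expAd (φ W) (φ x) := by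
  have h : ∀ n, φ (((LieAlgebra.ad ℂ L W) ^ n) x) = ((LieAlgebra.ad ℂ L' (φ W)) ^ n) (φ x) := by
    intro n
    induction n with
    | zero => simp
    | succ n ih => simp [pow_succ', hφ, ih]
  simp [expAd, expTrunc, LinearMap.sum_apply, h, hN]

variable (hf : φ D.f = D'.f) (hθ : ∀ x, φ (D.θ x) = D'.θ (φ x))

include hφ hN hf hθ in
theorem map_step (p : L) : φ (D.step p) = D'.step (φ p) := by
  simp [step, map_expAd φ hφ hN, hf, hθ]

include hφ hN hf hθ in
theorem map_proj (p : L) : φ (D.proj p) = D'.proj (φ p) := by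
  rw [proj, proj, hN]
  exact Function.Semiconj.iterate_right (map_step φ hφ hN hf hθ) _ p

end Naturality

/-! ### Curves -/

/-- The span of the `a ⊗ x`, `x ∈ S`, in the polynomial curves in `L`. -/
def curves (S : Submodule ℂ L) : Submodule ℂ (Polynomial ℂ ⊗[ℂ] L) :=
  Submodule.span ℂ {z | ∃ a : Polynomial ℂ, ∃ x ∈ S, a ⊗ₜ[ℂ] x = z}

theorem tmul_mem_curves (a : Polynomial ℂ) {S : Submodule ℂ L} {x : L} (hx : x ∈ S) :
    a ⊗ₜ[ℂ] x ∈ curves S :=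
  Submodule.subset_span ⟨a, x, hx, rfl⟩

theorem curves_mono {S T : Submodule ℂ L} (h : S ≤ T) : curves S ≤ curves T :=
  Submodule.span_mono fun _ ⟨a, x, hx, e⟩ => ⟨a, x, h hx, e⟩

theorem curves_bot : curves (⊥ : Submodule ℂ L) = ⊥ := by
  rw [curves, Submodule.span_eq_bot]
  rintro _ ⟨a, x, hx, rfl⟩
  rw [(Submodule.mem_bot ℂ).mp hx, TensorProduct.tmul_zero]

theorem curves_top : curves (⊤ : Submodule ℂ L) = ⊤ := by
  rw [eq_top_iff, ← TensorProduct.span_tmul_eq_top]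
  exact Submodule.span_mono fun _ ⟨a, x, e⟩ => ⟨a, x, Submodule.mem_top, e⟩

theorem curves_induction {V : Type*} [AddCommGroup V] [Module ℂ V] {S : Submodule ℂ L}
    (φ : Polynomial ℂ ⊗[ℂ] L →ₗ[ℂ] V) (T : Submodule ℂ V)
    (h : ∀ a, ∀ x ∈ S, φ (a ⊗ₜ[ℂ] x) ∈ T) {z : Polynomial ℂ ⊗[ℂ] L} (hz : z ∈ curves S) :
    φ z ∈ T := by
  refine (Submodule.span_le (p := T.comap φ)).mpr ?_ hz
  rintro _ ⟨a, x, hx, rfl⟩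
  exact h a x hx

theorem lie_mem_curves {S T U : Submodule ℂ L} (h : ∀ x ∈ S, ∀ y ∈ T, ⁅x, y⁆ ∈ U)
    {x y : Polynomial ℂ ⊗[ℂ] L} (hx : x ∈ curves S) (hy : y ∈ curves T) : ⁅x, y⁆ ∈ curves U := by
  refine curves_induction (LieAlgebra.ad ℂ _ x) _ (fun b y hy => ?_) hy
  rw [LieAlgebra.ad_apply, ← lie_skew, ← LieAlgebra.ad_apply ℂ]
  refine neg_mem (curves_induction (LieAlgebra.ad ℂ _ _) _ (fun a x hx => ?_) hx)
  rw [LieAlgebra.ad_apply, ← lie_skew]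
  exact neg_mem (tmul_mem_curves (a * b) (h x hx y hy))

/-- The slice datum of polynomial curves. -/
def curveDatum : SliceDatum (Polynomial ℂ ⊗[ℂ] L) where
  f := 1 ⊗ₜ D.f
  G k := curves (D.G k)
  P k := curves (D.P k)
  F k := curves (D.F k)
  C := curves D.C
  θ := D.θ.lTensor _
  N := D.N
  two_le := D.two_le
  G_antitone _ _ h := curves_mono (D.G_antitone h)
  P_antitone _ _ h := curves_mono (D.P_antitone h)
  lie_GG a b _ hx _ hy := lie_mem_curves (D.lie_GG a b) hx hy
  lie_GP a b _ hx _ hy := lie_mem_curves (D.lie_GP a b) hx hy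
  lie_Gf a x hx := lie_mem_curves (T := ℂ ∙ D.f)
    (fun x hx y hy => by
      obtain ⟨c, rfl⟩ := Submodule.mem_span_singleton.mp hy
      rw [lie_smul]
      exact Submodule.smul_mem _ _ (D.lie_Gf a x hx)) hx
    (tmul_mem_curves _ (Submodule.mem_span_singleton_self _))
  lie_GF b _ hx _ hy := lie_mem_curves (D.lie_GF b) hx hy
  G_eq_bot := by rw [D.G_eq_bot, curves_bot]
  F_zero := by rw [D.F_zero, curves_top]
  F_eq_bot := by rw [D.F_eq_bot, curves_bot]
  θ_mem k hk x hx := curves_induction _ _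
    (fun a x hx => tmul_mem_curves a (D.θ_mem k hk x hx)) hx
  C_le := curves_mono D.C_le
  sub_lie_mem x hx := curves_induction
    (LinearMap.id - LieAlgebra.ad ℂ _ ((1 : Polynomial ℂ) ⊗ₜ D.f) ∘ₗ D.θ.lTensor _) _
    (fun a x hx => by
      have := tmul_mem_curves a (D.sub_lie_mem x hx)
      simpa [TensorProduct.tmul_sub] using this) hx
  θ_C x hx := (Submodule.mem_bot ℂ).mp <| curves_induction _ ⊥
    (fun a x hx => by simp [D.θ_C x hx]) hx
  θ_lie y hy := sub_eq_zero.mp <| (Submodule.mem_bot ℂ).mp <| curves_induction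
    (D.θ.lTensor _ ∘ₗ LieAlgebra.ad ℂ _ ((1 : Polynomial ℂ) ⊗ₜ D.f) - LinearMap.id) ⊥
    (fun a x hx => by simp [D.θ_lie x hx]) hy

/-- The derivative of a curve. -/
def curveDeriv (L : Type*) [LieRing L] [LieAlgebra ℂ L] :
    Polynomial ℂ ⊗[ℂ] L →ₗ[ℂ] Polynomial ℂ ⊗[ℂ] L :=
  LinearMap.rTensor L Polynomial.derivative

theorem curveDeriv_lie (x y : Polynomial ℂ ⊗[ℂ] L) :
    curveDeriv L ⁅x, y⁆ = ⁅curveDeriv L x, y⁆ + ⁅x, curveDeriv L y⁆ := by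
  induction x with
  | zero => rw [zero_lie y, map_zero, zero_lie y, zero_lie (curveDeriv L y), add_zero]
  | add x x' hx hx' =>
    rw [add_lie x x' y, map_add, hx, hx', map_add, add_lie x x' (curveDeriv L y),
      add_lie _ _ y]
    abel
  | tmul a x =>
    induction y with
    | zero => rw [lie_zero (a ⊗ₜ[ℂ] x), map_zero, lie_zero (a ⊗ₜ[ℂ] x),
        lie_zero (curveDeriv L (a ⊗ₜ[ℂ] x)), add_zero]
    | add y y' hy hy' =>
      rw [lie_add (a ⊗ₜ[ℂ] x) y y', map_add, hy, hy', map_add,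
        lie_add (a ⊗ₜ[ℂ] x), lie_add (curveDeriv L (a ⊗ₜ[ℂ] x)) y y']
      abel
    | tmul b y => simp [curveDeriv, TensorProduct.add_tmul]

theorem curveDeriv_mem_curves {S : Submodule ℂ L} {x : Polynomial ℂ ⊗[ℂ] L} (hx : x ∈ curves S) :
    curveDeriv L x ∈ curves S :=
  curves_induction _ _ (fun _ _ hx => tmul_mem_curves _ hx) hx

/-- The value of a curve at the time `c`. -/
def curveEval (L : Type*) [LieRing L] [LieAlgebra ℂ L] (c : ℂ) : Polynomial ℂ ⊗[ℂ] L →ₗ[ℂ] L :=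
  TensorProduct.lid ℂ L ∘ₗ LinearMap.rTensor L (Polynomial.leval c)

theorem curveEval_tmul (c : ℂ) (a : Polynomial ℂ) (x : L) :
    curveEval L c (a ⊗ₜ x) = a.eval c • x := by
  simp [curveEval, Polynomial.leval]

theorem curveEval_lie (c : ℂ) (x y : Polynomial ℂ ⊗[ℂ] L) :
    curveEval L c ⁅x, y⁆ = ⁅curveEval L c x, curveEval L c y⁆ := by
  induction x with
  | zero => rw [zero_lie y, map_zero, zero_lie]
  | add x x' hx hx' => rw [add_lie x x' y, map_add, hx, hx', map_add, add_lie]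
  | tmul a x =>
    induction y with
    | zero => rw [lie_zero (a ⊗ₜ[ℂ] x), map_zero, lie_zero]
    | add y y' hy hy' => rw [lie_add (a ⊗ₜ[ℂ] x) y y', map_add, hy, hy', map_add, lie_add]
    | tmul b y => simp [curveEval_tmul, mul_smul, smul_comm (b.eval c)]

/-- A curve with vanishing derivative is constant. -/
theorem curveEval_eq_of_curveDeriv_eq_zero {x : Polynomial ℂ ⊗[ℂ] L} (hx : curveDeriv L x = 0)
    (c d : ℂ) : curveEval L c x = curveEval L d x := by
  obtain ⟨I, hI⟩ : ∃ I : Polynomial ℂ →ₗ[ℂ] ℂ,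
      I ∘ₗ Polynomial.derivative = Polynomial.leval c - Polynomial.leval d := by
    have hsurj : Function.Surjective (Polynomial.derivative : Polynomial ℂ →ₗ[ℂ] Polynomial ℂ) := by
      intro p
      induction p using Polynomial.induction_on' with
      | add p q hp hq =>
        obtain ⟨p', rfl⟩ := hp
        obtain ⟨q', rfl⟩ := hq
        exact ⟨p' + q', map_add _ _ _⟩
      | monomial n a =>
        refine ⟨Polynomial.monomial (n + 1) (a / (n + 1)), ?_⟩
        have : (n + 1 : ℂ) ≠ 0 := by exact_mod_cast n.succ_ne_zero
        rw [Polynomial.derivative_monomial]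
        simp [div_mul_cancel₀ a this]
    obtain ⟨g, hg⟩ := LinearMap.exists_rightInverse_of_surjective _
      (LinearMap.range_eq_top.mpr hsurj)
    refine ⟨(Polynomial.leval c - Polynomial.leval d) ∘ₗ g, LinearMap.ext fun p => ?_⟩
    have h1 : Polynomial.derivative (g (Polynomial.derivative p) - p) = 0 := by
      rw [map_sub, sub_eq_zero]
      exact LinearMap.congr_fun hg _
    have h2 := Polynomial.eq_C_of_derivative_eq_zero h1
    have h3 : g (Polynomial.derivative p) = p +
      Polynomial.C ((g (Polynomial.derivative p) - p).coeff 0) := by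
      rw [← h2]; ring
    simp only [LinearMap.comp_apply]
    rw [h3]
    simp [Polynomial.leval]
  have h : curveEval L c - curveEval L d =
      TensorProduct.lid ℂ L ∘ₗ LinearMap.rTensor L I ∘ₗ curveDeriv L := by
    rw [curveDeriv, ← LinearMap.rTensor_comp, hI, LinearMap.rTensor_sub, LinearMap.comp_sub]
    rfl
  have := LinearMap.congr_fun h x
  simpa [hx, sub_eq_zero] using this

/-- Points of `f + P 1` on the same orbit have the same projection to the slice: along the curve
`exp (-t Y) (f + p)` the projection `s` satisfies `s' = ⁅v, f + s⁆` with `v` in `G 1`, which forces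
`v = 0`. -/
theorem proj_eq_of_expAd {p q Y : L} (hp : p ∈ D.P 1) (hY : Y ∈ D.G 1)
    (h : D.f + q = D.expAd (-Y) (D.f + p)) : D.proj q = D.proj p := by
  set D' := D.curveDatum
  set Y' : Polynomial ℂ ⊗[ℂ] L := Polynomial.X ⊗ₜ (-Y) with hY'
  have hY'G : Y' ∈ D'.G 1 := tmul_mem_curves _ (neg_mem hY)
  set p' : Polynomial ℂ ⊗[ℂ] L := 1 ⊗ₜ p with hp'
  have hp'P : p' ∈ D'.P 1 := tmul_mem_curves _ hp
  set r := D'.expAd Y' (D'.f + p') - D'.f with hr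
  have hrP : r ∈ D'.P 1 := D'.expAd_sub_mem_P hY'G hp'P
  have hgauge : ∀ W ∈ D'.G 1, ∀ x, (∃ v ∈ D'.G 1, curveDeriv L x = ⁅v, x⁆) →
      ∃ v ∈ D'.G 1, curveDeriv L (D'.expAd W x) = ⁅v, D'.expAd W x⁆ := fun W hW x hx =>
    exists_derivation_expTrunc _ curveDeriv_lie (D'.G 1)
      (fun x hx y hy => D'.G_antitone (by omega) (D'.lie_GG 1 1 x hx y hy))
      (fun x hx => curveDeriv_mem_curves hx) hW (D'.ad_pow_eq_zero hW) hx
  have hit : ∀ n, ∃ v ∈ D'.G 1,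
      curveDeriv L (D'.f + D'.step^[n] r) = ⁅v, D'.f + D'.step^[n] r⁆ := by
    intro n
    induction n with
    | zero =>
      have : D'.f + r = D'.expAd Y' (D'.f + p') := by rw [hr]; abel
      rw [Function.iterate_zero_apply, this]
      refine hgauge _ hY'G _ ⟨0, zero_mem _, ?_⟩
      have h1 : D'.f + p' = 1 ⊗ₜ (D.f + p) := by rw [TensorProduct.tmul_add]; rfl
      rw [h1, zero_lie (1 ⊗ₜ[ℂ] (D.f + p) : Polynomial ℂ ⊗[ℂ] L)]
      simp [curveDeriv]
    | succ n ih =>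
      rw [Function.iterate_succ_apply', D'.f_add_step]
      exact hgauge _ (D'.θ_mem 1 le_rfl _ (D'.iterate_step_mem hrP n)) _ ih
  obtain ⟨v, hv, hvs⟩ := hit D'.N
  have hs : D'.proj r ∈ D'.C := D'.proj_mem hrP
  change curveDeriv L (D'.f + D'.proj r) = ⁅v, D'.f + D'.proj r⁆ at hvs
  have hf : curveDeriv L D'.f = 0 := by
    change curveDeriv L (1 ⊗ₜ D.f) = 0
    simp [curveDeriv]
  rw [map_add, hf, zero_add, lie_add v] at hvs
  have hds : curveDeriv L (D'.proj r) ∈ D'.C := curveDeriv_mem_curves hs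
  have hvk : ∀ k, v ∈ D'.G (k + 1) := by
    intro k
    induction k with
    | zero => exact hv
    | succ k ih =>
      have h1 : v = D'.θ ⁅v, D'.proj r⁆ := by
        have h2 : ⁅D'.f, v⁆ = ⁅v, D'.proj r⁆ - curveDeriv L (D'.proj r) := by
          rw [hvs, ← lie_skew]; abel
        have h3 := D'.θ_lie v hv
        rw [h2, map_sub, D'.θ_C _ hds, sub_zero] at h3
        exact h3.symm
      rw [h1]
      exact D'.θ_mem _ (by omega) _ (D'.lie_GP _ _ _ ih _ (D'.C_le hs))
  have hv0 : v = 0 := by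
    have := D'.G_antitone (Nat.le_succ D'.N) (hvk D'.N)
    rwa [D'.G_eq_bot, Submodule.mem_bot] at this
  rw [hv0, zero_lie D'.f, zero_lie (D'.proj r), add_zero] at hvs
  have hev : ∀ c, curveEval L c (D'.proj r) = D.proj (curveEval L c r) := fun c =>
    map_proj (D := D') (D' := D) _ (curveEval_lie c) rfl (by simp [D', curveDatum, curveEval_tmul])
      (fun x => by
        induction x with
        | zero => simp
        | add x y hx hy => simp only [map_add, hx, hy]
        | tmul a x => simp [D', curveDatum, curveEval_tmul]) r
  have hevr : ∀ c, curveEval L c r = D.expAd (c • -Y) (D.f + p) - D.f := by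
    intro c
    have hf : curveEval L c D'.f = D.f := by simp [D', curveDatum, curveEval_tmul]
    rw [hr, map_sub, map_expAd (D := D') (D' := D) _ (curveEval_lie c) rfl, map_add, hf, hp', hY',
      curveEval_tmul, curveEval_tmul]
    simp
  have h0 : curveEval L 0 r = p := by simp [hevr, expAd_zero]
  have h1 : curveEval L 1 r = q := by rw [hevr, one_smul, ← h]; abel
  rw [← h0, ← h1, ← hev, ← hev]
  exact curveEval_eq_of_curveDeriv_eq_zero hvs 1 0

end SliceDatum

end LieSlice

namespace LieSuperalgebra

/-! ### Parities -/

theorem superSign_mul_self (i j : ZMod 2) : superSign i j * superSign i j = 1 := by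
  unfold superSign; split_ifs <;> norm_num

theorem superSign_comm (i j : ZMod 2) : superSign i j = superSign j i := by
  simp only [superSign, and_comm]

theorem zmod_two_cases (k : ZMod 2) : k = 0 ∨ k = 1 := by
  revert k; decide

theorem superSign_add_left (i j k : ZMod 2) :
    superSign (i + j) k = superSign i k * superSign j k := by
  have h : (1 + 1 : ZMod 2) = 0 := by decide
  rcases zmod_two_cases i with rfl | rfl <;> rcases zmod_two_cases j with rfl | rfl <;>
    rcases zmod_two_cases k with rfl | rfl <;> simp [superSign, h]

theorem superSign_add_right (i j k : ZMod 2) :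
    superSign i (j + k) = superSign i j * superSign i k := by
  rw [superSign_comm, superSign_add_left, superSign_comm j, superSign_comm k]

@[simp] theorem superSign_zero_left (j : ZMod 2) : superSign 0 j = 1 := by simp [superSign]

@[simp] theorem superSign_zero_right (j : ZMod 2) : superSign j 0 = 1 := by simp [superSign]

@[simp] theorem superSign_one_one : superSign 1 1 = -1 := by simp [superSign]

section Parity

variable {V : Type*} [AddCommGroup V] [Module ℂ V] (𝒱 : ZMod 2 → Submodule ℂ V)
  [DirectSum.Decomposition 𝒱]

theorem parityProj_mem (i : ZMod 2) (x : V) : parityProj 𝒱 i x ∈ 𝒱 i :=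
  Subtype.property _

theorem parityProj_add (x : V) : parityProj 𝒱 0 x + parityProj 𝒱 1 x = x := by
  induction x using DirectSum.Decomposition.inductionOn 𝒱 with
  | zero => simp
  | @homogeneous i m =>
    rcases zmod_two_cases i with rfl | rfl
    · rw [parityProj_same 𝒱 m.2, parityProj_ne 𝒱 (by decide) m.2, add_zero]
    · rw [parityProj_same 𝒱 m.2, parityProj_ne 𝒱 (by decide) m.2, zero_add]
  | add x y hx hy =>
    rw [map_add, map_add, add_add_add_comm, hx, hy]

theorem parity_inf_eq_bot {x : V} (h0 : x ∈ 𝒱 0) (h1 : x ∈ 𝒱 1) : x = 0 := by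
  rw [← parityProj_same 𝒱 h0, parityProj_ne 𝒱 (by decide) h1]

end Parity

/-! ### Extension of scalars of superalgebras -/

section TensorGrading

variable (B : Type*) [CommRing B] [Algebra ℂ B] {A : Type*} [Ring A] [Algebra ℂ A]
  (𝒜 : ZMod 2 → Submodule ℂ A)

/-- The grading of `B ⊗ A`, for a purely even algebra `B`. -/
def tensorGrading (i : ZMod 2) : Submodule ℂ (B ⊗[ℂ] A) :=
  ((𝒜 i).baseChange B).restrictScalars ℂ

variable {B 𝒜} in
theorem tmul_mem_tensorGrading {i : ZMod 2} (b : B) {a : A} (ha : a ∈ 𝒜 i) :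
    b ⊗ₜ[ℂ] a ∈ tensorGrading B 𝒜 i :=
  Submodule.tmul_mem_baseChange_of_mem b ha

theorem tensorGrading_eq_span (i : ZMod 2) :
    tensorGrading B 𝒜 i = Submodule.span ℂ {z | ∃ b : B, ∃ a ∈ 𝒜 i, b ⊗ₜ[ℂ] a = z} := by
  refine le_antisymm (fun z hz => ?_) (Submodule.span_le.mpr ?_)
  · change z ∈ (𝒜 i).baseChange B at hz
    rw [Submodule.baseChange_eq_span] at hz
    induction hz using Submodule.span_induction with
    | zero => exact zero_mem _
    | add x y _ _ hx hy => exact add_mem hx hy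
    | mem x hx =>
      obtain ⟨a, ha, rfl⟩ := hx
      exact Submodule.subset_span ⟨1, a, ha, rfl⟩
    | smul b x hxs hx =>
      clear hxs
      induction hx using Submodule.span_induction with
      | zero => rw [smul_zero]; exact zero_mem _
      | add x y _ _ hx hy => rw [smul_add]; exact add_mem hx hy
      | mem x hx =>
        obtain ⟨c, a, ha, rfl⟩ := hx
        rw [TensorProduct.smul_tmul']
        exact Submodule.subset_span ⟨_, a, ha, rfl⟩
      | smul c x _ hx => rw [smul_comm]; exact Submodule.smul_mem _ _ hx
  · rintro _ ⟨b, a, ha, rfl⟩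
    exact tmul_mem_tensorGrading b ha

instance [GradedAlgebra 𝒜] : GradedAlgebra (tensorGrading B 𝒜) where
  one_mem := (inferInstance : GradedAlgebra fun i ↦ (𝒜 i).baseChange B).one_mem
  mul_mem _ _ _ _ h h' := (inferInstance : GradedAlgebra fun i ↦ (𝒜 i).baseChange B).mul_mem h h'
  decompose' := (inferInstance : GradedAlgebra fun i ↦ (𝒜 i).baseChange B).decompose'
  left_inv := (inferInstance : GradedAlgebra fun i ↦ (𝒜 i).baseChange B).left_inv
  right_inv := (inferInstance : GradedAlgebra fun i ↦ (𝒜 i).baseChange B).right_inv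

variable {𝒜} in
theorem IsSupercommutative.tensorGrading (h : IsSupercommutative 𝒜) :
    IsSupercommutative (tensorGrading B 𝒜) := by
  intro i j x hx y hy
  rw [tensorGrading_eq_span] at hx hy
  induction hx using Submodule.span_induction with
  | zero => simp
  | add x x' _ _ hx hx' => rw [add_mul, mul_add, smul_add, hx, hx']
  | smul c x _ hx => rw [smul_mul_assoc, mul_smul_comm, hx, smul_comm]
  | mem x hx =>
    obtain ⟨b, a, ha, rfl⟩ := hx
    induction hy using Submodule.span_induction with
    | zero => simp
    | add x x' _ _ hx hx' => rw [add_mul, mul_add, smul_add, hx, hx']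
    | smul c x _ hx => rw [smul_mul_assoc, mul_smul_comm, hx, smul_comm]
    | mem y hy =>
      obtain ⟨b', a', ha', rfl⟩ := hy
      rw [Algebra.TensorProduct.tmul_mul_tmul, Algebra.TensorProduct.tmul_mul_tmul,
        h i j a ha a' ha', TensorProduct.tmul_smul, mul_comm]

end TensorGrading

theorem isSupercommutative_evenOdd (V : Type*) [AddCommGroup V] [Module ℂ V] :
    IsSupercommutative (CliffordAlgebra.evenOdd (0 : QuadraticForm ℂ V)) := by
  intro i j a ha b hb
  have h := CliffordAlgebra.map_mul_map_of_isOrtho_of_mem_evenOdd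
    (QuadraticMap.Isometry.id (0 : QuadraticForm ℂ V))
    (QuadraticMap.Isometry.id (0 : QuadraticForm ℂ V)) (fun x y => by simp [QuadraticMap.IsOrtho])
    a b ha hb
  rw [CliffordAlgebra.map_id] at h
  simp only [AlgHom.id_apply] at h
  rw [h]
  rcases zmod_two_cases i with rfl | rfl <;> rcases zmod_two_cases j with rfl | rfl <;>
    simp [superSign]

/-! ### Even tensors -/

section EvenTensor

variable {g : Type*} [AddCommGroup g] [Module ℂ g] [LieSuperalgebra g]
  {A : Type*} [Ring A] [Algebra ℂ A]

/-- The even part `(W ⊗ A)₀ = W₀ ⊗ A₀ ⊕ W₁ ⊗ A₁` of `W ⊗ A`, for a graded subspace `W`. -/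
def evenTensor (W : Submodule ℂ g) (𝒜 : ZMod 2 → Submodule ℂ A) : Submodule ℂ (g ⊗[ℂ] A) :=
  Submodule.span ℂ {z | ∃ i, ∃ x ∈ component W i, ∃ a ∈ 𝒜 i, x ⊗ₜ[ℂ] a = z}

variable {𝒜 : ZMod 2 → Submodule ℂ A}

theorem tmul_mem_evenTensor {W : Submodule ℂ g} {i : ZMod 2} {x : g} (hx : x ∈ component W i)
    {a : A} (ha : a ∈ 𝒜 i) : x ⊗ₜ[ℂ] a ∈ evenTensor W 𝒜 :=
  Submodule.subset_span ⟨i, x, hx, a, ha, rfl⟩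

theorem evenTensor_mono {W W' : Submodule ℂ g} (h : W ≤ W') :
    evenTensor W 𝒜 ≤ evenTensor W' 𝒜 :=
  Submodule.span_mono fun _ ⟨i, x, hx, r⟩ => ⟨i, x, ⟨h hx.1, hx.2⟩, r⟩

theorem evenTensor_bot : evenTensor (⊥ : Submodule ℂ g) 𝒜 = ⊥ := by
  rw [evenTensor, Submodule.span_eq_bot]
  rintro _ ⟨i, x, hx, a, -, rfl⟩
  rw [(Submodule.mem_bot ℂ).mp hx.1, TensorProduct.zero_tmul]

/-- A linear map sends even tensors into `T` if it does so on generators. -/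
theorem evenTensor_induction {V : Type*} [AddCommGroup V] [Module ℂ V] {W : Submodule ℂ g}
    (φ : g ⊗[ℂ] A →ₗ[ℂ] V) (T : Submodule ℂ V)
    (h : ∀ i, ∀ x ∈ component W i, ∀ a ∈ 𝒜 i, φ (x ⊗ₜ[ℂ] a) ∈ T) {z : g ⊗[ℂ] A}
    (hz : z ∈ evenTensor W 𝒜) : φ z ∈ T := by
  refine (Submodule.span_le (p := T.comap φ)).mpr ?_ hz
  rintro _ ⟨i, x, hx, a, ha, rfl⟩
  exact h i x hx a ha

theorem evenTensor_induction_eq {V : Type*} [AddCommGroup V] [Module ℂ V] {W : Submodule ℂ g}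
    (φ ψ : g ⊗[ℂ] A →ₗ[ℂ] V)
    (h : ∀ i, ∀ x ∈ component W i, ∀ a ∈ 𝒜 i, φ (x ⊗ₜ[ℂ] a) = ψ (x ⊗ₜ[ℂ] a)) {z : g ⊗[ℂ] A}
    (hz : z ∈ evenTensor W 𝒜) : φ z = ψ z := by
  have := evenTensor_induction (φ - ψ) ⊥ (fun i x hx a ha => by simp [h i x hx a ha]) hz
  simpa [sub_eq_zero] using this

theorem rTensor_mem_evenTensor {W W' : Submodule ℂ g} {θ : g →ₗ[ℂ] g}
    (h : ∀ i, ∀ x ∈ component W i, θ x ∈ component W' i) {z : g ⊗[ℂ] A}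
    (hz : z ∈ evenTensor W 𝒜) : θ.rTensor A z ∈ evenTensor W' 𝒜 :=
  evenTensor_induction _ _ (fun i x hx _ ha => tmul_mem_evenTensor (h i x hx) ha) hz

theorem lTensor_mem_evenTensor {W : Submodule ℂ g} {A' : Type*} [Ring A'] [Algebra ℂ A']
    {𝒜' : ZMod 2 → Submodule ℂ A'} {φ : A →ₗ[ℂ] A'} (h : ∀ i, ∀ a ∈ 𝒜 i, φ a ∈ 𝒜' i)
    {z : g ⊗[ℂ] A} (hz : z ∈ evenTensor W 𝒜) : φ.lTensor g z ∈ evenTensor W 𝒜' :=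
  evenTensor_induction _ _ (fun i _ hx _ ha => tmul_mem_evenTensor hx (h i _ ha)) hz

variable [GradedAlgebra 𝒜]

theorem tensorBracket_mem_evenTensor {W W' W'' : Submodule ℂ g}
    (h : ∀ x ∈ W, ∀ y ∈ W', bracket x y ∈ W'') {z w : g ⊗[ℂ] A}
    (hz : z ∈ evenTensor W 𝒜) (hw : w ∈ evenTensor W' 𝒜) :
    tensorBracket 𝒜 z w ∈ evenTensor W'' 𝒜 := by
  refine evenTensor_induction (tensorBracket 𝒜 z) _ (fun j y hy b hb => ?_) hw
  refine evenTensor_induction ((tensorBracket 𝒜).flip (y ⊗ₜ b)) _ (fun i x hx a ha => ?_) hz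
  rw [LinearMap.flip_apply, tensorBracket_tmul 𝒜 x hy.2 ha]
  exact Submodule.smul_mem _ _ (tmul_mem_evenTensor
    ⟨h x hx.1 y hy.1, bracket_mem i j x hx.2 y hy.2⟩ (SetLike.mul_mem_graded ha hb))

theorem tensorBracket_skew (hA : IsSupercommutative 𝒜) {z w : g ⊗[ℂ] A}
    (hz : z ∈ evenTensor ⊤ 𝒜) (hw : w ∈ evenTensor ⊤ 𝒜) :
    tensorBracket 𝒜 z w = -tensorBracket 𝒜 w z := by
  refine evenTensor_induction_eq (tensorBracket 𝒜 z) (-(tensorBracket 𝒜).flip z)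
    (fun j y hy b hb => ?_) hw
  refine evenTensor_induction_eq ((tensorBracket 𝒜).flip (y ⊗ₜ b)) (-tensorBracket 𝒜 (y ⊗ₜ b))
    (fun i x hx a ha => ?_) hz
  simp only [LinearMap.flip_apply, LinearMap.neg_apply]
  rw [tensorBracket_tmul 𝒜 x hy.2 ha, tensorBracket_tmul 𝒜 y hx.2 hb, skew i j x hx.2 y hy.2,
    hA i j a ha b hb, superSign_comm j i]
  simp only [TensorProduct.neg_tmul, TensorProduct.smul_tmul', TensorProduct.tmul_smul, smul_smul,
    smul_neg, superSign_mul_self, one_smul]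

theorem tensorBracket_jacobi (hA : IsSupercommutative 𝒜) {z w v : g ⊗[ℂ] A}
    (hz : z ∈ evenTensor ⊤ 𝒜) (hw : w ∈ evenTensor ⊤ 𝒜) (hv : v ∈ evenTensor ⊤ 𝒜) :
    tensorBracket 𝒜 z (tensorBracket 𝒜 w v) =
      tensorBracket 𝒜 (tensorBracket 𝒜 z w) v + tensorBracket 𝒜 w (tensorBracket 𝒜 z v) := by
  refine evenTensor_induction_eq (tensorBracket 𝒜 z ∘ₗ tensorBracket 𝒜 w)
    (tensorBracket 𝒜 (tensorBracket 𝒜 z w) + tensorBracket 𝒜 w ∘ₗ tensorBracket 𝒜 z)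
    (fun k t ht c hc => ?_) hv
  refine evenTensor_induction_eq (tensorBracket 𝒜 z ∘ₗ (tensorBracket 𝒜).flip (t ⊗ₜ c))
    ((tensorBracket 𝒜).flip (t ⊗ₜ c) ∘ₗ tensorBracket 𝒜 z +
      (tensorBracket 𝒜).flip (tensorBracket 𝒜 z (t ⊗ₜ c)))
    (fun j y hy b hb => ?_) hw
  refine evenTensor_induction_eq ((tensorBracket 𝒜).flip (tensorBracket 𝒜 (y ⊗ₜ b) (t ⊗ₜ c)))
    ((tensorBracket 𝒜).flip (t ⊗ₜ c) ∘ₗ (tensorBracket 𝒜).flip (y ⊗ₜ b) +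
      tensorBracket 𝒜 (y ⊗ₜ b) ∘ₗ (tensorBracket 𝒜).flip (t ⊗ₜ c))
    (fun i x hx a ha => ?_) hz
  simp only [LinearMap.flip_apply, LinearMap.add_apply, LinearMap.comp_apply]
  rw [tensorBracket_tmul 𝒜 y ht.2 hb, tensorBracket_tmul 𝒜 x hy.2 ha,
    tensorBracket_tmul 𝒜 x ht.2 ha]
  simp only [map_smul, LinearMap.smul_apply]
  rw [tensorBracket_tmul 𝒜 x (bracket_mem j k y hy.2 t ht.2) ha,
    tensorBracket_tmul 𝒜 (bracket x y) ht.2 (SetLike.mul_mem_graded ha hb),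
    tensorBracket_tmul 𝒜 y (bracket_mem i k x hx.2 t ht.2) hb,
    jacobi i j x hx.2 y hy.2 t, ← mul_assoc b a c, hA j i b hb a ha, ← mul_assoc a b c,
    superSign_add_left, superSign_add_right i, superSign_add_right j, superSign_comm j i]
  simp only [TensorProduct.add_tmul, TensorProduct.smul_tmul', TensorProduct.tmul_smul, smul_smul,
    smul_add, smul_mul_assoc]
  congr 3 <;> ring

end EvenTensor

/-- The Grassmann envelope of `g` over a commutative superalgebra: the even part of `g ⊗ A`, an
ordinary Lie algebra. -/
def Envelope (g : Type*) [AddCommGroup g] [Module ℂ g] [LieSuperalgebra g]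
    {A : Type*} [Ring A] [Algebra ℂ A] (𝒜 : ZMod 2 → Submodule ℂ A) : Type _ :=
  evenTensor (⊤ : Submodule ℂ g) 𝒜

namespace Envelope

variable {g : Type*} [AddCommGroup g] [Module ℂ g] [LieSuperalgebra g]
  {A : Type*} [Ring A] [Algebra ℂ A] {𝒜 : ZMod 2 → Submodule ℂ A}

instance : AddCommGroup (Envelope g 𝒜) :=
  inferInstanceAs (AddCommGroup (evenTensor (⊤ : Submodule ℂ g) 𝒜))

instance : Module ℂ (Envelope g 𝒜) :=
  inferInstanceAs (Module ℂ (evenTensor (⊤ : Submodule ℂ g) 𝒜))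

/-- The inclusion of the Grassmann envelope in `g ⊗ A`. -/
def val : Envelope g 𝒜 →ₗ[ℂ] g ⊗[ℂ] A := (evenTensor (⊤ : Submodule ℂ g) 𝒜).subtype

/-- An even tensor as an element of the Grassmann envelope. -/
def mk (z : g ⊗[ℂ] A) (hz : z ∈ evenTensor ⊤ 𝒜) : Envelope g 𝒜 := ⟨z, hz⟩

@[simp] theorem val_mk (z : g ⊗[ℂ] A) (hz : z ∈ evenTensor ⊤ 𝒜) : val (mk z hz) = z := rfl

theorem val_mem (z : Envelope g 𝒜) : val z ∈ evenTensor ⊤ 𝒜 := z.2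

theorem val_injective : Function.Injective (val : Envelope g 𝒜 → g ⊗[ℂ] A) :=
  Subtype.val_injective

variable [GradedAlgebra 𝒜]

instance [hA : Fact (IsSupercommutative 𝒜)] : LieRing (Envelope g 𝒜) where
  bracket z w := mk (tensorBracket 𝒜 (val z) (val w))
    (tensorBracket_mem_evenTensor (fun _ _ _ _ => Submodule.mem_top) (val_mem z) (val_mem w))
  add_lie z w v := val_injective (by simp only [val_mk, map_add, LinearMap.add_apply])
  lie_add z w v := val_injective (by simp only [val_mk, map_add])
  lie_self z := val_injective (by
    have h := tensorBracket_skew hA.out (val_mem z) (val_mem z)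
    rw [eq_neg_iff_add_eq_zero, ← two_smul ℂ, smul_eq_zero] at h
    simpa using h)
  leibniz_lie z w v := val_injective (by
    simpa using tensorBracket_jacobi hA.out (val_mem z) (val_mem w) (val_mem v))

variable [Fact (IsSupercommutative 𝒜)]

theorem val_lie (z w : Envelope g 𝒜) : val ⁅z, w⁆ = tensorBracket 𝒜 (val z) (val w) := rfl

instance : LieAlgebra ℂ (Envelope g 𝒜) where
  lie_smul c z w := val_injective (by simp only [val_lie, map_smul])

end Envelope

end LieSuperalgebra

namespace LieSuperalgebra

/-! ### Coordinate rings and points -/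

section Coordinates

variable {g : Type*} [AddCommGroup g] [Module ℂ g] [LieSuperalgebra g]

/-- The `ℤ/2`-grading of the superpolynomials, given by the parity of the exterior factor. -/
abbrev coordGrading (W : Submodule ℂ g) : ZMod 2 → Submodule ℂ (CoordRing W) :=
  tensorGrading (SymmetricAlgebra ℂ (Module.Dual ℂ (component W 0)))
    (CliffordAlgebra.evenOdd (0 : QuadraticForm ℂ (Module.Dual ℂ (component W 1))))

theorem isSupercommutative_coordGrading (W : Submodule ℂ g) :
    IsSupercommutative (coordGrading W) :=
  IsSupercommutative.tensorGrading _ (isSupercommutative_evenOdd _)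

theorem evenCoord_mem (W : Submodule ℂ g) (ξ : Module.Dual ℂ (component W 0)) :
    evenCoord W ξ ∈ coordGrading W 0 :=
  tmul_mem_tensorGrading _ (SetLike.one_mem_graded
    (CliffordAlgebra.evenOdd (0 : QuadraticForm ℂ (Module.Dual ℂ (component W 1)))))

theorem oddCoord_mem (W : Submodule ℂ g) (ξ : Module.Dual ℂ (component W 1)) :
    oddCoord W ξ ∈ coordGrading W 1 :=
  tmul_mem_tensorGrading _ (CliffordAlgebra.ι_mem_evenOdd_one _ ξ)

/-- Homomorphisms out of a coordinate ring are determined by the linear coordinates; the target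
need not be commutative. -/
theorem coordRing_hom_ext {W : Submodule ℂ g} {A : Type*} [Ring A] [Algebra ℂ A]
    {φ ψ : CoordRing W →ₐ[ℂ] A} (h0 : ∀ ξ, φ (evenCoord W ξ) = ψ (evenCoord W ξ))
    (h1 : ∀ ξ, φ (oddCoord W ξ) = ψ (oddCoord W ξ)) : φ = ψ := by
  refine Algebra.TensorProduct.ext ?_ (ExteriorAlgebra.hom_ext (LinearMap.ext h1))
  refine AlgHom.ext fun a => ?_
  induction a using SymmetricAlgebra.induction with
  | algebraMap r => rw [AlgHom.commutes, AlgHom.commutes]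
  | ι ξ => exact h0 ξ
  | mul a b ha hb => rw [map_mul, map_mul, ha, hb]
  | add a b ha hb => rw [map_add, map_add, ha, hb]

theorem restrict_evenCoord {U W : Submodule ℂ g} (h : U ≤ W)
    (ξ : Module.Dual ℂ (component W 0)) :
    restrict h (evenCoord W ξ) = evenCoord U (dualRestrict h 0 ξ) := by
  simp [restrict, evenCoord]

theorem restrict_oddCoord {U W : Submodule ℂ g} (h : U ≤ W)
    (ξ : Module.Dual ℂ (component W 1)) :
    restrict h (oddCoord W ξ) = oddCoord U (dualRestrict h 1 ξ) := by
  simp [restrict, oddCoord]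

section Graded

variable {A : Type*} [Ring A] [Algebra ℂ A] {𝒜 : ZMod 2 → Submodule ℂ A} [GradedAlgebra 𝒜]

theorem IsSupercommutative.mem_center (hA : IsSupercommutative 𝒜) {a : A} (ha : a ∈ 𝒜 0) :
    a ∈ Subalgebra.center ℂ A := by
  rw [Subalgebra.mem_center_iff]
  intro b
  have h : ∀ i, ∀ b ∈ 𝒜 i, b * a = a * b := fun i b hb => by
    rw [hA 0 i a ha b hb, superSign_zero_left, one_smul]
  rw [← parityProj_add 𝒜 b, add_mul, mul_add, h 0 _ (parityProj_mem 𝒜 0 b),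
    h 1 _ (parityProj_mem 𝒜 1 b)]

omit [GradedAlgebra 𝒜] in
theorem IsSupercommutative.mul_self (hA : IsSupercommutative 𝒜) {a : A} (ha : a ∈ 𝒜 1) :
    a * a = 0 := by
  have h := hA 1 1 a ha a ha
  rw [superSign_one_one, neg_one_smul, eq_neg_iff_add_eq_zero, ← two_smul ℂ, smul_eq_zero] at h
  simpa using h

/-- The homomorphism of superalgebras `ℂ[W] → A` with prescribed values on the linear
coordinates. -/
def coordLift (hA : IsSupercommutative 𝒜) {W : Submodule ℂ g}
    (l₀ : Module.Dual ℂ (component W 0) →ₗ[ℂ] A) (h₀ : ∀ ξ, l₀ ξ ∈ 𝒜 0)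
    (l₁ : Module.Dual ℂ (component W 1) →ₗ[ℂ] A) (h₁ : ∀ ξ, l₁ ξ ∈ 𝒜 1) :
    CoordRing W →ₐ[ℂ] A :=
  Algebra.TensorProduct.lift
    ((Subalgebra.center ℂ A).val.comp (SymmetricAlgebra.lift
      (l₀.codRestrict (Subalgebra.toSubmodule (Subalgebra.center ℂ A))
        fun ξ => IsSupercommutative.mem_center hA (h₀ ξ))))
    (ExteriorAlgebra.lift ℂ ⟨l₁, fun ξ => IsSupercommutative.mul_self hA (h₁ ξ)⟩)
    fun _ _ => ((Subalgebra.mem_center_iff.mp (Subtype.property _) _).symm : _ * _ = _ * _)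

variable (hA : IsSupercommutative 𝒜) {W : Submodule ℂ g}
    (l₀ : Module.Dual ℂ (component W 0) →ₗ[ℂ] A) (h₀ : ∀ ξ, l₀ ξ ∈ 𝒜 0)
    (l₁ : Module.Dual ℂ (component W 1) →ₗ[ℂ] A) (h₁ : ∀ ξ, l₁ ξ ∈ 𝒜 1)

theorem coordLift_evenCoord (ξ) : coordLift hA l₀ h₀ l₁ h₁ (evenCoord W ξ) = l₀ ξ := by
  refine (Algebra.TensorProduct.lift_tmul _ _ _ _ _).trans ?_
  rw [map_one, mul_one, AlgHom.comp_apply, SymmetricAlgebra.lift_ι_apply]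
  rfl

theorem coordLift_oddCoord (ξ) : coordLift hA l₀ h₀ l₁ h₁ (oddCoord W ξ) = l₁ ξ := by
  refine (Algebra.TensorProduct.lift_tmul _ _ _ _ _).trans ?_
  rw [map_one, one_mul, ExteriorAlgebra.lift_ι_apply]

end Graded

end Coordinates

section Coevaluation

variable {V g A : Type*} [AddCommGroup V] [Module ℂ V] [FiniteDimensional ℂ V]
  [AddCommGroup g] [Module ℂ g] [Ring A] [Algebra ℂ A]

/-- The tensor `∑ ι v_α ⊗ l (v_α^*)` attached to a linear family of coordinates on `V`. -/
def coordTensor (ι : V →ₗ[ℂ] g) (l : Module.Dual ℂ V →ₗ[ℂ] A) : g ⊗[ℂ] A :=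
  TensorProduct.map ι l (coevaluation ℂ V 1)

theorem coordTensor_eq_sum (ι : V →ₗ[ℂ] g) (l : Module.Dual ℂ V →ₗ[ℂ] A) :
    coordTensor ι l = ∑ i, ι (Module.Basis.ofVectorSpace ℂ V i) ⊗ₜ[ℂ]
      l ((Module.Basis.ofVectorSpace ℂ V).coord i) := by
  rw [coordTensor, coevaluation_apply_one]
  simp only [map_sum, TensorProduct.map_tmul]

theorem contract_coordTensor (ι : V →ₗ[ℂ] g) (l : Module.Dual ℂ V →ₗ[ℂ] A) (η : g →ₗ[ℂ] ℂ) :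
    TensorProduct.lid ℂ A (η.rTensor A (coordTensor ι l)) = l (η ∘ₗ ι) := by
  rw [coordTensor_eq_sum]
  simp only [map_sum, LinearMap.rTensor_tmul, TensorProduct.lid_tmul]
  rw [← (Module.Basis.ofVectorSpace ℂ V).sum_dual_apply_smul_coord (η ∘ₗ ι)]
  simp [map_sum]

theorem coordTensor_smulRight (ι : V →ₗ[ℂ] g) (x : V) (a : A) :
    coordTensor ι ((Module.Dual.eval ℂ V x).smulRight a) = ι x ⊗ₜ[ℂ] a := by
  rw [coordTensor_eq_sum]
  simp only [LinearMap.smulRight_apply, Module.Dual.eval_apply, Module.Basis.coord_apply,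
    TensorProduct.tmul_smul, TensorProduct.smul_tmul', ← map_smul, ← TensorProduct.sum_tmul,
    ← map_sum, Module.Basis.sum_repr]

theorem coordTensor_add (ι : V →ₗ[ℂ] g) (l l' : Module.Dual ℂ V →ₗ[ℂ] A) :
    coordTensor ι (l + l') = coordTensor ι l + coordTensor ι l' := by
  simp only [coordTensor, TensorProduct.map_add_right, LinearMap.add_apply]

theorem coordTensor_smul (ι : V →ₗ[ℂ] g) (c : ℂ) (l : Module.Dual ℂ V →ₗ[ℂ] A) :
    coordTensor ι (c • l) = c • coordTensor ι l := by
  simp only [coordTensor, TensorProduct.map_smul_right, LinearMap.smul_apply]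

theorem coordTensor_zero (ι : V →ₗ[ℂ] g) :
    coordTensor ι (0 : Module.Dual ℂ V →ₗ[ℂ] A) = 0 := by
  simp only [coordTensor, TensorProduct.map_zero_right, LinearMap.zero_apply]

end Coevaluation

namespace SuperPoint

variable {g : Type*} [AddCommGroup g] [Module ℂ g] [LieSuperalgebra g] [FiniteDimensional ℂ g]
  {A : Type*} [Ring A] [Algebra ℂ A] {𝒜 : ZMod 2 → Submodule ℂ A}
  {B : Type*} [Ring B] [Algebra ℂ B] {ℬ : ZMod 2 → Submodule ℂ B} {W : Submodule ℂ g}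

theorem toTensor_eq (p : SuperPoint W 𝒜) : p.toTensor =
    coordTensor (component W 0).subtype (p.eval.toLinearMap ∘ₗ evenCoord W) +
      coordTensor (component W 1).subtype (p.eval.toLinearMap ∘ₗ oddCoord W) := rfl

theorem contract_toTensor (p : SuperPoint W 𝒜) (η : g →ₗ[ℂ] ℂ) :
    TensorProduct.lid ℂ A (η.rTensor A p.toTensor) =
      p.eval (evenCoord W (η ∘ₗ (component W 0).subtype)) +
        p.eval (oddCoord W (η ∘ₗ (component W 1).subtype)) := by
  rw [toTensor_eq, map_add, map_add, contract_coordTensor, contract_coordTensor]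
  rfl

omit [FiniteDimensional ℂ g] in
theorem exists_extend_dual (W : Submodule ℂ g) {i j : ZMod 2} (hij : j ≠ i)
    (ξ : Module.Dual ℂ (component W i)) : ∃ η : g →ₗ[ℂ] ℂ,
      η ∘ₗ (component W i).subtype = ξ ∧ ∀ x ∈ parity (g := g) j, η x = 0 := by
  obtain ⟨η, hη⟩ := LinearMap.exists_extend ξ
  refine ⟨η ∘ₗ parityProj parity i, ?_, fun x hx => ?_⟩
  · ext x
    rw [← hη]
    simp only [LinearMap.comp_apply, Submodule.subtype_apply]
    rw [parityProj_same _ x.2.2]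
  · rw [LinearMap.comp_apply, parityProj_ne _ hij hx, map_zero]

/-- If a point of `W` lies on `U ≤ W`, its values are computed after restriction to `U`. -/
theorem eval_eq_comp_restrict {U : Submodule ℂ g} (hU : U ≤ W) (p : SuperPoint W 𝒜)
    (s : SuperPoint U 𝒜) (h : p.toTensor = s.toTensor) : p.eval = s.eval.comp (restrict hU) := by
  refine coordRing_hom_ext (fun ξ => ?_) fun ξ => ?_
  · obtain ⟨η, rfl, hη⟩ := exists_extend_dual W (by decide : (1 : ZMod 2) ≠ 0) ξ
    have h1 := p.contract_toTensor η
    rw [h, s.contract_toTensor η, (LinearMap.ext fun x => hη _ x.2.2 :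
      η ∘ₗ (component W 1).subtype = 0), (LinearMap.ext fun x => hη _ x.2.2 :
      η ∘ₗ (component U 1).subtype = 0)] at h1
    simp only [map_zero, add_zero] at h1
    rw [← h1, AlgHom.comp_apply, restrict_evenCoord]
    rfl
  · obtain ⟨η, rfl, hη⟩ := exists_extend_dual W (by decide : (0 : ZMod 2) ≠ 1) ξ
    have h1 := p.contract_toTensor η
    rw [h, s.contract_toTensor η, (LinearMap.ext fun x => hη _ x.2.2 :
      η ∘ₗ (component W 0).subtype = 0), (LinearMap.ext fun x => hη _ x.2.2 :
      η ∘ₗ (component U 0).subtype = 0)] at h1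
    simp only [map_zero, zero_add] at h1
    rw [← h1, AlgHom.comp_apply, restrict_oddCoord]
    rfl

omit [FiniteDimensional ℂ g] in
theorem restrict_refl (W : Submodule ℂ g) : restrict (le_refl W) = AlgHom.id ℂ _ := by
  refine coordRing_hom_ext (fun ξ => ?_) fun ξ => ?_
  · rw [restrict_evenCoord]; rfl
  · rw [restrict_oddCoord]; rfl

theorem eval_eq_of_toTensor_eq {p q : SuperPoint W 𝒜} (h : p.toTensor = q.toTensor) :
    p.eval = q.eval := by
  rw [eval_eq_comp_restrict le_rfl p q h, restrict_refl, AlgHom.comp_id]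

theorem coordTensor_mem {i : ZMod 2} (l : Module.Dual ℂ (component W i) →ₗ[ℂ] A)
    (hl : ∀ ξ, l ξ ∈ 𝒜 i) : coordTensor (component W i).subtype l ∈ evenTensor W 𝒜 := by
  rw [coordTensor_eq_sum]
  exact sum_mem fun j _ => tmul_mem_evenTensor (Subtype.property _) (hl _)

theorem toTensor_mem (p : SuperPoint W 𝒜) : p.toTensor ∈ evenTensor W 𝒜 :=
  add_mem (coordTensor_mem _ p.eval_even) (coordTensor_mem _ p.eval_odd)

/-- The image of a point under an even homomorphism of superalgebras. -/
def map (φ : A →ₐ[ℂ] B) (hφ : ∀ i, ∀ a ∈ 𝒜 i, φ a ∈ ℬ i) (p : SuperPoint W 𝒜) :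
    SuperPoint W ℬ where
  eval := φ.comp p.eval
  eval_even ξ := hφ 0 _ (p.eval_even ξ)
  eval_odd ξ := hφ 1 _ (p.eval_odd ξ)

theorem toTensor_map (φ : A →ₐ[ℂ] B) (hφ : ∀ i, ∀ a ∈ 𝒜 i, φ a ∈ ℬ i) (p : SuperPoint W 𝒜) :
    (p.map φ hφ).toTensor = φ.toLinearMap.lTensor g p.toTensor := by
  rw [toTensor_eq, toTensor_eq, map_add]
  simp only [coordTensor_eq_sum, map_sum, LinearMap.lTensor_tmul]
  rfl

variable (W) in
/-- The generic point of `W`, with values in the coordinate ring. -/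
def generic : SuperPoint W (coordGrading W) where
  eval := AlgHom.id ℂ _
  eval_even := evenCoord_mem W
  eval_odd := oddCoord_mem W

omit [FiniteDimensional ℂ g] in
/-- The values of a point are even elements at even functions and odd ones at odd functions. -/
theorem eval_mem [GradedAlgebra 𝒜] (p : SuperPoint W 𝒜) (i : ZMod 2) {F : CoordRing W}
    (hF : F ∈ coordGrading W i) : p.eval F ∈ 𝒜 i := by
  rw [coordGrading, tensorGrading_eq_span] at hF
  refine (Submodule.span_le (p := (𝒜 i).comap p.eval.toLinearMap)).mpr ?_ hF
  rintro _ ⟨b, a, ha, rfl⟩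
  have hb : p.eval (b ⊗ₜ 1) ∈ 𝒜 0 := by
    induction b using SymmetricAlgebra.induction with
    | algebraMap r =>
      have : (algebraMap ℂ (SymmetricAlgebra ℂ (Module.Dual ℂ (component W 0))) r) ⊗ₜ[ℂ]
        (1 : ExteriorAlgebra ℂ (Module.Dual ℂ (component W 1))) =
          algebraMap ℂ (CoordRing W) r := rfl
      rw [this, AlgHom.commutes, Algebra.algebraMap_eq_smul_one]
      exact Submodule.smul_mem _ _ (SetLike.one_mem_graded 𝒜)
    | ι ξ => exact p.eval_even ξ
    | mul x y hx hy =>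
      have := SetLike.mul_mem_graded hx hy
      rwa [← map_mul, Algebra.TensorProduct.tmul_mul_tmul, one_mul, add_zero] at this
    | add x y hx hy =>
      rw [TensorProduct.add_tmul, map_add]
      exact add_mem hx hy
  have hs : ∀ a ∈ CliffordAlgebra.evenOdd (0 : QuadraticForm ℂ (Module.Dual ℂ (component W 1))) i,
      p.eval (1 ⊗ₜ a) ∈ 𝒜 i := by
    intro a ha
    induction a, ha using CliffordAlgebra.evenOdd_induction with
    | range_ι_pow v h =>
      rcases zmod_two_cases i with rfl | rfl
      · rw [ZMod.val_zero, pow_zero] at h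
        obtain ⟨r, rfl⟩ := Submodule.mem_one.mp h
        have : (1 : SymmetricAlgebra ℂ (Module.Dual ℂ (component W 0))) ⊗ₜ[ℂ]
          algebraMap ℂ (ExteriorAlgebra ℂ (Module.Dual ℂ (component W 1))) r =
            algebraMap ℂ (CoordRing W) r := (Algebra.TensorProduct.algebraMap_apply' r).symm
        erw [this]
        rw [AlgHom.commutes, Algebra.algebraMap_eq_smul_one]
        exact Submodule.smul_mem _ _ (SetLike.one_mem_graded 𝒜)
      · rw [ZMod.val_one, pow_one] at h
        obtain ⟨ξ, rfl⟩ := h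
        exact p.eval_odd ξ
    | add x y hx hy h1 h2 =>
      rw [TensorProduct.tmul_add, map_add]
      exact add_mem h1 h2
    | ι_mul_ι_mul m₁ m₂ x hx h =>
      have := SetLike.mul_mem_graded
        (SetLike.mul_mem_graded (p.eval_odd m₁) (p.eval_odd m₂)) h
      rw [← map_mul, ← map_mul, show (1 + 1 : ZMod 2) + i = i by
        rcases zmod_two_cases i with rfl | rfl <;> decide] at this
      simpa [oddCoord] using this
  have := SetLike.mul_mem_graded hb (hs a ha)
  rwa [← map_mul, Algebra.TensorProduct.tmul_mul_tmul, one_mul, mul_one, zero_add] at this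

/-- Every even tensor of `W ⊗ A` is an `A`-valued point of `W`. -/
theorem exists_toTensor_eq [GradedAlgebra 𝒜] (hA : IsSupercommutative 𝒜) {z : g ⊗[ℂ] A}
    (hz : z ∈ evenTensor W 𝒜) : ∃ p : SuperPoint W 𝒜, p.toTensor = z := by
  suffices h : ∃ l₀ : Module.Dual ℂ (component W 0) →ₗ[ℂ] A, (∀ ξ, l₀ ξ ∈ 𝒜 0) ∧
      ∃ l₁ : Module.Dual ℂ (component W 1) →ₗ[ℂ] A, (∀ ξ, l₁ ξ ∈ 𝒜 1) ∧
        coordTensor (component W 0).subtype l₀ + coordTensor (component W 1).subtype l₁ = z by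
    obtain ⟨l₀, h₀, l₁, h₁, rfl⟩ := h
    refine ⟨⟨coordLift hA l₀ h₀ l₁ h₁, fun ξ => ?_, fun ξ => ?_⟩, ?_⟩
    · rw [coordLift_evenCoord]; exact h₀ ξ
    · rw [coordLift_oddCoord]; exact h₁ ξ
    · rw [toTensor_eq]
      congr 2
      · exact LinearMap.ext (coordLift_evenCoord hA l₀ h₀ l₁ h₁)
      · exact LinearMap.ext (coordLift_oddCoord hA l₀ h₀ l₁ h₁)
  induction hz using Submodule.span_induction with
  | zero => exact ⟨0, fun _ => zero_mem _, 0, fun _ => zero_mem _, by simp [coordTensor_zero]⟩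
  | add x y _ _ hx hy =>
    obtain ⟨l₀, h₀, l₁, h₁, rfl⟩ := hx
    obtain ⟨m₀, k₀, m₁, k₁, rfl⟩ := hy
    refine ⟨l₀ + m₀, fun ξ => add_mem (h₀ ξ) (k₀ ξ), l₁ + m₁,
      fun ξ => add_mem (h₁ ξ) (k₁ ξ), ?_⟩
    rw [coordTensor_add, coordTensor_add, add_add_add_comm]
  | smul c x _ hx =>
    obtain ⟨l₀, h₀, l₁, h₁, rfl⟩ := hx
    refine ⟨c • l₀, fun ξ => Submodule.smul_mem _ _ (h₀ ξ), c • l₁,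
      fun ξ => Submodule.smul_mem _ _ (h₁ ξ), ?_⟩
    rw [coordTensor_smul, coordTensor_smul, smul_add]
  | mem x hx =>
    obtain ⟨i, x, hx, a, ha, rfl⟩ := hx
    have h : ∀ ξ : Module.Dual ℂ (component W i),
        (Module.Dual.eval ℂ (component W i) ⟨x, hx⟩).smulRight a ξ ∈ 𝒜 i :=
      fun ξ => Submodule.smul_mem _ _ ha
    rcases zmod_two_cases i with rfl | rfl
    · exact ⟨_, h, 0, fun _ => zero_mem _, by
        rw [coordTensor_smulRight, coordTensor_zero, add_zero]
        rfl⟩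
    · exact ⟨0, fun _ => zero_mem _, _, h, by
        rw [coordTensor_smulRight, coordTensor_zero, zero_add]
        rfl⟩

end SuperPoint

end LieSuperalgebra

namespace LieSuperalgebra

/-! ### The filtration of a good grading -/

section Filtration

variable {g : Type*} [AddCommGroup g] [Module ℂ g] [LieSuperalgebra g]

/-- `⨁_{m ≥ n} Γ m`. -/
def geSub (Γ : ℤ → Submodule ℂ g) (n : ℤ) : Submodule ℂ g := ⨆ m : ℤ, ⨆ _ : n ≤ m, Γ m

/-- A subspace is graded when it contains the homogeneous components of its elements. -/
def IsGraded (W : Submodule ℂ g) : Prop := ∀ i, ∀ x ∈ W, parityProj parity i x ∈ W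

variable {Γ : ℤ → Submodule ℂ g}

omit [LieSuperalgebra g] in
theorem gPos_eq_geSub : gPos Γ = geSub Γ 1 := rfl

omit [LieSuperalgebra g] in
theorem gGe_eq_geSub : gGe Γ = geSub Γ (-1) := rfl

omit [LieSuperalgebra g] in
theorem le_geSub {n m : ℤ} (h : n ≤ m) : Γ m ≤ geSub Γ n := le_iSup₂_of_le m h le_rfl

omit [LieSuperalgebra g] in
theorem geSub_antitone : Antitone (geSub Γ) :=
  fun _ _ h => iSup₂_le fun _ hm => le_geSub (h.trans hm)

omit [LieSuperalgebra g] in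
theorem geSub_eq_sup (n : ℤ) : geSub Γ n = Γ n ⊔ geSub Γ (n + 1) := by
  refine le_antisymm (iSup₂_le fun m hm => ?_)
    (sup_le (le_geSub le_rfl) (geSub_antitone (by omega)))
  rcases hm.eq_or_lt with rfl | h
  · exact le_sup_left
  · exact le_sup_of_le_right (le_geSub h)

omit [LieSuperalgebra g] in
/-- A linear map sends `geSub Γ n` into `T` when it does
so on each `Γ m`, `m ≥ n`. -/
theorem geSub_induction {V : Type*} [AddCommGroup V] [Module ℂ V] (φ : g →ₗ[ℂ] V)
    {T : Submodule ℂ V} {n : ℤ} (h : ∀ m, n ≤ m → ∀ x ∈ Γ m, φ x ∈ T) {x : g}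
    (hx : x ∈ geSub Γ n) : φ x ∈ T :=
  (iSup₂_le fun m hm x hx => h m hm x hx : geSub Γ n ≤ T.comap φ) hx

/-- Homogeneous components of brackets with an even element. -/
theorem parityProj_bracket_even {z : g} (hz : z ∈ parity (g := g) 0) (i : ZMod 2) (x : g) :
    parityProj parity i (bracket z x) = bracket z (parityProj parity i x) := by
  have h : ∀ j, ∀ x ∈ parity (g := g) j,
      parityProj parity i (bracket z x) = bracket z (parityProj parity i x) := by
    intro j x hx
    have hb := bracket_mem 0 j z hz x hx
    rw [zero_add] at hb
    by_cases hij : j = i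
    · subst hij
      rw [parityProj_same _ hb, parityProj_same _ hx]
    · rw [parityProj_ne _ hij hb, parityProj_ne _ hij hx, map_zero]
  conv_lhs => rw [← parityProj_add parity x]
  conv_rhs => rw [← parityProj_add parity x]
  simp only [map_add]
  rw [h 0 _ (parityProj_mem _ 0 x), h 1 _ (parityProj_mem _ 1 x)]

theorem isGraded_centralizer {e : g} (he : e ∈ parity (g := g) 0) : IsGraded (centralizer e) := by
  intro i x hx
  change bracket e _ = 0
  rw [← parityProj_bracket_even he, show bracket e x = 0 from hx, map_zero]

namespace IsGoodGrading

variable {f : g} (hΓ : IsGoodGrading Γ f)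
include hΓ

theorem isGraded_geSub (n : ℤ) : IsGraded (geSub Γ n) := fun i _ hx =>
  geSub_induction _ (fun m hm x hx => le_geSub hm (hΓ.homogeneous m i x hx)) hx

theorem isGraded_gIni : IsGraded (gIni Γ) := fun i _ hx =>
  (sup_le (fun x hx => Submodule.mem_sup_left (hΓ.homogeneous (-1) i x hx))
    (fun x hx => Submodule.mem_sup_right (hΓ.homogeneous 0 i x hx)) :
    gIni Γ ≤ (gIni Γ).comap (parityProj parity i)) hx

theorem bracket_mem_geSub {a b : ℤ} {x y : g} (hx : x ∈ geSub Γ a) (hy : y ∈ geSub Γ b) :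
    bracket x y ∈ geSub Γ (a + b) := by
  refine geSub_induction (bracket x) (fun n hn y hy => ?_) hy
  refine geSub_induction (bracket.flip y) (fun m hm x hx => ?_) hx
  exact le_geSub (by omega) (hΓ.bracket_mem m n x hx y hy)

/-- The grading has finitely many non-zero components. -/
theorem exists_bound [FiniteDimensional ℂ g] :
    ∃ M : ℕ, geSub Γ M = ⊥ ∧ geSub Γ (-M) = ⊤ := by
  have hfin := WellFoundedGT.finite_ne_bot_of_iSupIndep hΓ.internal.submodule_iSupIndep
  obtain ⟨M, hM⟩ : ∃ M : ℕ, ∀ n, Γ n ≠ ⊥ → -(M : ℤ) ≤ n ∧ n < M := by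
    obtain ⟨a, ha⟩ := hfin.bddAbove
    obtain ⟨b, hb⟩ := hfin.bddBelow
    refine ⟨(a + 1).toNat + (-b).toNat, fun n hn => ?_⟩
    have h1 := ha hn
    have h2 := hb hn
    omega
  refine ⟨M, ?_, ?_⟩
  · refine iSup₂_eq_bot.mpr fun n hn => ?_
    by_contra h
    have := (hM n h).2
    omega
  · rw [eq_top_iff, ← hΓ.internal.submodule_iSup_eq_top]
    refine iSup_le fun n => ?_
    by_cases h : Γ n = ⊥
    · rw [h]; exact bot_le
    · exact le_geSub (hM n h).1

/-- Distinct components of the grading are independent. -/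
theorem disjoint_geSub_succ (n : ℤ) : Disjoint (Γ n) (geSub Γ (n + 1)) :=
  (hΓ.internal.submodule_iSupIndep n).mono_right
    (iSup₂_le fun m hm => le_iSup₂_of_le m (by omega) le_rfl)

end IsGoodGrading

end Filtration

/-! ### Splittings of a good grading and slice data in Grassmann envelopes -/

section Splitting

variable {g : Type*} [AddCommGroup g] [Module ℂ g] [LieSuperalgebra g]

/-- Filtrations `U` of `g_+` and `V` of `g_{≥ -1/2}` and a complement `C` of `[f₀, U 1]` in `V 1`,
such that `V k ⊆ [f₀, U k] ⊕ C`. -/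
structure SliceSplitting (Γ : ℤ → Submodule ℂ g) (f₀ : g) where
  /-- The filtration of `g_+`. -/
  U : ℕ → Submodule ℂ g
  /-- The filtration of `g_{≥ -1/2}`. -/
  V : ℕ → Submodule ℂ g
  /-- The complement. -/
  C : Submodule ℂ g
  even : f₀ ∈ parity (g := g) 0
  U_antitone : Antitone U
  V_antitone : Antitone V
  U_le : U 1 ≤ gPos Γ
  V_le : V 1 ≤ gGe Γ
  C_le : C ≤ V 1
  bracket_UU : ∀ a b, ∀ x ∈ U a, ∀ y ∈ U b, bracket x y ∈ U (a + b)
  bracket_UV : ∀ a b, ∀ x ∈ U a, ∀ y ∈ V b, bracket x y ∈ V (a + b)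
  bracket_Uf : ∀ a, ∀ x ∈ U a, bracket x f₀ ∈ V a
  graded_U : IsGraded (U 1)
  graded_C : IsGraded C
  injective : ∀ y ∈ U 1, bracket f₀ y ∈ C → y = 0
  exists_decomp : ∀ k, 1 ≤ k → ∀ x ∈ V k, ∃ y ∈ U k, x - bracket f₀ y ∈ C

namespace SliceSplitting

variable {Γ : ℤ → Submodule ℂ g} {f₀ : g} (S : SliceSplitting Γ f₀)

theorem exists_theta : ∃ θ : g →ₗ[ℂ] g, (∀ i, ∀ x ∈ parity (g := g) i, θ x ∈ parity (g := g) i) ∧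
    ∀ y ∈ S.U 1, ∀ c ∈ S.C, θ (bracket f₀ y + c) = y := by
  let Ψ : S.U 1 × S.C →ₗ[ℂ] g := (bracket f₀ ∘ₗ (S.U 1).subtype).coprod S.C.subtype
  have hΨ : LinearMap.ker Ψ = ⊥ := by
    rw [LinearMap.ker_eq_bot']
    rintro ⟨y, c⟩ h
    replace h : bracket f₀ (y : g) + c = 0 := h
    have hy : (y : g) = 0 := S.injective y y.2 (by
      rw [eq_neg_of_add_eq_zero_left h]; exact neg_mem c.2)
    rw [hy, map_zero, zero_add] at h
    exact Prod.ext (Subtype.ext hy) (Subtype.ext h)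
  obtain ⟨l, hl⟩ := LinearMap.exists_leftInverse_of_injective Ψ hΨ
  let θ' : g →ₗ[ℂ] g := (S.U 1).subtype ∘ₗ LinearMap.fst ℂ _ _ ∘ₗ l
  have hθ' : ∀ y ∈ S.U 1, ∀ c ∈ S.C, θ' (bracket f₀ y + c) = y := fun y hy c hc =>
    congrArg (fun v => ((v.1 : S.U 1) : g)) (LinearMap.congr_fun hl (⟨y, hy⟩, ⟨c, hc⟩))
  refine ⟨parityProj parity 0 ∘ₗ θ' ∘ₗ parityProj parity 0 +
    parityProj parity 1 ∘ₗ θ' ∘ₗ parityProj parity 1, fun i x hx => ?_, fun y hy c hc => ?_⟩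
  · simp only [LinearMap.add_apply, LinearMap.comp_apply]
    rcases zmod_two_cases i with rfl | rfl
    · rw [parityProj_ne _ (by decide : (0 : ZMod 2) ≠ 1) hx, map_zero, map_zero, add_zero]
      exact parityProj_mem _ _ _
    · rw [parityProj_ne _ (by decide : (1 : ZMod 2) ≠ 0) hx, map_zero, map_zero, zero_add]
      exact parityProj_mem _ _ _
  · have h : ∀ i, θ' (parityProj parity i (bracket f₀ y + c)) = parityProj parity i y := by
      intro i
      rw [map_add, parityProj_bracket_even S.even,
        hθ' _ (S.graded_U i y hy) _ (S.graded_C i c hc)]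
    simp only [LinearMap.add_apply, LinearMap.comp_apply]
    rw [h, h, parityProj_same _ (parityProj_mem _ 0 y), parityProj_same _ (parityProj_mem _ 1 y),
      parityProj_add]

/-- A parity preserving linear map inverting `[f₀, ·]` on `U 1` and vanishing on `C`. -/
def θ : g →ₗ[ℂ] g := S.exists_theta.choose

theorem θ_parity {i : ZMod 2} {x : g} (hx : x ∈ parity (g := g) i) : S.θ x ∈ parity (g := g) i :=
  S.exists_theta.choose_spec.1 i x hx

theorem θ_eq {x y : g} (hy : y ∈ S.U 1) (hx : x - bracket f₀ y ∈ S.C) : S.θ x = y := by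
  rw [← S.exists_theta.choose_spec.2 y hy _ hx, add_sub_cancel]
  rfl

theorem θ_mem {k : ℕ} (hk : 1 ≤ k) {x : g} (hx : x ∈ S.V k) : S.θ x ∈ S.U k := by
  obtain ⟨y, hy, hxy⟩ := S.exists_decomp k hk x hx
  rwa [S.θ_eq (S.U_antitone hk hy) hxy]

theorem sub_bracket_θ_mem {x : g} (hx : x ∈ S.V 1) : x - bracket f₀ (S.θ x) ∈ S.C := by
  obtain ⟨y, hy, hxy⟩ := S.exists_decomp 1 le_rfl x hx
  rwa [S.θ_eq hy hxy]

theorem θ_of_mem_C {x : g} (hx : x ∈ S.C) : S.θ x = 0 :=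
  S.θ_eq (zero_mem _) (by simpa using hx)

theorem θ_bracket {y : g} (hy : y ∈ S.U 1) : S.θ (bracket f₀ y) = y :=
  S.θ_eq hy (by simp)

end SliceSplitting

end Splitting

/-- A decreasing multiplicative filtration of a superalgebra by graded subspaces. -/
structure CoeffFiltration {A : Type*} [Ring A] [Algebra ℂ A] (𝒜 : ZMod 2 → Submodule ℂ A) where
  /-- The components of the filtration. -/
  comp : ℕ → ZMod 2 → Submodule ℂ A
  le : ∀ k i, comp k i ≤ 𝒜 i
  antitone : Antitone comp
  mul_mem : ∀ k l i j, ∀ a ∈ comp k i, ∀ b ∈ comp l j, a * b ∈ comp (k + l) (i + j)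

/-- The constant filtration. -/
def CoeffFiltration.const {A : Type*} [Ring A] [Algebra ℂ A] (𝒜 : ZMod 2 → Submodule ℂ A)
    [GradedAlgebra 𝒜] : CoeffFiltration 𝒜 where
  comp _ := 𝒜
  le _ _ := le_rfl
  antitone _ _ _ := le_rfl
  mul_mem _ _ _ _ _ ha _ hb := SetLike.mul_mem_graded ha hb

/-- The filtration by the powers of an even element. -/
def CoeffFiltration.powers {A : Type*} [Ring A] [Algebra ℂ A] {𝒜 : ZMod 2 → Submodule ℂ A}
    [GradedAlgebra 𝒜] (hA : IsSupercommutative 𝒜) {τ : A} (hτ : τ ∈ 𝒜 0) :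
    CoeffFiltration 𝒜 where
  comp k i := (𝒜 i).map (LinearMap.mulLeft ℂ (τ ^ k))
  le k i := by
    rintro _ ⟨a, ha, rfl⟩
    have := SetLike.mul_mem_graded (SetLike.pow_mem_graded k hτ) ha
    simpa using this
  antitone k l hkl i := by
    rintro _ ⟨a, ha, rfl⟩
    refine ⟨τ ^ (l - k) * a, ?_, ?_⟩
    · have := SetLike.mul_mem_graded (SetLike.pow_mem_graded (l - k) hτ) ha
      simpa using this
    · simp only [LinearMap.mulLeft_apply]
      rw [← mul_assoc, ← pow_add, Nat.add_sub_cancel' hkl]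
  mul_mem k l i j := by
    rintro _ ⟨a, ha, rfl⟩ _ ⟨b, hb, rfl⟩
    refine ⟨a * b, SetLike.mul_mem_graded ha hb, ?_⟩
    have h0 : τ ^ l ∈ 𝒜 0 := by simpa using SetLike.pow_mem_graded l hτ
    have hc := Subalgebra.mem_center_iff.mp (IsSupercommutative.mem_center hA h0) a
    simp only [LinearMap.mulLeft_apply]
    rw [pow_add, mul_assoc (τ ^ k) a, ← mul_assoc a, hc, mul_assoc, mul_assoc]

section Datum

variable {g : Type*} [AddCommGroup g] [Module ℂ g] [LieSuperalgebra g]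
  {A : Type*} [Ring A] [Algebra ℂ A] {𝒜 : ZMod 2 → Submodule ℂ A}

theorem evenTensor_mono_right {W : Submodule ℂ g} {ℬ ℬ' : ZMod 2 → Submodule ℂ A} (h : ℬ ≤ ℬ') :
    evenTensor W ℬ ≤ evenTensor W ℬ' :=
  Submodule.span_mono fun _ ⟨i, x, hx, a, ha, r⟩ => ⟨i, x, hx, a, h i ha, r⟩

variable [GradedAlgebra 𝒜]

theorem tensorBracket_mem_evenTensor_of_mul_mem {W W' W'' : Submodule ℂ g}
    {ℬ ℬ' ℬ'' : ZMod 2 → Submodule ℂ A} (hℬ : ℬ ≤ 𝒜)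
    (h : ∀ x ∈ W, ∀ y ∈ W', bracket x y ∈ W'')
    (hmul : ∀ i j, ∀ a ∈ ℬ i, ∀ b ∈ ℬ' j, a * b ∈ ℬ'' (i + j)) {z w : g ⊗[ℂ] A}
    (hz : z ∈ evenTensor W ℬ) (hw : w ∈ evenTensor W' ℬ') :
    tensorBracket 𝒜 z w ∈ evenTensor W'' ℬ'' := by
  refine evenTensor_induction (tensorBracket 𝒜 z) _ (fun j y hy b hb => ?_) hw
  refine evenTensor_induction ((tensorBracket 𝒜).flip (y ⊗ₜ b)) _ (fun i x hx a ha => ?_) hz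
  rw [LinearMap.flip_apply, tensorBracket_tmul 𝒜 x hy.2 (hℬ i ha)]
  exact Submodule.smul_mem _ _ (tmul_mem_evenTensor
    ⟨h x hx.1 y hy.1, bracket_mem i j x hx.2 y hy.2⟩ (hmul i j a ha b hb))

namespace Envelope

/-- The even part of `W ⊗ A` as a subspace of the Grassmann envelope, with coefficients restricted
to `ℬ`. -/
def sub (W : Submodule ℂ g) (ℬ : ZMod 2 → Submodule ℂ A) : Submodule ℂ (Envelope g 𝒜) :=
  (evenTensor W ℬ).comap val

omit [GradedAlgebra 𝒜] in
theorem mem_sub {W : Submodule ℂ g} {ℬ : ZMod 2 → Submodule ℂ A} {z : Envelope g 𝒜} :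
    z ∈ sub W ℬ ↔ val z ∈ evenTensor W ℬ := Iff.rfl

/-- An even element of `g` as an element of the Grassmann envelope. -/
def incl (𝒜 : ZMod 2 → Submodule ℂ A) [GradedAlgebra 𝒜] {x : g} (hx : x ∈ parity (g := g) 0) :
    Envelope g 𝒜 :=
  mk (x ⊗ₜ 1) (tmul_mem_evenTensor ⟨Submodule.mem_top, hx⟩ (SetLike.one_mem_graded 𝒜))

/-- Extension of scalars of a parity preserving linear map. -/
def mapLeft {θ : g →ₗ[ℂ] g} (hθ : ∀ i, ∀ x ∈ parity (g := g) i, θ x ∈ parity (g := g) i) :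
    Envelope g 𝒜 →ₗ[ℂ] Envelope g 𝒜 :=
  LinearMap.restrict (θ.rTensor A) fun _ hz =>
    rTensor_mem_evenTensor (fun i x hx => ⟨Submodule.mem_top, hθ i x hx.2⟩) hz

end Envelope

open Envelope in
/-- The slice datum in a Grassmann envelope attached to a splitting. -/
def SliceSplitting.datum [Fact (IsSupercommutative 𝒜)] {Γ : ℤ → Submodule ℂ g} {f f₀ : g}
    (hΓ : IsGoodGrading Γ f)
    (S : SliceSplitting Γ f₀) (ℬ : CoeffFiltration 𝒜) {M : ℕ} (hM : geSub Γ M = ⊥)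
    (hM' : geSub Γ (-M) = ⊤) {N : ℕ} (hN : 2 * M + 2 ≤ N)
    (hbot : S.U N = ⊥ ∨ ∀ i, ℬ.comp N i = ⊥) : LieSlice.SliceDatum (Envelope g 𝒜) where
  f := incl 𝒜 S.even
  G k := sub (S.U k) (ℬ.comp k)
  P k := sub (S.V k) (ℬ.comp k)
  F b := sub (geSub Γ (b - M)) 𝒜
  C := sub S.C (ℬ.comp 1)
  θ := mapLeft fun _ _ hx => S.θ_parity hx
  N := N
  two_le := by omega
  G_antitone _ _ h := Submodule.comap_mono
    ((evenTensor_mono (S.U_antitone h)).trans (evenTensor_mono_right (ℬ.antitone h)))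
  P_antitone _ _ h := Submodule.comap_mono
    ((evenTensor_mono (S.V_antitone h)).trans (evenTensor_mono_right (ℬ.antitone h)))
  lie_GG a b _ hx _ hy := tensorBracket_mem_evenTensor_of_mul_mem (ℬ.le a) (S.bracket_UU a b)
    (ℬ.mul_mem a b) hx hy
  lie_GP a b _ hx _ hy := tensorBracket_mem_evenTensor_of_mul_mem (ℬ.le a) (S.bracket_UV a b)
    (ℬ.mul_mem a b) hx hy
  lie_Gf a x hx := by
    change (tensorBracket 𝒜).flip (f₀ ⊗ₜ (1 : A)) (val x) ∈ evenTensor (S.V a) (ℬ.comp a)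
    refine evenTensor_induction _ _ ?_ hx
    intro i x hx a ha
    rw [LinearMap.flip_apply, tensorBracket_tmul 𝒜 x S.even (ℬ.le _ i ha), mul_one]
    refine Submodule.smul_mem _ _ (tmul_mem_evenTensor ⟨S.bracket_Uf _ x hx.1, ?_⟩ ha)
    simpa using bracket_mem i 0 x hx.2 f₀ S.even
  lie_GF b x hx y hy := by
    refine tensorBracket_mem_evenTensor_of_mul_mem (ℬ.le 1) (fun x hx y hy => ?_)
      (fun i j a ha b hb => SetLike.mul_mem_graded (ℬ.le _ i ha) hb) hx hy
    have := hΓ.bracket_mem_geSub (S.U_le hx) hy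
    rwa [Nat.cast_succ, show ((b : ℤ) + 1 - M) = 1 + (b - M) by ring]
  G_eq_bot := by
    rw [eq_bot_iff]
    intro z hz
    rw [mem_sub] at hz
    refine val_injective (Eq.trans ?_ (map_zero _).symm)
    refine (evenTensor_induction LinearMap.id ⊥ (fun i x hx a ha => ?_) hz :)
    rcases hbot with h | h
    · rw [h] at hx
      rw [(Submodule.mem_bot ℂ).mp hx.1, TensorProduct.zero_tmul, map_zero]
      exact zero_mem _
    · rw [h] at ha
      rw [(Submodule.mem_bot ℂ).mp ha, TensorProduct.tmul_zero, map_zero]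
      exact zero_mem _
  F_zero := by
    rw [eq_top_iff]
    intro z _
    rw [mem_sub, Nat.cast_zero, zero_sub, hM']
    exact val_mem z
  F_eq_bot := by
    have h : geSub Γ (N - M) = ⊥ := by
      rw [eq_bot_iff, ← hM]
      exact geSub_antitone (by omega)
    rw [eq_bot_iff]
    intro z hz
    rw [mem_sub, h, evenTensor_bot] at hz
    exact val_injective ((Submodule.mem_bot ℂ).mp hz)
  θ_mem k hk _ hx := rTensor_mem_evenTensor
    (fun _ _ hx => ⟨S.θ_mem hk hx.1, S.θ_parity hx.2⟩) hx
  C_le := Submodule.comap_mono (evenTensor_mono S.C_le)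
  sub_lie_mem x hx := by
    change (LinearMap.id - tensorBracket 𝒜 (f₀ ⊗ₜ (1 : A)) ∘ₗ S.θ.rTensor A :
      g ⊗[ℂ] A →ₗ[ℂ] g ⊗[ℂ] A) (val x) ∈
      evenTensor S.C (ℬ.comp 1)
    refine evenTensor_induction _ _ ?_ hx
    intro i x hx a ha
    rw [LinearMap.sub_apply, LinearMap.comp_apply, LinearMap.rTensor_tmul,
      tensorBracket_tmul 𝒜 f₀ (S.θ_parity hx.2) (SetLike.one_mem_graded 𝒜), superSign_zero_left,
      one_smul, one_mul, LinearMap.id_apply, ← TensorProduct.sub_tmul]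
    refine tmul_mem_evenTensor ⟨S.sub_bracket_θ_mem hx.1, sub_mem hx.2 ?_⟩ ha
    simpa using bracket_mem 0 i f₀ S.even _ (S.θ_parity hx.2)
  θ_C x hx := by
    refine val_injective (evenTensor_induction_eq (S.θ.rTensor A) 0 (fun i x hx a _ => ?_) hx)
    rw [LinearMap.rTensor_tmul, S.θ_of_mem_C hx.1, TensorProduct.zero_tmul]
    rfl
  θ_lie y hy := by
    refine val_injective (evenTensor_induction_eq
      (S.θ.rTensor A ∘ₗ tensorBracket 𝒜 (f₀ ⊗ₜ (1 : A))) LinearMap.id (fun i x hx a _ => ?_) hy)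
    rw [LinearMap.comp_apply, tensorBracket_tmul 𝒜 f₀ hx.2 (SetLike.one_mem_graded 𝒜),
      superSign_zero_left, one_smul, one_mul, LinearMap.rTensor_tmul, S.θ_bracket hx.1]
    rfl

end Datum

end LieSuperalgebra

namespace LieSuperalgebra

/-! ### The action of the unipotent group -/

section Action

variable {g : Type*} [AddCommGroup g] [Module ℂ g] [LieSuperalgebra g]
  {A : Type*} [Ring A] [Algebra ℂ A] {𝒜 : ZMod 2 → Submodule ℂ A} [GradedAlgebra 𝒜]
  {Γ : ℤ → Submodule ℂ g} {f : g}

theorem tensorBracket_mem_range {W W' : Submodule ℂ g} (hW : IsGraded W) {y : g}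
    (h : ∀ x ∈ W, bracket y x ∈ W') (a : A) {z : g ⊗[ℂ] A}
    (hz : z ∈ LinearMap.range (W.subtype.rTensor A)) :
    tensorBracket 𝒜 (y ⊗ₜ a) z ∈ LinearMap.range (W'.subtype.rTensor A) := by
  obtain ⟨z, rfl⟩ := hz
  induction z using TensorProduct.induction_on with
  | zero => simp
  | add z w hz hw => rw [map_add, map_add]; exact add_mem hz hw
  | tmul x b =>
    have hmem : ∀ v ∈ W', ∀ c : A, v ⊗ₜ[ℂ] c ∈ LinearMap.range (W'.subtype.rTensor A) :=
      fun v hv c => ⟨(⟨v, hv⟩ : W') ⊗ₜ c, by simp⟩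
    simp only [tensorBracket, LinearMap.rTensor_tmul, LinearMap.add_apply,
      TensorProduct.map₂_apply_tmul, Submodule.subtype_apply]
    exact add_mem (hmem _ (h _ (hW 0 x x.2)) _) (hmem _ (h _ (hW 1 x x.2)) _)

/-- Elements of `(g_+ ⊗ A)₀` are `ad`-nilpotent on all of `g ⊗ A`. -/
theorem isNilpotent_tensorBracket [FiniteDimensional ℂ g] (hΓ : IsGoodGrading Γ f)
    {y : g ⊗[ℂ] A} (hy : y ∈ evenTensor (gPos Γ) 𝒜) :
    IsNilpotent (tensorBracket 𝒜 y : Module.End ℂ (g ⊗[ℂ] A)) := by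
  obtain ⟨M, hM, hM'⟩ := hΓ.exists_bound
  have hstep : ∀ n : ℤ, ∀ z ∈ LinearMap.range ((geSub Γ n).subtype.rTensor A),
      tensorBracket 𝒜 y z ∈ LinearMap.range ((geSub Γ (n + 1)).subtype.rTensor A) := by
    intro n z hz
    refine evenTensor_induction ((tensorBracket 𝒜).flip z) _ (fun i x hx a _ => ?_) hy
    refine tensorBracket_mem_range (hΓ.isGraded_geSub n) (fun w hw => ?_) a hz
    rw [add_comm]
    exact hΓ.bracket_mem_geSub hx.1 hw
  have hpow : ∀ (n : ℕ) (z : g ⊗[ℂ] A), ((tensorBracket 𝒜 y : Module.End ℂ (g ⊗[ℂ] A)) ^ n) z ∈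
      LinearMap.range ((geSub Γ (n - M)).subtype.rTensor A) := by
    intro n z
    induction n with
    | zero =>
      rw [Nat.cast_zero, zero_sub, hM']
      exact (LinearMap.rTensor_surjective A
        (LinearMap.range_eq_top.mp (Submodule.range_subtype ⊤))) _
    | succ n ih =>
      rw [pow_succ', Module.End.mul_apply, Nat.cast_succ, show (n : ℤ) + 1 - M = n - M + 1 by ring]
      exact hstep _ _ ih
  refine ⟨2 * M, LinearMap.ext fun z => ?_⟩
  have h := hpow (2 * M) z
  rw [show ((2 * M : ℕ) : ℤ) - M = M by push_cast; ring, hM] at h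
  obtain ⟨w, hw⟩ := h
  have h0 : (⊥ : Submodule ℂ g).subtype = 0 := LinearMap.ext fun x => (Submodule.mem_bot ℂ).mp x.2
  rw [← hw, h0, LinearMap.rTensor_zero]
  rfl

open Envelope LieSlice in
/-- On the Grassmann envelope the action of `exp y` agrees with the exponential of `-ad y`
truncated at any order that annihilates `ad y`. -/
theorem expNegAd_val [FiniteDimensional ℂ g] [Fact (IsSupercommutative 𝒜)]
    (hΓ : IsGoodGrading Γ f) {y : Envelope g 𝒜} (hy : val y ∈ evenTensor (gPos Γ) 𝒜) {N : ℕ}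
    (hN : (LieAlgebra.ad ℂ (Envelope g 𝒜) y) ^ N = 0) (z : Envelope g 𝒜) :
    expNegAd 𝒜 (val y) (val z) = val (expTrunc N (LieAlgebra.ad ℂ (Envelope g 𝒜) (-y)) z) := by
  set X : Module.End ℂ (g ⊗[ℂ] A) := tensorBracket 𝒜 (val y) with hX
  set c : ℕ → ℂ := fun n => (-1) ^ n / (n.factorial : ℂ)
  set K := nilpotencyClass X
  have hK : X ^ K = 0 := pow_nilpotencyClass (isNilpotent_tensorBracket hΓ hy)
  have hval : ∀ n, val (((LieAlgebra.ad ℂ (Envelope g 𝒜) y) ^ n) z) = (X ^ n) (val z) := by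
    intro n
    induction n with
    | zero => simp
    | succ n ih => rw [pow_succ', pow_succ', Module.End.mul_apply, Module.End.mul_apply, ← ih]; rfl
  have hKy : (X ^ K) (val z) = 0 := by rw [hK]; rfl
  have h1 : expNegAd 𝒜 (val y) (val z) = ∑ n ∈ Finset.range (K + N), c n • (X ^ n) (val z) := by
    refine Finset.sum_subset (Finset.range_subset_range.mpr (Nat.le_add_right _ _)) fun n _ hn => ?_
    rw [← hX, pow_eq_zero_of_le (by simpa using hn) hK, LinearMap.zero_apply, smul_zero]
  have h2 : expTrunc N (LieAlgebra.ad ℂ (Envelope g 𝒜) (-y)) z =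
      ∑ n ∈ Finset.range (K + N), c n • ((LieAlgebra.ad ℂ (Envelope g 𝒜) y) ^ n) z := by
    have : ∀ n, (n.factorial : ℂ)⁻¹ • (LieAlgebra.ad ℂ (Envelope g 𝒜) (-y)) ^ n =
        c n • (LieAlgebra.ad ℂ (Envelope g 𝒜) y) ^ n := by
      intro n
      rw [map_neg, ← neg_one_smul ℂ (LieAlgebra.ad ℂ (Envelope g 𝒜) y), smul_pow, smul_smul,
        mul_comm, ← div_eq_mul_inv]
    rw [expTrunc]
    simp only [this, LinearMap.sum_apply, LinearMap.smul_apply]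
    refine Finset.sum_subset (Finset.range_subset_range.mpr (Nat.le_add_left _ _)) fun n _ hn => ?_
    rw [pow_eq_zero_of_le (by simpa using hn) hN, LinearMap.zero_apply, smul_zero]
  rw [h1, h2, map_sum]
  simp only [map_smul, hval]

end Action

section Invariance

open Envelope

variable {g : Type u} [AddCommGroup g] [Module ℂ g] [LieSuperalgebra g] [FiniteDimensional ℂ g]
  {A : Type u} [Ring A] [Algebra ℂ A] {𝒜 : ZMod 2 → Submodule ℂ A} [GradedAlgebra 𝒜]
  [Fact (IsSupercommutative 𝒜)] {Γ : ℤ → Submodule ℂ g} {f f₀ z : g}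

/-- An invariant function takes the same value at a point `f + z + w` and at the point of the slice
through `f + z` to which the iteration of a slice datum leads. -/
theorem eval_proj_eq (hΓ : IsGoodGrading Γ f) (hf : f ∈ parity (g := g) 0) (hz : z ∈ gGe Γ)
    (hfz : f₀ = f + z) (S : SliceSplitting Γ f₀)
    (ℬ : CoeffFiltration 𝒜) {M : ℕ} (hM : geSub Γ M = ⊥) (hM' : geSub Γ (-M) = ⊤) {N : ℕ}
    (hN : 2 * M + 2 ≤ N) (hbot : S.U N = ⊥ ∨ ∀ i, ℬ.comp N i = ⊥) {F : CoordRing (gGe Γ)}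
    (hF : F ∈ invariants Γ f) {w : Envelope g 𝒜} (hw : w ∈ (S.datum hΓ ℬ hM hM' hN hbot).P 1)
    (p q : SuperPoint (gGe Γ) 𝒜) (hp : p.toTensor = z ⊗ₜ 1 + val w)
    (hq : q.toTensor = z ⊗ₜ 1 + val ((S.datum hΓ ℬ hM hM' hN hbot).proj w)) :
    q.eval F = p.eval F := by
  set D := S.datum hΓ ℬ hM hM' hN hbot with hD
  have hA : IsSupercommutative 𝒜 := Fact.out
  have hz0 : z ∈ parity (g := g) 0 := by simpa [hfz] using sub_mem S.even hf
  have hP : ∀ w ∈ D.P 1, val w ∈ evenTensor (gGe Γ) 𝒜 := fun w hw =>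
    evenTensor_mono S.V_le (evenTensor_mono_right (ℬ.le 1) hw)
  have hzm : z ⊗ₜ[ℂ] (1 : A) ∈ evenTensor (gGe Γ) 𝒜 :=
    tmul_mem_evenTensor ⟨hz, hz0⟩ (SetLike.one_mem_graded 𝒜)
  have key : ∀ n : ℕ, ∀ q : SuperPoint (gGe Γ) 𝒜, q.toTensor = z ⊗ₜ 1 + val (D.step^[n] w) →
      q.eval F = p.eval F := by
    intro n
    induction n with
    | zero =>
      intro q hq
      rw [SuperPoint.eval_eq_of_toTensor_eq (hq.trans hp.symm)]
    | succ n ih =>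
      intro q hq
      rw [Function.iterate_succ_apply'] at hq
      set v := D.step^[n] w
      have hv : v ∈ D.P 1 := D.iterate_step_mem hw n
      obtain ⟨r, hr⟩ := SuperPoint.exists_toTensor_eq hA (add_mem hzm (hP v hv))
      rw [← ih r hr]
      have hθ : D.θ v ∈ D.G 1 := D.θ_mem 1 le_rfl v hv
      have hθ' : val (-D.θ v) ∈ evenTensor (gPos Γ) 𝒜 := by
        rw [map_neg]
        exact neg_mem (evenTensor_mono S.U_le (evenTensor_mono_right (ℬ.le 1) hθ))
      obtain ⟨Y, hY⟩ := SuperPoint.exists_toTensor_eq hA hθ'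
      refine hF A 𝒜 hA Y r q ?_
      have hbase : ∀ x : Envelope g 𝒜, f ⊗ₜ[ℂ] (1 : A) + (z ⊗ₜ 1 + val x) = val (D.f + x) := by
        intro x
        rw [map_add, ← add_assoc, ← TensorProduct.add_tmul, ← hfz]
        rfl
      rw [hq, hr, hY, hbase, hbase, D.f_add_step, expNegAd_val hΓ hθ'
        (D.ad_pow_eq_zero (neg_mem hθ)), neg_neg]
      rfl
  exact key _ q hq

end Invariance

end LieSuperalgebra

namespace LieSuperalgebra

/-! ### Consequences of the `sl₂`-triple -/

section Sl2

attribute [local instance] LieRing.ofAssociativeRing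

variable {g : Type*} [AddCommGroup g] [Module ℂ g] [LieSuperalgebra g]
  {Γ : ℤ → Submodule ℂ g} {e h f : g}

namespace IsGradedSl2Triple

variable (t : IsGradedSl2Triple Γ e h f)
include t

theorem bracket_h_e (x : g) :
    bracket h (bracket e x) = bracket e (bracket h x) + (2 : ℂ) • bracket e x := by
  rw [jacobi 0 0 h t.h_even e t.e_even, t.h_e, superSign_zero_left, one_smul, map_smul,
    LinearMap.smul_apply, add_comm]

theorem bracket_h_f (x : g) :
    bracket h (bracket f x) = bracket f (bracket h x) - (2 : ℂ) • bracket f x := by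
  rw [jacobi 0 0 h t.h_even f t.f_even, t.h_f, superSign_zero_left, one_smul, map_smul,
    LinearMap.smul_apply, neg_smul]
  abel

theorem bracket_e_f (x : g) : bracket e (bracket f x) = bracket f (bracket e x) + bracket h x := by
  rw [jacobi 0 0 e t.e_even f t.f_even, t.e_f, superSign_zero_left, one_smul, add_comm]

theorem bracket_h_e_pow (j : ℕ) (x : g) : bracket h (((bracket e : Module.End ℂ g) ^ j) x) =
    ((bracket e : Module.End ℂ g) ^ j) (bracket h x + (2 * j : ℂ) • x) := by
  induction j generalizing x with
  | zero => simp
  | succ j ih =>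
    rw [pow_succ, Module.End.mul_apply, Module.End.mul_apply, ih, t.bracket_h_e,
      map_add (bracket e),
      map_smul (bracket e), add_assoc, ← add_smul]
    push_cast
    ring_nf

theorem bracket_e_pow_f (j : ℕ) (x : g) :
    ((bracket e : Module.End ℂ g) ^ (j + 1)) (bracket f x) =
      bracket f (((bracket e : Module.End ℂ g) ^ (j + 1)) x) +
        (j + 1 : ℂ) • ((bracket e : Module.End ℂ g) ^ j) (bracket h x + (j : ℂ) • x) := by
  induction j with
  | zero => simp [t.bracket_e_f]
  | succ j ih =>
    have hs : ∀ w, bracket e (((bracket e : Module.End ℂ g) ^ j) w) =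
        ((bracket e : Module.End ℂ g) ^ (j + 1)) w := fun w => by
      rw [pow_succ', Module.End.mul_apply]
    rw [pow_succ', Module.End.mul_apply, ih, map_add, t.bracket_e_f, t.bracket_h_e_pow,
      map_smul, hs, Module.End.mul_apply]
    simp only [map_add, map_smul]
    push_cast
    module

/-- The image of `ad f` and the kernel of `ad e` intersect trivially. The eigenvalues of `ad h` on
the intersection are natural numbers, as for all primitive vectors; on the other hand, writing an
eigenvector as `[f, y]`, descending induction along the powers of `ad e` annihilating `y` shows
that it vanishes. -/
theorem eq_zero_of_bracket_e_f [FiniteDimensional ℂ g]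
    (he : IsNilpotent (bracket e : Module.End ℂ g)) {y : g}
    (hy : bracket e (bracket f y) = 0) : bracket f y = 0 := by
  by_contra hne
  let Z : Submodule ℂ g := LinearMap.range (bracket f) ⊓ LinearMap.ker (bracket e)
  have hZ : ∀ x ∈ Z, bracket h x ∈ Z := by
    rintro _ ⟨⟨y, rfl⟩, hx⟩
    have hx : bracket e (bracket f y) = 0 := hx
    refine ⟨⟨bracket h y - (2 : ℂ) • y, ?_⟩, ?_⟩
    · rw [t.bracket_h_f, map_sub, map_smul]
    · change bracket e (bracket h (bracket f y)) = 0
      have := t.bracket_h_e (bracket f y)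
      rw [hx, map_zero, smul_zero, add_zero] at this
      exact this.symm
  have : Nontrivial Z := ⟨⟨⟨bracket f y, ⟨y, rfl⟩, hy⟩, 0, fun h => hne (congrArg Subtype.val h)⟩⟩
  obtain ⟨μ, hμ⟩ := Module.End.exists_eigenvalue ((bracket h).restrict hZ)
  obtain ⟨⟨x, ⟨y, hxy⟩, hex⟩, hev, hx0⟩ := hμ.exists_hasEigenvector
  have hx0 : x ≠ 0 := fun h => hx0 (Subtype.ext h)
  have hhx : bracket h x = μ • x := congrArg Subtype.val (Module.End.mem_eigenspace_iff.mp hev)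
  have hex : bracket e x = 0 := hex
  have htr : IsSl2Triple (L := Module.End ℂ g) (bracket h) (bracket e) (bracket f) := by
    refine ⟨fun h0 => ?_, ?_, ?_, ?_⟩
    · apply hx0
      rw [← hxy]
      have := t.bracket_h_f y
      rw [h0, LinearMap.zero_apply, LinearMap.zero_apply, map_zero, zero_sub, eq_comm, neg_eq_zero,
        smul_eq_zero] at this
      simpa using this
    · ext x
      rw [LieRing.of_associative_ring_bracket, LinearMap.sub_apply, Module.End.mul_apply,
        Module.End.mul_apply, t.bracket_e_f, add_sub_cancel_left]
    · ext x
      rw [LieRing.of_associative_ring_bracket, LinearMap.sub_apply, Module.End.mul_apply,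
        Module.End.mul_apply, t.bracket_h_e, add_sub_cancel_left, ofNat_smul_eq_nsmul]
      rfl
    · ext x
      rw [LieRing.of_associative_ring_bracket, LinearMap.sub_apply, Module.End.mul_apply,
        Module.End.mul_apply, t.bracket_h_f, sub_sub_cancel_left, ofNat_smul_eq_nsmul]
      rfl
  obtain ⟨n, rfl⟩ := (IsSl2Triple.HasPrimitiveVectorWith.mk hx0 hhx hex :
    htr.HasPrimitiveVectorWith x μ).exists_nat
  have key : ∀ j : ℕ, ∀ y : g, bracket e (bracket f y) = 0 →
      bracket h (bracket f y) = (n : ℂ) • bracket f y →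
      ((bracket e : Module.End ℂ g) ^ j) y = 0 → bracket f y = 0 := by
    intro j
    induction j with
    | zero =>
      intro y _ _ h0
      rw [show y = 0 from h0, map_zero]
    | succ j ih =>
      intro y hy hh h0
      have h1 : bracket f (bracket h y + (j : ℂ) • y) = ((n + 2 + j : ℕ) : ℂ) • bracket f y := by
        have := t.bracket_h_f y
        rw [hh] at this
        rw [map_add, map_smul, eq_add_of_sub_eq this.symm]
        push_cast
        module
      have h2 := ih (bracket h y + (j : ℂ) • y)
        (by rw [h1, map_smul, hy, smul_zero]) (by rw [h1, map_smul, hh, smul_comm]) (by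
          have := t.bracket_e_pow_f j y
          rw [h0, map_zero, zero_add, pow_succ, Module.End.mul_apply, hy, map_zero, eq_comm,
            smul_eq_zero] at this
          exact this.resolve_left (Nat.cast_add_one_ne_zero j))
      rw [h1, smul_eq_zero] at h2
      exact h2.resolve_left (Nat.cast_ne_zero.mpr (by omega))
  obtain ⟨k, hk⟩ := he
  apply hx0
  rw [← hxy] at hex hhx ⊢
  exact key k y hex hhx (by rw [hk]; rfl)

end IsGradedSl2Triple

end Sl2

section Splittings

variable {g : Type*} [AddCommGroup g] [Module ℂ g] [LieSuperalgebra g] [FiniteDimensional ℂ g]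
  {Γ : ℤ → Submodule ℂ g} {e h f : g}

/-- Bracketing with an element of positive degree is nilpotent. -/
theorem IsGoodGrading.isNilpotent_bracket (hΓ : IsGoodGrading Γ f) {x : g} (hx : x ∈ gPos Γ) :
    IsNilpotent (bracket x : Module.End ℂ g) := by
  obtain ⟨M, hM, hM'⟩ := hΓ.exists_bound
  have hpow : ∀ (n : ℕ) (y : g), ((bracket x : Module.End ℂ g) ^ n) y ∈ geSub Γ (n - M) := by
    intro n y
    induction n with
    | zero => rw [Nat.cast_zero, zero_sub, hM']; exact Submodule.mem_top
    | succ n ih =>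
      rw [pow_succ', Module.End.mul_apply, Nat.cast_succ,
        show (n : ℤ) + 1 - M = 1 + (n - M) by ring]
      exact hΓ.bracket_mem_geSub hx ih
  refine ⟨2 * M, LinearMap.ext fun y => ?_⟩
  have h := hpow (2 * M) y
  rw [show ((2 * M : ℕ) : ℤ) - M = M by push_cast; ring, hM] at h
  exact (Submodule.mem_bot ℂ).mp h

theorem IsGradedSl2Triple.eq_zero (hΓ : IsGoodGrading Γ f) (t : IsGradedSl2Triple Γ e h f) {y : g}
    (hy : bracket e (bracket f y) = 0) : bracket f y = 0 :=
  t.eq_zero_of_bracket_e_f (hΓ.isNilpotent_bracket (le_geSub (by norm_num) t.e_mem)) hy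

omit [FiniteDimensional ℂ g] in
/-- A homogeneous linear map that is injective on each component of degree `< n` has kernel in
degrees `≥ n`. -/
theorem IsGoodGrading.ker_le_geSub (hΓ : IsGoodGrading Γ f) {φ : g →ₗ[ℂ] g} {d : ℤ}
    (hφ : ∀ m, ∀ x ∈ Γ m, φ x ∈ Γ (m + d)) {n : ℤ} {a : ℕ}
    (hinj : ∀ m < n, ∀ x ∈ Γ m, φ x = 0 → x = 0) {x : g} (hx : x ∈ geSub Γ (n - a))
    (h0 : φ x = 0) : x ∈ geSub Γ n := by
  induction a with
  | zero => simpa using hx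
  | succ a ih =>
    apply ih
    rw [geSub_eq_sup, Submodule.mem_sup] at hx
    obtain ⟨u, hu, v, hv, rfl⟩ := hx
    rw [map_add] at h0
    have hv' : φ v ∈ geSub Γ (n - (a + 1 : ℕ) + d + 1) :=
      geSub_induction φ (fun m hm x hx => le_geSub (by omega) (hφ m x hx)) hv
    have hu0 : φ u = 0 := (Submodule.disjoint_def.mp (hΓ.disjoint_geSub_succ _)) _ (hφ _ u hu)
      (by rw [eq_neg_of_add_eq_zero_left h0]; exact neg_mem hv')
    rw [hinj _ (by omega) u hu hu0, zero_add]
    convert hv using 2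
    push_cast
    ring

theorem centralizer_le_gGe (hΓ : IsGoodGrading Γ f) (t : IsGradedSl2Triple Γ e h f) :
    centralizer e ≤ gGe Γ := by
  intro x hx
  obtain ⟨M, -, hM⟩ := hΓ.exists_bound
  refine hΓ.ker_le_geSub (φ := bracket e) (d := 2) (a := M)
    (fun m x hx => by rw [add_comm]; exact hΓ.bracket_mem 2 m e t.e_mem x hx)
    (fun m hm x hx h0 => ?_) ?_ hx
  · obtain ⟨y, -, rfl⟩ := hΓ.surjective (m + 2) (by omega) x (by simpa using hx)
    exact t.eq_zero hΓ h0
  · exact geSub_antitone (by omega) (hM ▸ Submodule.mem_top : x ∈ geSub Γ (-M))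

/-- The splitting `g_{≥ -1/2} = [f, g_+] ⊕ g^e`. -/
def slodowySplitting (hΓ : IsGoodGrading Γ f) (t : IsGradedSl2Triple Γ e h f) :
    SliceSplitting Γ f where
  U k := geSub Γ k
  V k := geSub Γ (k - 2)
  C := centralizer e
  even := t.f_even
  U_antitone _ _ h := geSub_antitone (by omega)
  V_antitone _ _ h := geSub_antitone (by omega)
  U_le := geSub_antitone (by norm_num)
  V_le := geSub_antitone (by norm_num)
  C_le := (centralizer_le_gGe hΓ t).trans (geSub_antitone (by norm_num))
  bracket_UU a b x hx y hy := by
    rw [Nat.cast_add]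
    exact hΓ.bracket_mem_geSub hx hy
  bracket_UV a b x hx y hy := by
    rw [Nat.cast_add, add_sub_assoc]
    exact hΓ.bracket_mem_geSub hx hy
  bracket_Uf a x hx := hΓ.bracket_mem_geSub hx (le_geSub le_rfl hΓ.mem)
  graded_U := hΓ.isGraded_geSub _
  graded_C := isGraded_centralizer t.e_even
  injective y hy hc := by
    obtain ⟨M, hM, -⟩ := hΓ.exists_bound
    have h0 := t.eq_zero hΓ hc
    have hstep : ∀ n : ℕ, y ∈ geSub Γ (n + 1) := by
      intro n
      induction n with
      | zero => simpa using hy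
      | succ n ih =>
        rw [geSub_eq_sup, Submodule.mem_sup] at ih
        obtain ⟨u, hu, v, hv, rfl⟩ := ih
        rw [map_add] at h0
        have hb : ∀ m, ∀ x ∈ Γ m, bracket f x ∈ Γ (-2 + m) :=
          fun m => hΓ.bracket_mem (-2) m f hΓ.mem
        have hv' : bracket f v ∈ geSub Γ (-2 + (n + 1) + 1) :=
          geSub_induction (bracket f) (fun m hm x hx => le_geSub (by omega) (hb m x hx)) hv
        have hu0 : bracket f u = 0 :=
          (Submodule.disjoint_def.mp (hΓ.disjoint_geSub_succ _)) _ (hb _ u hu)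
            (by rw [eq_neg_of_add_eq_zero_left h0]; exact neg_mem hv')
        rw [hΓ.injective _ (by omega) u hu hu0, zero_add]
        exact_mod_cast hv
    have := geSub_antitone (by omega : (M : ℤ) ≤ M + 1) (hstep M)
    rw [hM] at this
    exact (Submodule.mem_bot ℂ).mp this
  exists_decomp k hk x hx := by
    have key : geSub Γ (k - 2) ≤ (geSub Γ k).map (bracket f) ⊔ centralizer e := by
      refine iSup₂_le fun n hn x hx => ?_
      -- `ad e ∘ ad f` is injective, hence bijective, on `Γ (n + 2)`.
      let φ : Γ (n + 2) →ₗ[ℂ] Γ (n + 2) := (bracket e ∘ₗ bracket f).restrict fun y hy => by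
        have h1 := hΓ.bracket_mem _ _ f hΓ.mem y hy
        have h2 := hΓ.bracket_mem _ _ e t.e_mem _ h1
        rwa [show (2 : ℤ) + (-2 + (n + 2)) = n + 2 by ring] at h2
      have hφ : Function.Injective φ := by
        rw [injective_iff_map_eq_zero]
        intro y hy
        exact Subtype.ext (hΓ.injective _ (by omega) y y.2 (t.eq_zero hΓ (congrArg Subtype.val hy)))
      have hex : bracket e x ∈ Γ (n + 2) := by
        rw [add_comm]
        exact hΓ.bracket_mem 2 n e t.e_mem x hx
      obtain ⟨y, hy⟩ := (LinearMap.injective_iff_surjective.mp hφ) ⟨_, hex⟩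
      have hy : bracket e (bracket f y) = bracket e x := congrArg Subtype.val hy
      refine Submodule.mem_sup.mpr ⟨bracket f y,
        ⟨y, le_geSub (by omega) y.2, rfl⟩, x - bracket f y, ?_, add_sub_cancel _ _⟩
      change bracket e _ = 0
      rw [map_sub, hy, sub_self]
    obtain ⟨_, ⟨y, hy, rfl⟩, c, hc, rfl⟩ := Submodule.mem_sup.mp (key hx)
    exact ⟨y, hy, by rwa [add_sub_cancel_left]⟩

/-- The splitting `g_{≥ -1/2} = [f + z, g_+] ⊕ (g_{-1/2} ⊕ g_0)` for an even `z ∈ g_0` acting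
injectively on `g_+`. -/
def initialSplitting (hΓ : IsGoodGrading Γ f) (hf : f ∈ parity (g := g) 0) {z : g}
    (hz0 : z ∈ parity (g := g) 0) (hz : z ∈ Γ 0)
    (hinj : ∀ n : ℤ, 1 ≤ n → ∀ x ∈ Γ n, bracket z x = 0 → x = 0) : SliceSplitting Γ (f + z) :=
  have hdecomp : gGe Γ ≤ (gPos Γ).map (bracket (f + z)) ⊔ gIni Γ := by
    have key : ∀ n : ℕ, ∀ m : ℤ, -1 ≤ m → m ≤ n →
        Γ m ≤ (gPos Γ).map (bracket (f + z)) ⊔ gIni Γ := by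
      intro n
      induction n with
      | zero =>
        intro m h1 h2
        obtain rfl | rfl : m = -1 ∨ m = 0 := by omega
        · exact le_sup_of_le_right le_sup_left
        · exact le_sup_of_le_right le_sup_right
      | succ n ih =>
        intro m h1 h2
        by_cases hm : m ≤ n
        · exact ih m h1 hm
        obtain rfl : m = n + 1 := by omega
        intro x hx
        let φ : Γ (n + 1) →ₗ[ℂ] Γ (n + 1) := (bracket z).restrict fun y hy => by
          have := hΓ.bracket_mem _ _ z hz y hy
          rwa [zero_add] at this
        have hφ : Function.Injective φ := by
          rw [injective_iff_map_eq_zero]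
          intro y hy
          exact Subtype.ext (hinj _ (by omega) y y.2 (congrArg Subtype.val hy))
        obtain ⟨y, hy⟩ := (LinearMap.injective_iff_surjective.mp hφ) ⟨x, hx⟩
        have hy : bracket z y = x := congrArg Subtype.val hy
        have hfy : bracket f y ∈ (gPos Γ).map (bracket (f + z)) ⊔ gIni Γ := by
          have := hΓ.bracket_mem _ _ f hΓ.mem y y.2
          exact ih (-2 + (n + 1)) (by omega) (by omega) this
        have : x = bracket (f + z) y - bracket f y := by
          rw [map_add, LinearMap.add_apply, hy, add_sub_cancel_left]
        rw [this]
        exact sub_mem (Submodule.mem_sup_left ⟨y, le_geSub (by omega) y.2, rfl⟩) hfy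
    exact iSup₂_le fun m hm => key m.toNat m hm (Int.self_le_toNat m)
  { U := fun _ => gPos Γ
    V := fun _ => gGe Γ
    C := gIni Γ
    even := add_mem hf hz0
    U_antitone := fun _ _ _ => le_rfl
    V_antitone := fun _ _ _ => le_rfl
    U_le := le_rfl
    V_le := le_rfl
    C_le := gIni_le_gGe Γ
    bracket_UU := fun _ _ x hx y hy => geSub_antitone (by norm_num) (hΓ.bracket_mem_geSub hx hy)
    bracket_UV := fun _ _ x hx y hy => geSub_antitone (by norm_num) (hΓ.bracket_mem_geSub hx hy)
    bracket_Uf := fun _ x hx => by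
      have h2 : f + z ∈ geSub Γ (-2) := add_mem (le_geSub le_rfl hΓ.mem) (le_geSub (by norm_num) hz)
      exact geSub_antitone (by norm_num) (hΓ.bracket_mem_geSub hx h2)
    graded_U := hΓ.isGraded_geSub _
    graded_C := hΓ.isGraded_gIni
    injective := by
      -- A surjection between spaces of the same finite dimension is injective.
      have hfz : ∀ y ∈ gPos Γ, bracket (f + z) y ∈ gGe Γ := by
        intro y hy
        have h2 : f + z ∈ geSub Γ (-2) :=
          add_mem (le_geSub le_rfl hΓ.mem) (le_geSub (by norm_num) hz)
        exact geSub_antitone (by norm_num) (hΓ.bracket_mem_geSub h2 hy)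
      let ψ : gPos Γ × gIni Γ →ₗ[ℂ] gGe Γ :=
        ((bracket (f + z)).restrict hfz).coprod (Submodule.inclusion (gIni_le_gGe Γ))
      have hψ : Function.Surjective ψ := by
        rintro ⟨x, hx⟩
        obtain ⟨_, ⟨y, hy, rfl⟩, c, hc, rfl⟩ := Submodule.mem_sup.mp (hdecomp hx)
        exact ⟨(⟨y, hy⟩, ⟨c, hc⟩), rfl⟩
      have hdim : Module.finrank ℂ (gPos Γ × gIni Γ) = Module.finrank ℂ (gGe Γ) := by
        have h1 : gGe Γ = gPos Γ ⊔ gIni Γ := by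
          rw [gGe_eq_geSub, geSub_eq_sup, geSub_eq_sup, gIni, gPos_eq_geSub, ← sup_assoc, sup_comm]
          rfl
        have h2 : gPos Γ ⊓ gIni Γ = ⊥ := by
          rw [eq_bot_iff]
          rintro x ⟨hx, hx'⟩
          obtain ⟨u, hu, v, hv, rfl⟩ := Submodule.mem_sup.mp hx'
          have hu0 : u = 0 := Submodule.disjoint_def.mp (hΓ.disjoint_geSub_succ (-1)) u hu (by
            rw [← add_sub_cancel_right u v]
            exact sub_mem (geSub_antitone (by norm_num) hx) (le_geSub (by norm_num) hv))
          rw [hu0, zero_add] at hx ⊢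
          rw [Submodule.disjoint_def.mp (hΓ.disjoint_geSub_succ 0) v hv hx]
          exact zero_mem _
        have h3 := Submodule.finrank_sup_add_finrank_inf_eq (gPos Γ) (gIni Γ)
        rw [h2, finrank_bot, add_zero, ← h1] at h3
        rw [Module.finrank_prod, h3]
      have hinjψ := (LinearMap.injective_iff_surjective_of_finrank_eq_finrank hdim).mpr hψ
      intro y hy hc
      have : ψ (⟨y, hy⟩, -⟨_, hc⟩) = 0 := Subtype.ext (add_neg_cancel (bracket (f + z) y))
      have := hinjψ (this.trans (map_zero ψ).symm)
      exact congrArg (fun v => ((v.1 : gPos Γ) : g)) this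
    exists_decomp := fun _ _ x hx => by
      obtain ⟨_, ⟨y, hy, rfl⟩, c, hc, rfl⟩ := Submodule.mem_sup.mp (hdecomp hx)
      exact ⟨y, hy, by rwa [add_sub_cancel_left]⟩ }

end Splittings

end LieSuperalgebra

namespace LieSuperalgebra

/-! ### Naturality in the coefficients -/

section Naturality

variable {g : Type*} [AddCommGroup g] [Module ℂ g] [LieSuperalgebra g]
  {A : Type*} [Ring A] [Algebra ℂ A] {𝒜 : ZMod 2 → Submodule ℂ A} [GradedAlgebra 𝒜]
  {B : Type*} [Ring B] [Algebra ℂ B] {ℬ : ZMod 2 → Submodule ℂ B} [GradedAlgebra ℬ]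

theorem lTensor_tensorBracket {φ : A →ₐ[ℂ] B} (hφ : ∀ i, ∀ a ∈ 𝒜 i, φ a ∈ ℬ i) {z w : g ⊗[ℂ] A}
    (hz : z ∈ evenTensor ⊤ 𝒜) (hw : w ∈ evenTensor ⊤ 𝒜) :
    φ.toLinearMap.lTensor g (tensorBracket 𝒜 z w) =
      tensorBracket ℬ (φ.toLinearMap.lTensor g z) (φ.toLinearMap.lTensor g w) := by
  set Φ := φ.toLinearMap.lTensor g with hΦ
  refine evenTensor_induction_eq (Φ ∘ₗ tensorBracket 𝒜 z) (tensorBracket ℬ (Φ z) ∘ₗ Φ)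
    (fun j y hy b hb => ?_) hw
  refine evenTensor_induction_eq (Φ ∘ₗ (tensorBracket 𝒜).flip (y ⊗ₜ b))
    ((tensorBracket ℬ).flip (Φ (y ⊗ₜ b)) ∘ₗ Φ) (fun i x hx a ha => ?_) hz
  simp only [LinearMap.comp_apply, LinearMap.flip_apply, hΦ, LinearMap.lTensor_tmul,
    AlgHom.toLinearMap_apply]
  rw [tensorBracket_tmul 𝒜 x hy.2 ha, tensorBracket_tmul ℬ x hy.2 (hφ i a ha), map_smul,
    LinearMap.lTensor_tmul, AlgHom.toLinearMap_apply, map_mul]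

/-- The map of Grassmann envelopes induced by an even homomorphism of coefficients. -/
def Envelope.mapRight (φ : A →ₐ[ℂ] B) (hφ : ∀ i, ∀ a ∈ 𝒜 i, φ a ∈ ℬ i) :
    Envelope g 𝒜 →ₗ[ℂ] Envelope g ℬ :=
  LinearMap.restrict (φ.toLinearMap.lTensor g) fun _ hz => lTensor_mem_evenTensor hφ hz

open Envelope in
/-- The point of the slice attached to a point of the affine space is natural in the
coefficients. -/
theorem SliceSplitting.mapRight_proj [Fact (IsSupercommutative 𝒜)] [Fact (IsSupercommutative ℬ)]
    {Γ : ℤ → Submodule ℂ g} {f f₀ : g} (hΓ : IsGoodGrading Γ f) (S : SliceSplitting Γ f₀)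
    {M : ℕ} (hM : geSub Γ M = ⊥) (hM' : geSub Γ (-M) = ⊤) {N : ℕ} (hN : 2 * M + 2 ≤ N)
    (hbot : S.U N = ⊥) {φ : A →ₐ[ℂ] B} (hφ : ∀ i, ∀ a ∈ 𝒜 i, φ a ∈ ℬ i) (w : Envelope g 𝒜) :
    mapRight φ hφ ((S.datum hΓ (CoeffFiltration.const 𝒜) hM hM' hN (Or.inl hbot)).proj w) =
      (S.datum hΓ (CoeffFiltration.const ℬ) hM hM' hN (Or.inl hbot)).proj (mapRight φ hφ w) := by
  refine LieSlice.SliceDatum.map_proj (mapRight φ hφ) (fun x y => ?_) rfl ?_ (fun x => ?_) w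
  · exact val_injective (lTensor_tensorBracket hφ (val_mem x) (val_mem y))
  · refine val_injective ?_
    change φ.toLinearMap.lTensor g (f₀ ⊗ₜ 1) = f₀ ⊗ₜ 1
    rw [LinearMap.lTensor_tmul, AlgHom.toLinearMap_apply, map_one]
  · refine val_injective ?_
    change φ.toLinearMap.lTensor g (S.θ.rTensor A (val x)) =
      S.θ.rTensor B (φ.toLinearMap.lTensor g (val x))
    exact LinearMap.congr_fun ((LinearMap.lTensor_comp_rTensor _ _ _).trans
      (LinearMap.rTensor_comp_lTensor _ _ _).symm) (val x)

end Naturality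

/-! ### Restriction of invariants to the Slodowy slice -/

section Slodowy

open Envelope

variable {g : Type u} [AddCommGroup g] [Module ℂ g] [LieSuperalgebra g] [FiniteDimensional ℂ g]
  {Γ : ℤ → Submodule ℂ g} {e h f : g}

section Projection

variable {B : Type*} [Ring B] [Algebra ℂ B] {ℬ : ZMod 2 → Submodule ℂ B} [GradedAlgebra ℬ]
  [Fact (IsSupercommutative ℬ)] {B' : Type*} [Ring B'] [Algebra ℂ B']
  {ℬ' : ZMod 2 → Submodule ℂ B'} [GradedAlgebra ℬ'] [Fact (IsSupercommutative ℬ')]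
  (hΓ : IsGoodGrading Γ f) (t : IsGradedSl2Triple Γ e h f) {M : ℕ} (hM : geSub Γ M = ⊥)
  (hM' : geSub Γ (-M) = ⊤)

include hM in
theorem slodowySplitting_U_eq_bot : (slodowySplitting hΓ t).U (2 * M + 2) = ⊥ := by
  rw [eq_bot_iff, ← hM]
  exact geSub_antitone (by push_cast; omega)

/-- The slice datum of the Slodowy slice in a Grassmann envelope. -/
abbrev slodowyDatum (ℬ : ZMod 2 → Submodule ℂ B) [GradedAlgebra ℬ] [Fact (IsSupercommutative ℬ)] :
    LieSlice.SliceDatum (Envelope g ℬ) :=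
  (slodowySplitting hΓ t).datum hΓ (CoeffFiltration.const ℬ) hM hM' le_rfl
    (Or.inl (slodowySplitting_U_eq_bot hΓ t hM))

/-- The tensor of a point, as an element of the Grassmann envelope. -/
def SuperPoint.toEnvelope {W : Submodule ℂ g} (p : SuperPoint W ℬ) : Envelope g ℬ :=
  Envelope.mk p.toTensor (evenTensor_mono le_top p.toTensor_mem)

/-- The projection of a point of `f + g_{≥ -1/2}` to the Slodowy slice along its orbit. -/
def slodowyProj (p : SuperPoint (gGe Γ) ℬ) : g ⊗[ℂ] B :=
  val ((slodowyDatum hΓ t hM hM' ℬ).proj p.toEnvelope)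

theorem slodowyDatum_toEnvelope_mem (p : SuperPoint (gGe Γ) ℬ) :
    p.toEnvelope ∈ (slodowyDatum hΓ t hM hM' ℬ).P 1 := p.toTensor_mem

theorem slodowyProj_mem (p : SuperPoint (gGe Γ) ℬ) :
    slodowyProj hΓ t hM hM' p ∈ evenTensor (centralizer e) ℬ :=
  (slodowyDatum hΓ t hM hM' ℬ).proj_mem (slodowyDatum_toEnvelope_mem hΓ t hM hM' p)

theorem slodowyProj_map (p : SuperPoint (gGe Γ) ℬ) {φ : B →ₐ[ℂ] B'}
    (hφ : ∀ i, ∀ a ∈ ℬ i, φ a ∈ ℬ' i) : slodowyProj hΓ t hM hM' (p.map φ hφ) =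
      φ.toLinearMap.lTensor g (slodowyProj hΓ t hM hM' p) := by
  have h1 : (p.map φ hφ).toEnvelope = mapRight φ hφ p.toEnvelope :=
    val_injective (p.toTensor_map φ hφ)
  rw [slodowyProj, h1, ← (slodowySplitting hΓ t).mapRight_proj hΓ hM hM' le_rfl
    (slodowySplitting_U_eq_bot hΓ t hM) hφ]
  rfl

theorem slodowyProj_of_mem {p : SuperPoint (gGe Γ) ℬ}
    (hp : p.toTensor ∈ evenTensor (centralizer e) ℬ) :
    slodowyProj hΓ t hM hM' p = p.toTensor := by
  have hC : p.toEnvelope ∈ (slodowyDatum hΓ t hM hM' ℬ).C := hp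
  rw [slodowyProj, LieSlice.SliceDatum.proj_of_mem_C _ hC]
  rfl

theorem slodowyProj_eq_of_expNegAd {p q : SuperPoint (gGe Γ) ℬ} (Y : SuperPoint (gPos Γ) ℬ)
    (hpq : f ⊗ₜ[ℂ] (1 : B) + q.toTensor =
      expNegAd ℬ Y.toTensor (f ⊗ₜ[ℂ] (1 : B) + p.toTensor)) :
    slodowyProj hΓ t hM hM' q = slodowyProj hΓ t hM hM' p := by
  set D := slodowyDatum hΓ t hM hM' ℬ with hD
  have hY : Y.toEnvelope ∈ D.G 1 :=
    evenTensor_mono (geSub_antitone (by norm_num : ((1 : ℕ) : ℤ) ≤ 1)) Y.toTensor_mem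
  have hexp : D.f + q.toEnvelope = D.expAd (-Y.toEnvelope) (D.f + p.toEnvelope) := by
    have h := expNegAd_val hΓ (y := Y.toEnvelope) Y.toTensor_mem (D.ad_pow_eq_zero hY)
      (D.f + p.toEnvelope)
    refine val_injective (Eq.trans ?_ h)
    rw [map_add, map_add]
    exact hpq
  rw [slodowyProj, slodowyProj, ← hD,
    D.proj_eq_of_expAd (slodowyDatum_toEnvelope_mem hΓ t hM hM' p) hY hexp]

end Projection

theorem restrictInvariants_slodowy_injective (hΓ : IsGoodGrading Γ f)
    (t : IsGradedSl2Triple Γ e h f) :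
    Function.Injective (restrictInvariants Γ f (centralizer_le_gGe hΓ t)) := by
  rw [injective_iff_map_eq_zero]
  rintro ⟨F, hF⟩ h0
  refine Subtype.ext ?_
  obtain ⟨M, hM, hM'⟩ := hΓ.exists_bound
  have hA := isSupercommutative_coordGrading (gGe Γ)
  have : Fact (IsSupercommutative (coordGrading (gGe Γ))) := ⟨hA⟩
  set p := SuperPoint.generic (gGe Γ)
  have hproj := slodowyProj_mem hΓ t hM hM' p
  obtain ⟨s, hs⟩ := SuperPoint.exists_toTensor_eq hA hproj
  obtain ⟨q, hq⟩ := SuperPoint.exists_toTensor_eq hA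
    (evenTensor_mono (centralizer_le_gGe hΓ t) hproj)
  have h1 : q.eval F = p.eval F := eval_proj_eq hΓ t.f_even (zero_mem _) (add_zero f).symm
    (slodowySplitting hΓ t) (CoeffFiltration.const (coordGrading (gGe Γ))) hM hM' le_rfl
    (Or.inl (slodowySplitting_U_eq_bot hΓ t hM)) hF (w := p.toEnvelope)
    (slodowyDatum_toEnvelope_mem hΓ t hM hM' p) p q
    (by rw [TensorProduct.zero_tmul, zero_add]; rfl)
    (by rw [TensorProduct.zero_tmul, zero_add, hq]; rfl)
  rw [SuperPoint.eval_eq_comp_restrict (centralizer_le_gGe hΓ t) q s (hq.trans hs.symm),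
    AlgHom.comp_apply] at h1
  have h2 : restrict (centralizer_le_gGe hΓ t) F = 0 := h0
  rw [h2, map_zero] at h1
  exact h1.symm

theorem restrictInvariants_slodowy_surjective (hΓ : IsGoodGrading Γ f)
    (t : IsGradedSl2Triple Γ e h f) :
    Function.Surjective (restrictInvariants Γ f (centralizer_le_gGe hΓ t)) := by
  intro φ
  obtain ⟨M, hM, hM'⟩ := hΓ.exists_bound
  have hA := isSupercommutative_coordGrading (gGe Γ)
  have : Fact (IsSupercommutative (coordGrading (gGe Γ))) := ⟨hA⟩
  obtain ⟨s, hs⟩ := SuperPoint.exists_toTensor_eq hA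
    (slodowyProj_mem hΓ t hM hM' (SuperPoint.generic (gGe Γ)))
  -- The value of `s^* φ` at a point `q` is the value of `φ` at the projection of `q`.
  have key : ∀ (B : Type u) [Ring B] [Algebra ℂ B] (ℬ : ZMod 2 → Submodule ℂ B) [GradedAlgebra ℬ]
      [Fact (IsSupercommutative ℬ)] (q : SuperPoint (gGe Γ) ℬ), ∃ r : SuperPoint (centralizer e) ℬ,
        r.toTensor = slodowyProj hΓ t hM hM' q ∧ q.eval (s.eval φ) = r.eval φ := by
    intro B _ _ ℬ _ _ q
    have hqe : ∀ i, ∀ a ∈ coordGrading (gGe Γ) i, q.eval a ∈ ℬ i := fun i a ha => q.eval_mem i ha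
    refine ⟨s.map q.eval hqe, ?_, rfl⟩
    rw [SuperPoint.toTensor_map, hs, ← slodowyProj_map hΓ t hM hM' _ hqe]
    rfl
  have hinv : s.eval φ ∈ invariants Γ f := by
    intro B _ _ ℬ _ hB Y a b hab
    have : Fact (IsSupercommutative ℬ) := ⟨hB⟩
    obtain ⟨ra, hra, ha⟩ := key B ℬ a
    obtain ⟨rb, hrb, hb⟩ := key B ℬ b
    rw [ha, hb, SuperPoint.eval_eq_of_toTensor_eq (hrb.trans
      ((slodowyProj_eq_of_expNegAd hΓ t hM hM' Y hab).trans hra.symm))]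
  refine ⟨⟨s.eval φ, hinv⟩, ?_⟩
  -- Points of the slice are fixed by the projection.
  have hC := isSupercommutative_coordGrading (centralizer e)
  have : Fact (IsSupercommutative (coordGrading (centralizer e))) := ⟨hC⟩
  set c := SuperPoint.generic (centralizer e)
  obtain ⟨q, hq⟩ := SuperPoint.exists_toTensor_eq hC
    (evenTensor_mono (centralizer_le_gGe hΓ t) c.toTensor_mem)
  obtain ⟨r, hr, hrq⟩ := key _ _ q
  rw [slodowyProj_of_mem hΓ t hM hM' (hq ▸ c.toTensor_mem), hq] at hr
  rw [SuperPoint.eval_eq_comp_restrict (centralizer_le_gGe hΓ t) q c hq,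
    SuperPoint.eval_eq_of_toTensor_eq hr] at hrq
  exact hrq

end Slodowy

/-! ### Restriction of invariants to the initial affine subspace -/

section Initial

open Envelope Polynomial

variable {g : Type u} [AddCommGroup g] [Module ℂ g] [LieSuperalgebra g] [FiniteDimensional ℂ g]
  {Γ : ℤ → Submodule ℂ g} {f : g}

/-- A polynomial with coefficients in `R` that vanishes modulo all powers of the variable vanishes
at `1`. -/
theorem aeval_one_eq_zero {R : Type*} [Ring R] [Algebra ℂ R] (Q : ℂ[X] ⊗[ℂ] R)
    (hQ : ∀ k : ℕ,
      (Ideal.Quotient.mkₐ ℂ (Ideal.span {(X : ℂ[X]) ^ k})).toLinearMap.rTensor R Q = 0) :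
    TensorProduct.lid ℂ R ((Polynomial.aeval (1 : ℂ)).toLinearMap.rTensor R Q) = 0 := by
  have hcoeff : ∀ i, (Polynomial.lcoeff ℂ i).rTensor R Q = 0 := by
    intro i
    let I : Ideal ℂ[X] := Ideal.span {(X : ℂ[X]) ^ (i + 1)}
    have hI : I.restrictScalars ℂ ≤ LinearMap.ker (Polynomial.lcoeff ℂ i) := by
      intro a ha
      obtain ⟨b, rfl⟩ := Ideal.mem_span_singleton.mp (show a ∈ I from ha)
      change ((X : ℂ[X]) ^ (i + 1) * b).coeff i = 0
      rw [Polynomial.coeff_X_pow_mul', if_neg (by omega)]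
    let l : (ℂ[X] ⧸ I) →ₗ[ℂ] ℂ := (I.restrictScalars ℂ).liftQ (Polynomial.lcoeff ℂ i) hI
    have hl : Polynomial.lcoeff ℂ i = l ∘ₗ (Ideal.Quotient.mkₐ ℂ I).toLinearMap := rfl
    rw [hl, LinearMap.rTensor_comp, LinearMap.comp_apply, hQ (i + 1), map_zero]
  obtain ⟨n, hn⟩ : ∃ n : ℕ, ∀ m ≥ n, (Polynomial.aeval (1 : ℂ)).toLinearMap.rTensor R Q =
      ∑ i ∈ Finset.range m, (Polynomial.lcoeff ℂ i).rTensor R Q := by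
    clear hQ hcoeff
    induction Q using TensorProduct.induction_on with
    | zero => exact ⟨0, fun m _ => by simp⟩
    | add x y hx hy =>
      obtain ⟨a, ha⟩ := hx
      obtain ⟨b, hb⟩ := hy
      refine ⟨max a b, fun m hm => ?_⟩
      rw [map_add, ha m ((le_max_left a b).trans hm), hb m ((le_max_right a b).trans hm)]
      simp only [map_add, Finset.sum_add_distrib]
    | tmul q r =>
      refine ⟨q.natDegree + 1, fun m hm => ?_⟩
      simp only [LinearMap.rTensor_tmul, ← TensorProduct.sum_tmul]
      congr 1
      rw [AlgHom.toLinearMap_apply, Polynomial.coe_aeval_eq_eval, Polynomial.eval_eq_sum_range' hm]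
      simp
  rw [hn n le_rfl, Finset.sum_eq_zero fun i _ => hcoeff i, map_zero]

/-- An invariant function that vanishes on `f + (g_{-1/2} ⊕ g_0)` vanishes at the points
`f + z + w` with `w` divisible by an even nilpotent scalar. -/
theorem eval_eq_zero_of_nilpotent {A : Type u} [Ring A] [Algebra ℂ A] {𝒜 : ZMod 2 → Submodule ℂ A}
    [GradedAlgebra 𝒜] (hA : IsSupercommutative 𝒜) {τ : A} (hτ : τ ∈ 𝒜 0) {k : ℕ} (hτk : τ ^ k = 0)
    (hΓ : IsGoodGrading Γ f) (hf : f ∈ parity (g := g) 0) {z : g} (hz0 : z ∈ parity (g := g) 0)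
    (hz : z ∈ Γ 0) (hinj : ∀ n : ℤ, 1 ≤ n → ∀ x ∈ Γ n, bracket z x = 0 → x = 0)
    {F : CoordRing (gGe Γ)} (hF : F ∈ invariants Γ f) (h0 : restrict (gIni_le_gGe Γ) F = 0)
    (P : SuperPoint (gGe Γ) 𝒜) {v : g ⊗[ℂ] A}
    (hv : v ∈ evenTensor (gGe Γ) ((CoeffFiltration.powers hA hτ).comp 1))
    (hP : P.toTensor = z ⊗ₜ 1 + v) : P.eval F = 0 := by
  obtain ⟨M, hM, hM'⟩ := hΓ.exists_bound
  have : Fact (IsSupercommutative 𝒜) := ⟨hA⟩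
  set ℱ := CoeffFiltration.powers hA hτ
  set S := initialSplitting hΓ hf hz0 hz hinj with hS
  have hbot : S.U (2 * M + 2 + k) = ⊥ ∨ ∀ i, ℱ.comp (2 * M + 2 + k) i = ⊥ := by
    refine Or.inr fun i => ?_
    rw [eq_bot_iff]
    rintro _ ⟨a, -, rfl⟩
    rw [LinearMap.mulLeft_apply, pow_add, hτk, mul_zero, zero_mul]
    exact zero_mem _
  set D := S.datum hΓ ℱ hM hM' (Nat.le_add_right _ k) hbot
  set w : Envelope g 𝒜 := Envelope.mk v
    (evenTensor_mono le_top (evenTensor_mono_right (ℱ.le 1) hv))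
  have hw : w ∈ D.P 1 := hv
  have hproj : val (D.proj w) ∈ evenTensor (gIni Γ) 𝒜 :=
    evenTensor_mono_right (ℱ.le 1) (D.proj_mem hw)
  have hzini : z ⊗ₜ[ℂ] (1 : A) ∈ evenTensor (gIni Γ) 𝒜 :=
    tmul_mem_evenTensor ⟨Submodule.mem_sup_right hz, hz0⟩ (SetLike.one_mem_graded 𝒜)
  obtain ⟨s, hs⟩ := SuperPoint.exists_toTensor_eq hA (add_mem hzini hproj)
  obtain ⟨q, hq⟩ := SuperPoint.exists_toTensor_eq hA
    (evenTensor_mono (gIni_le_gGe Γ) (add_mem hzini hproj))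
  have h1 := eval_proj_eq hΓ hf (le_geSub (by norm_num) hz) rfl S ℱ hM hM'
    (Nat.le_add_right _ k) hbot hF hw P q hP hq
  rw [SuperPoint.eval_eq_comp_restrict (gIni_le_gGe Γ) q s (hq.trans hs.symm),
    AlgHom.comp_apply, h0, map_zero] at h1
  exact h1.symm

omit [FiniteDimensional ℂ g] in
theorem map_mem_tensorGrading {B B' R : Type*} [CommRing B] [Algebra ℂ B] [CommRing B']
    [Algebra ℂ B'] [Ring R] [Algebra ℂ R] {ℛ : ZMod 2 → Submodule ℂ R} (φ : B →ₐ[ℂ] B') (i : ZMod 2)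
    {x : B ⊗[ℂ] R} (hx : x ∈ tensorGrading B ℛ i) :
    Algebra.TensorProduct.map φ (AlgHom.id ℂ R) x ∈ tensorGrading B' ℛ i := by
  rw [tensorGrading_eq_span] at hx
  refine (Submodule.span_le (p := (tensorGrading B' ℛ i).comap
    (Algebra.TensorProduct.map φ (AlgHom.id ℂ R)).toLinearMap)).mpr ?_ hx
  rintro _ ⟨b, a, ha, rfl⟩
  exact tmul_mem_tensorGrading _ ha

/-- The variant of `eval_eq_zero_of_nilpotent` for the points `f + z + X w` with polynomial
coefficients, reduced modulo a power of `X`. -/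
theorem map_eval_eq_zero {R : Type u} [Ring R] [Algebra ℂ R] {ℛ : ZMod 2 → Submodule ℂ R}
    [GradedAlgebra ℛ] (hR : IsSupercommutative ℛ)
    (hΓ : IsGoodGrading Γ f) (hf : f ∈ parity (g := g) 0) {z : g} (hz0 : z ∈ parity (g := g) 0)
    (hz : z ∈ Γ 0) (hinj : ∀ n : ℤ, 1 ≤ n → ∀ x ∈ Γ n, bracket z x = 0 → x = 0)
    {F : CoordRing (gGe Γ)} (hF : F ∈ invariants Γ f) (h0 : restrict (gIni_le_gGe Γ) F = 0)
    (P : SuperPoint (gGe Γ) (tensorGrading ℂ[X] ℛ)) {v : g ⊗[ℂ] R} (hv : v ∈ evenTensor (gGe Γ) ℛ)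
    (hP : P.toTensor = z ⊗ₜ 1 + (TensorProduct.mk ℂ ℂ[X] R X).lTensor g v) (k : ℕ) :
    (Ideal.Quotient.mkₐ ℂ (Ideal.span {(X : ℂ[X]) ^ k})).toLinearMap.rTensor R (P.eval F) = 0 := by
  let π := Ideal.Quotient.mkₐ ℂ (Ideal.span {(X : ℂ[X]) ^ k})
  have hA := IsSupercommutative.tensorGrading (ℂ[X] ⧸ Ideal.span {(X : ℂ[X]) ^ k}) hR
  have hτ : π X ⊗ₜ[ℂ] (1 : R) ∈ tensorGrading (ℂ[X] ⧸ Ideal.span {(X : ℂ[X]) ^ k}) ℛ 0 :=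
    tmul_mem_tensorGrading _ (SetLike.one_mem_graded _)
  have hτk : (π X ⊗ₜ[ℂ] (1 : R)) ^ k = 0 := by
    rw [Algebra.TensorProduct.tmul_pow, ← map_pow,
      show π (X ^ k) = 0 from Ideal.Quotient.eq_zero_iff_mem.mpr
        (Ideal.mem_span_singleton_self _), TensorProduct.zero_tmul]
  refine eval_eq_zero_of_nilpotent hA hτ hτk hΓ hf hz0 hz hinj hF h0
    (P.map (Algebra.TensorProduct.map π (AlgHom.id ℂ R)) fun i _ ha => map_mem_tensorGrading π i ha)
    (v := (TensorProduct.mk ℂ _ R (π X)).lTensor g v) ?_ ?_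
  · refine lTensor_mem_evenTensor (fun i a ha => ?_) hv
    refine ⟨1 ⊗ₜ a, tmul_mem_tensorGrading _ ha, ?_⟩
    rw [LinearMap.mulLeft_apply, pow_one, Algebra.TensorProduct.tmul_mul_tmul, mul_one, one_mul]
    rfl
  · rw [SuperPoint.toTensor_map, hP, map_add, LinearMap.lTensor_tmul, AlgHom.toLinearMap_apply,
      map_one, ← LinearMap.comp_apply, ← LinearMap.lTensor_comp]
    rfl

/-- If some even `z ∈ g_0` acts injectively on `g_+`, then invariants are determined by their
restriction to `f + (g_{-1/2} ⊕ g_0)`: the orbits of `G_+` through a formal neighbourhood of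
`f + z` meet this subspace. -/
theorem eval_eq_zero_of_restrict_eq_zero {R : Type u} [Ring R] [Algebra ℂ R]
    {ℛ : ZMod 2 → Submodule ℂ R} [GradedAlgebra ℛ] (hR : IsSupercommutative ℛ)
    (hΓ : IsGoodGrading Γ f) (hf : f ∈ parity (g := g) 0) {z : g} (hz0 : z ∈ parity (g := g) 0)
    (hz : z ∈ Γ 0) (hinj : ∀ n : ℤ, 1 ≤ n → ∀ x ∈ Γ n, bracket z x = 0 → x = 0)
    {F : CoordRing (gGe Γ)} (hF : F ∈ invariants Γ f) (h0 : restrict (gIni_le_gGe Γ) F = 0)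
    (q : SuperPoint (gGe Γ) ℛ) : q.eval F = 0 := by
  have hzG : z ∈ component (gGe Γ) 0 := ⟨le_geSub (by norm_num) hz, hz0⟩
  -- The line `z + X v` joins the point `z` to the point `q = z + v`.
  set v := q.toTensor - z ⊗ₜ (1 : R)
  have hv : v ∈ evenTensor (gGe Γ) ℛ :=
    sub_mem q.toTensor_mem (tmul_mem_evenTensor hzG (SetLike.one_mem_graded ℛ))
  obtain ⟨P, hP⟩ := SuperPoint.exists_toTensor_eq (W := gGe Γ)
    (IsSupercommutative.tensorGrading ℂ[X] hR)
    (add_mem (tmul_mem_evenTensor hzG (SetLike.one_mem_graded _))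
      (lTensor_mem_evenTensor (φ := TensorProduct.mk ℂ ℂ[X] R X)
        (fun _ _ ha => tmul_mem_tensorGrading X ha) hv))
  have hone := aeval_one_eq_zero (P.eval F)
    (map_eval_eq_zero hR hΓ hf hz0 hz hinj hF h0 P hv hP)
  let ev : ℂ[X] ⊗[ℂ] R →ₐ[ℂ] R := (Algebra.TensorProduct.lid ℂ R).toAlgHom.comp
    (Algebra.TensorProduct.map (Polynomial.aeval (1 : ℂ)) (AlgHom.id ℂ R))
  have hev : ∀ i, ∀ a ∈ tensorGrading ℂ[X] ℛ i, ev a ∈ ℛ i := by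
    intro i a ha
    rw [tensorGrading_eq_span] at ha
    refine (Submodule.span_le (p := (ℛ i).comap ev.toLinearMap)).mpr ?_ ha
    rintro _ ⟨b, a, ha, rfl⟩
    exact Submodule.smul_mem _ _ ha
  have hq : (P.map ev hev).toTensor = q.toTensor := by
    have hX : ev.toLinearMap ∘ₗ TensorProduct.mk ℂ ℂ[X] R X = LinearMap.id := by
      ext1 a
      change Polynomial.aeval (1 : ℂ) (X : ℂ[X]) • a = a
      rw [Polynomial.aeval_X, one_smul]
    rw [SuperPoint.toTensor_map, hP, map_add, LinearMap.lTensor_tmul, AlgHom.toLinearMap_apply,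
      map_one, ← LinearMap.comp_apply, ← LinearMap.lTensor_comp, hX, LinearMap.lTensor_id,
      LinearMap.id_apply, add_sub_cancel]
  rw [← SuperPoint.eval_eq_of_toTensor_eq hq]
  exact hone

theorem restrictInvariants_initial_injective (hΓ : IsGoodGrading Γ f)
    (hf : f ∈ parity (g := g) 0) {z : g} (hz0 : z ∈ parity (g := g) 0) (hz : z ∈ Γ 0)
    (hinj : ∀ n : ℤ, 1 ≤ n → ∀ x ∈ Γ n, bracket z x = 0 → x = 0) :
    Function.Injective (restrictInvariants Γ f (gIni_le_gGe Γ)) := by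
  rw [injective_iff_map_eq_zero]
  rintro ⟨F, hF⟩ h0
  exact Subtype.ext (eval_eq_zero_of_restrict_eq_zero (isSupercommutative_coordGrading _) hΓ hf hz0
    hz hinj hF h0 (SuperPoint.generic (gGe Γ)))

end Initial

end LieSuperalgebra

/-! ### Faithful completely reducible modules -/

namespace LieModule

open LieAlgebra

variable {K L M : Type*} [Field K] [LieRing L] [AddCommGroup M] [Module K M] [LieRingModule L M]

theorem eq_top_of_forall_inf_ne_bot [ComplementedLattice (LieSubmodule K L M)]
    {N : LieSubmodule K L M}
    (h : ∀ N' : LieSubmodule K L M, N' ≠ ⊥ → ∃ m ∈ N', m ∈ N ∧ m ≠ 0) : N = ⊤ := by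
  obtain ⟨N', hN'⟩ := exists_isCompl N
  by_cases hb : N' = ⊥
  · simpa [hb] using hN'.sup_eq_top
  · obtain ⟨m, hm', hm, h0⟩ := h N' hb
    have hmem : m ∈ N ⊓ N' := (LieSubmodule.mem_inf _ _ _).2 ⟨hm, hm'⟩
    rw [hN'.inf_eq_bot] at hmem
    exact (h0 ((LieSubmodule.mem_bot m).1 hmem)).elim

variable [LieAlgebra K L] [LieModule K L M]

/-- The vectors of `M` killed by the ideal `I`; they form a submodule. -/
def annihilatedBy (M : Type*) [AddCommGroup M] [Module K M] [LieRingModule L M] [LieModule K L M]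
    (I : LieIdeal K L) : LieSubmodule K L M where
  carrier := {m | ∀ x ∈ I, ⁅x, m⁆ = 0}
  add_mem' {a b} ha hb x hx := by rw [lie_add, ha x hx, hb x hx, add_zero]
  zero_mem' x _ := lie_zero x
  smul_mem' c a ha x hx := by rw [lie_smul, ha x hx, smul_zero]
  lie_mem {y m} hm x hx := by
    have h1 : ⁅⁅x, y⁆, m⁆ = 0 := hm _ (by rw [← lie_skew]; exact I.neg_mem (I.lie_mem hx))
    rw [leibniz_lie, h1, hm x hx, lie_zero, add_zero]

variable (M) in
/-- If every non-zero submodule of `M` contains a non-zero vector killed by the ideal `I`, then a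
complement of the submodule of all such vectors is zero. So `I` kills `M`, and is zero. -/
theorem eq_zero_of_forall_exists [ComplementedLattice (LieSubmodule K L M)]
    [IsFaithful K L M] (I : LieIdeal K L)
    (h : ∀ N : LieSubmodule K L M, N ≠ ⊥ → ∃ m ∈ N, m ≠ 0 ∧ ∀ x ∈ I, ⁅x, m⁆ = 0) {x : L}
    (hx : x ∈ I) : x = 0 := by
  have htop : annihilatedBy M I = ⊤ := eq_top_of_forall_inf_ne_bot fun N hN => by
    obtain ⟨m, hm, h0, hI⟩ := h N hN
    exact ⟨m, hm, hI, h0⟩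
  refine (toEnd_eq_zero_iff (R := K) (L := L) (M := M)).1 (LinearMap.ext fun m => ?_)
  have : m ∈ annihilatedBy M I := htop ▸ LieSubmodule.mem_top m
  exact this x hx

theorem eq_zero_of_central_of_isNilpotent [ComplementedLattice (LieSubmodule K L M)]
    [IsFaithful K L M] {x : L} (hx : ∀ y : L, ⁅x, y⁆ = 0)
    (hn : _root_.IsNilpotent (toEnd K L M x)) : x = 0 := by
  let N : LieSubmodule K L M :=
    { LinearMap.ker (toEnd K L M x) with
      lie_mem := fun {y m} hm => by
        have hm' : ⁅x, m⁆ = 0 := hm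
        change ⁅x, ⁅y, m⁆⁆ = 0
        rw [leibniz_lie, hx, zero_lie, hm', lie_zero, add_zero] }
  have htop : N = ⊤ := eq_top_of_forall_inf_ne_bot fun N' hN' => by
    obtain ⟨⟨m, hm⟩, h0⟩ := @exists_ne _ ((LieSubmodule.nontrivial_iff_ne_bot K L M).2 hN') 0
    replace h0 : m ≠ 0 := fun h => h0 (Subtype.ext h)
    obtain ⟨n, hn⟩ := hn
    by_contra! hcon
    have hmem : ∀ k, ((toEnd K L M x) ^ k) m ∈ N' ∧ ((toEnd K L M x) ^ k) m ≠ 0 := by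
      intro k
      induction k with
      | zero => exact ⟨hm, h0⟩
      | succ k ih =>
        rw [pow_succ']
        refine ⟨N'.lie_mem ih.1, fun h => ih.2 (hcon _ ih.1 h)⟩
    exact (hmem n).2 (by rw [hn]; rfl)
  refine (toEnd_eq_zero_iff (R := K) (L := L) (M := M)).1 (LinearMap.ext fun m => ?_)
  have : m ∈ N := htop ▸ LieSubmodule.mem_top m
  exact this

theorem trace_toEnd_eq_zero_of_mem_lie {N : Type*} [AddCommGroup N] [Module K N]
    [LieRingModule L N] [LieModule K L N] {x : L}
    (hx : x ∈ (⁅(⊤ : LieIdeal K L), (⊤ : LieIdeal K L)⁆ : LieIdeal K L)) :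
    LinearMap.trace K N (toEnd K L N x) = 0 := by
  rw [← LieSubmodule.mem_toSubmodule, LieSubmodule.lieIdeal_oper_eq_linear_span'] at hx
  induction hx using Submodule.span_induction with
  | mem x hx =>
    obtain ⟨a, -, b, -, rfl⟩ := hx
    simp
  | zero => simp
  | add x y _ _ hx hy => rw [map_add, map_add, hx, hy, add_zero]
  | smul c x _ hx => rw [map_smul, map_smul, hx, smul_zero]

variable (M)
variable [CharZero K] [ComplementedLattice (LieSubmodule K L M)] [IsFaithful K L M]
  [FiniteDimensional K L] [FiniteDimensional K M]

/-- The radical of the trace form is an ideal on which the form vanishes, hence solvable. -/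
theorem mem_radical_of_traceForm_eq_zero {x : L} (hx : ∀ y, traceForm K L M x y = 0) :
    x ∈ radical K L := by
  let I : LieIdeal K L :=
    { LinearMap.ker (traceForm K L M) with
      lie_mem := fun {y z} hz => by
        refine LinearMap.ext fun w => ?_
        have hz' : traceForm K L M z = 0 := hz
        rw [← lie_skew, map_neg, LinearMap.neg_apply, traceForm_apply_lie_apply, hz']
        simp }
  have hI : ∀ y ∈ I, traceForm K L M y = 0 := fun y hy => hy
  have htf : traceForm K I M = 0 := by
    ext ⟨a, ha⟩ ⟨b, hb⟩
    exact LinearMap.congr_fun (hI a ha) b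
  have hnil : LieModule.IsNilpotent (derivedSeries K I 1) M :=
    isNilpotent_derivedSeries_of_traceForm_eq_zero htf
  -- `[I, I]` acts nilpotently, hence has a non-zero invariant in every submodule
  have hab : ∀ y ∈ ⁅I, I⁆, y = 0 := fun y hy => by
    refine eq_zero_of_forall_exists M ⁅I, I⁆ (fun N hN => ?_) hy
    have : Nontrivial N := (LieSubmodule.nontrivial_iff_ne_bot K L M).2 hN
    have hnilN : LieModule.IsNilpotent (derivedSeries K I 1) N := by
      rw [isNilpotent_iff_forall' (R := K)] at hnil ⊢
      intro y
      obtain ⟨k, hk⟩ := hnil y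
      refine ⟨k, LinearMap.ext fun m => Subtype.ext ?_⟩
      have hpow : ∀ k : ℕ, (((toEnd K (derivedSeries K I 1) N y ^ k) m : N) : M) =
          (toEnd K (derivedSeries K I 1) M y ^ k) m := by
        intro k
        induction k with
        | zero => rfl
        | succ k ih =>
          rw [pow_succ', pow_succ', Module.End.mul_apply, Module.End.mul_apply, ← ih]
          rfl
      rw [hpow, hk]
      rfl
    have := nontrivial_max_triv_of_isNilpotent K (derivedSeries K I 1) N
    obtain ⟨⟨m, hm⟩, h0⟩ := exists_ne (0 : maxTrivSubmodule K (derivedSeries K I 1) N)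
    rw [mem_maxTrivSubmodule] at hm
    refine ⟨m, m.2, fun h => h0 (Subtype.ext (Subtype.ext h)), fun w hw => ?_⟩
    have hwI : w ∈ I := LieSubmodule.lie_le_left I I hw
    exact congrArg Subtype.val (hm ⟨⟨w, hwI⟩, by
      rwa [LieIdeal.derivedSeries_eq_derivedSeriesOfIdeal_comap, LieIdeal.mem_comap]⟩)
  have : LieAlgebra.IsSolvable I := by
    have : IsLieAbelian I := ⟨fun a b => Subtype.ext (hab _ (LieSubmodule.lie_mem_lie a.2 b.2))⟩
    infer_instance
  exact (LieIdeal.solvable_iff_le_radical K L I).1 this (LinearMap.ext hx)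

variable [IsAlgClosed K]

/-- Solvable ideals meet the derived algebra trivially: on a weight space of the radical in a
submodule, an element of the derived algebra acts by a scalar of trace zero. -/
theorem eq_zero_of_mem_radical_of_mem_lie (M : Type*) [AddCommGroup M] [Module K M]
    [LieRingModule L M] [LieModule K L M] [ComplementedLattice (LieSubmodule K L M)]
    [IsFaithful K L M] [FiniteDimensional K M] {x : L} (hx : x ∈ radical K L)
    (hx' : x ∈ (⁅(⊤ : LieIdeal K L), (⊤ : LieIdeal K L)⁆ : LieIdeal K L)) : x = 0 := by
  refine eq_zero_of_forall_exists M
    (radical K L ⊓ (⁅(⊤ : LieIdeal K L), (⊤ : LieIdeal K L)⁆ : LieIdeal K L)) (fun N hN => ?_)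
    (LieSubmodule.mem_inf _ _ _ |>.2 ⟨hx, hx'⟩)
  have : Nontrivial N := (LieSubmodule.nontrivial_iff_ne_bot K L M).2 hN
  obtain ⟨χ, hχ⟩ := exists_nontrivial_weightSpace_of_isSolvable K (radical K L) N
  let N' : LieSubmodule K L N := weightSpaceOfIsLieTower K N χ
  have hN' : Nontrivial N' := hχ
  have hact : ∀ (y : L) (hy : y ∈ radical K L) (m : N'), ⁅y, m⁆ = χ ⟨y, hy⟩ • m := by
    intro y hy m
    have hm : (m : N) ∈ weightSpace N χ := m.2
    rw [mem_weightSpace] at hm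
    exact Subtype.ext (hm ⟨y, hy⟩)
  obtain ⟨m, hm⟩ := exists_ne (0 : N')
  refine ⟨((m : N) : M), (m : N).2, fun h => hm (Subtype.ext (Subtype.ext h)), fun y hy => ?_⟩
  obtain ⟨hy, hy'⟩ := (LieSubmodule.mem_inf _ _ _).1 hy
  have htr := trace_toEnd_eq_zero_of_mem_lie (N := N') hy'
  have hs : toEnd K L N' y = χ ⟨y, hy⟩ • LinearMap.id := LinearMap.ext fun m => hact y hy m
  rw [hs, map_smul, LinearMap.trace_id, smul_eq_mul, mul_eq_zero] at htr
  have h0 : χ ⟨y, hy⟩ = 0 := htr.resolve_right (by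
    exact_mod_cast (Module.finrank_pos (R := K) (M := N')).ne')
  have := hact y hy m
  rw [h0, zero_smul] at this
  exact congrArg (fun m : N' => ((m : N) : M)) this

/-- The radical of the trace form is central. -/
theorem lie_eq_zero_of_traceForm_eq_zero {x : L} (hx : ∀ y, traceForm K L M x y = 0) (y : L) :
    ⁅x, y⁆ = 0 := by
  refine eq_zero_of_mem_radical_of_mem_lie (K := K) M ?_
    (LieSubmodule.lie_mem_lie (LieSubmodule.mem_top x) (LieSubmodule.mem_top y))
  rw [← lie_skew]
  exact (radical K L).neg_mem ((radical K L).lie_mem (mem_radical_of_traceForm_eq_zero M hx))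

/-- A functional `y ↦ tr (T y)` is represented, on the derived algebra, by the trace form. -/
theorem exists_traceForm_eq (T : Module.End K M) : ∃ z : L,
    ∀ y ∈ (⁅(⊤ : LieIdeal K L), (⊤ : LieIdeal K L)⁆ : LieIdeal K L),
      traceForm K L M z y = LinearMap.trace K M (T * toEnd K L M y) := by
  let D := (⁅(⊤ : LieIdeal K L), (⊤ : LieIdeal K L)⁆ : LieIdeal K L).toSubmodule
  let B : L →ₗ[K] Module.Dual K D := (traceForm K L M).compl₂ D.subtype
  have hB : Function.Surjective B := by
    rw [← LinearMap.flip_injective_iff₁, ← LinearMap.ker_eq_bot, LinearMap.ker_eq_bot']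
    intro y hy
    refine Subtype.ext (eq_zero_of_mem_radical_of_mem_lie M
      (mem_radical_of_traceForm_eq_zero M fun w => ?_) y.2)
    rw [traceForm_comm]
    exact LinearMap.congr_fun hy w
  obtain ⟨z, hz⟩ := hB (LinearMap.trace K M ∘ₗ LinearMap.mulLeft K T ∘ₗ
    (toEnd K L M : L →ₗ[K] Module.End K M) ∘ₗ D.subtype)
  exact ⟨z, fun y hy => LinearMap.congr_fun hz ⟨y, hy⟩⟩

/-- A derivation `d` of `L` that is induced by an endomorphism of `M` is inner modulo the radical of
the trace form. -/
theorem exists_forall_traceForm_sub_lie_eq_zero {d : L → L} {T : Module.End K M}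
    (hT : ∀ (y : L) (m : M), T ⁅y, m⁆ = ⁅d y, m⁆ + ⁅y, T m⁆) :
    ∃ z : L, ∀ y w : L, traceForm K L M (d y - ⁅z, y⁆) w = 0 := by
  obtain ⟨z, hz⟩ := exists_traceForm_eq M T (L := L)
  refine ⟨z, fun y w => ?_⟩
  have hd : toEnd K L M (d y) = T * toEnd K L M y - toEnd K L M y * T := by
    ext m
    simp [hT]
  have hyw : toEnd K L M ⁅y, w⁆ =
      toEnd K L M y * toEnd K L M w - toEnd K L M w * toEnd K L M y := by
    ext m
    simp
  rw [map_sub, LinearMap.sub_apply, traceForm_apply_lie_apply,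
    hz _ (LieSubmodule.lie_mem_lie (LieSubmodule.mem_top y) (LieSubmodule.mem_top w)), hyw,
    traceForm_apply_apply, hd, ← Module.End.mul_eq_comp, sub_mul, mul_sub, map_sub, map_sub,
    ← mul_assoc, ← mul_assoc, LinearMap.trace_mul_comm K (T * toEnd K L M w)]
  rw [← mul_assoc, LinearMap.trace_mul_cycle K (toEnd K L M y) T]
  simp [mul_assoc]

/-- A coroot on which its root vanishes is zero: every weight of `M` vanishes on it as well, so it
lies in the radical of the trace form. -/
theorem eq_zero_of_mem_corootSpace (M : Type*) [AddCommGroup M] [Module K M]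
    [LieRingModule L M] [LieModule K L M] [ComplementedLattice (LieSubmodule K L M)]
    [IsFaithful K L M] [FiniteDimensional K M] {H : LieSubalgebra K L} [H.IsCartanSubalgebra]
    {α : H → K}
    (hα : α ≠ 0) {t : H} (ht : t ∈ corootSpace α) (h0 : α t = 0) : t = 0 := by
  have hχ : ∀ χ : Weight K H M, χ t = 0 := fun χ => by
    obtain ⟨a, b, hb, h⟩ := exists_forall_mem_corootSpace_smul_add_eq_zero M α χ hα
      χ.genWeightSpace_ne_bot
    have := h t ht
    rw [Pi.add_apply, Pi.smul_apply, Pi.smul_apply, h0, smul_zero, zero_add, zsmul_eq_mul,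
      mul_eq_zero] at this
    exact this.resolve_left (by exact_mod_cast hb.ne')
  have htr : ∀ y : L, traceForm K L M t y = 0 := fun y => by
    have ht0 : (t : L) ∈ genWeightSpace L (0 : H → K) := by
      have := (rootSpace_zero_eq K L H).ge
      exact this t.2
    have hy : y ∈ genWeightSpace L (0 : H → K) ⊔ posFittingComp K H L := by
      rw [(isCompl_genWeightSpace_zero_posFittingComp K H L).sup_eq_top]
      exact LieSubmodule.mem_top y
    obtain ⟨y₀, hy₀, y₁, hy₁, rfl⟩ := (LieSubmodule.mem_sup _ _ _).1 hy
    have hy₀' : y₀ ∈ H := (rootSpace_zero_eq K L H).le hy₀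
    rw [map_add, eq_zero_of_mem_genWeightSpace_mem_posFitting K H L
      (B := traceForm K L M) (fun x m n => traceForm_apply_lie_apply' K L M x m n) ht0 hy₁,
      add_zero]
    have := traceForm_eq_sum_finrank_nsmul_mul K H M t ⟨y₀, hy₀'⟩
    simp only [hχ, zero_mul, smul_zero, Finset.sum_const_zero] at this
    exact this
  refine Subtype.ext (eq_zero_of_mem_radical_of_mem_lie (K := K) M
    (mem_radical_of_traceForm_eq_zero M htr) ?_)
  rw [mem_corootSpace] at ht
  generalize (t : L) = w at ht
  induction ht using Submodule.span_induction with
  | mem x hx =>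
    obtain ⟨a, -, b, -, rfl⟩ := hx
    exact LieSubmodule.lie_mem_lie (LieSubmodule.mem_top a) (LieSubmodule.mem_top b)
  | zero => exact zero_mem _
  | add x y _ _ hx hy => exact add_mem hx hy
  | smul c x _ hx => exact SMulMemClass.smul_mem c hx

end LieModule

/-- If `ad z` is semisimple at the eigenvalue zero, there is a Cartan subalgebra containing `z` and
centralizing it: a Cartan subalgebra of the centralizer of `z`. -/
theorem LieAlgebra.exists_isCartanSubalgebra_of_engel {K L : Type*} [Field K] [Infinite K]
    [LieRing L] [LieAlgebra K L] [FiniteDimensional K L] {z : L}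
    (hz : ∀ y ∈ LieSubalgebra.engel K z, ⁅z, y⁆ = 0) :
    ∃ H : LieSubalgebra K L, H.IsCartanSubalgebra ∧ z ∈ H ∧ ∀ y ∈ H, ⁅z, y⁆ = 0 := by
  set C := LieSubalgebra.engel K z
  obtain ⟨x, hx⟩ := LieAlgebra.exists_isCartanSubalgebra_engel K C
  let E := LieSubalgebra.engel K x
  have hE : E.IsCartanSubalgebra := hx
  let φ : E →ₗ⁅K⁆ L := C.incl.comp E.incl
  have hzC : z ∈ C := LieSubalgebra.self_mem_engel K z
  have hC : ∀ y ∈ φ.range, ∃ h : y ∈ C, ⟨y, h⟩ ∈ E := by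
    rintro _ ⟨y, rfl⟩
    exact ⟨y.1.2, y.2⟩
  have hzE : (⟨z, hzC⟩ : C) ∈ E := by
    rw [LieSubalgebra.mem_engel_iff]
    refine ⟨1, Subtype.ext ?_⟩
    rw [pow_one, LieAlgebra.ad_apply, LieSubalgebra.coe_bracket, ← lie_skew, hz _ x.2]
    simp
  have hzr : z ∈ φ.range := ⟨⟨⟨z, hzC⟩, hzE⟩, rfl⟩
  refine ⟨φ.range, ⟨?_, ?_⟩, hzr, fun y hy => hz y (hC y hy).1⟩
  · exact φ.surjective_rangeRestrict.lieAlgebra_isNilpotent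
  · refine le_antisymm (fun y hy => ?_) φ.range.le_normalizer
    rw [LieSubalgebra.mem_normalizer_iff] at hy
    have hyC : y ∈ C := by
      rw [LieSubalgebra.mem_engel_iff]
      refine ⟨2, ?_⟩
      rw [pow_two, Module.End.mul_apply, LieAlgebra.ad_apply, LieAlgebra.ad_apply, ← lie_skew z y,
        lie_neg, hz _ (hC _ (hy z hzr)).1, neg_zero]
    have hyE : (⟨y, hyC⟩ : C) ∈ E.normalizer := by
      rw [LieSubalgebra.mem_normalizer_iff]
      intro w hw
      exact (hC _ (hy w ⟨⟨w, hw⟩, rfl⟩)).2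
    rw [hE.self_normalizing] at hyE
    exact ⟨⟨⟨y, hyC⟩, hyE⟩, rfl⟩

namespace LieSuperalgebra

/-! ### The even part and its modules -/

/-- The even part of a Lie superalgebra, a Lie algebra acting on the superalgebra. -/
abbrev EvenPart (g : Type*) [AddCommGroup g] [Module ℂ g] [LieSuperalgebra g] : Type _ :=
  ↥(parity (g := g) 0)

section EvenPart

variable {g : Type*} [AddCommGroup g] [Module ℂ g] [LieSuperalgebra g]

theorem bracket_leibniz {a : g} (ha : a ∈ parity (g := g) 0) (x y : g) :
    bracket a (bracket x y) = bracket (bracket a x) y + bracket x (bracket a y) := by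
  have h : ∀ i, ∀ x ∈ parity (g := g) i,
      bracket a (bracket x y) = bracket (bracket a x) y + bracket x (bracket a y) := by
    intro i x hx
    rw [jacobi 0 i a ha x hx y, superSign_zero_left, one_smul]
  rw [← parityProj_add parity x]
  simp only [map_add, LinearMap.add_apply]
  rw [h 0 _ (parityProj_mem _ 0 x), h 1 _ (parityProj_mem _ 1 x)]
  abel

theorem bracket_skew_of_even {a : g} (ha : a ∈ parity (g := g) 0) (x : g) :
    bracket x a = -bracket a x := by
  have h : ∀ i, ∀ x ∈ parity (g := g) i, bracket x a = -bracket a x := by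
    intro i x hx
    rw [skew i 0 x hx a ha, superSign_zero_right, one_smul]
  rw [← parityProj_add parity x]
  simp only [map_add, LinearMap.add_apply]
  rw [h 0 _ (parityProj_mem _ 0 x), h 1 _ (parityProj_mem _ 1 x)]
  abel

theorem bracket_self_of_even {a : g} (ha : a ∈ parity (g := g) 0) : bracket a a = 0 := by
  have h := bracket_skew_of_even ha a
  rwa [eq_neg_iff_add_eq_zero, ← two_smul ℂ, smul_eq_zero, or_iff_right two_ne_zero] at h

instance : LieRing (EvenPart g) where
  bracket a b := ⟨bracket (a : g) b, by simpa using bracket_mem 0 0 (a : g) a.2 b b.2⟩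
  add_lie a b c := Subtype.ext (by simp)
  lie_add a b c := Subtype.ext (by simp)
  lie_self a := Subtype.ext (bracket_self_of_even a.2)
  leibniz_lie a b c := Subtype.ext (bracket_leibniz a.2 _ _)

instance : LieAlgebra ℂ (EvenPart g) where
  lie_smul _ _ _ := Subtype.ext (map_smul _ _ _)

instance : LieRingModule (EvenPart g) g where
  bracket a x := bracket (a : g) x
  add_lie a b x := by simp
  lie_add a x y := map_add _ _ _
  leibniz_lie a b x := bracket_leibniz a.2 _ _

instance : LieModule ℂ (EvenPart g) g where
  smul_lie c a x := by simp [Bracket.bracket]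
  lie_smul c a x := map_smul _ _ _

/-- The even or odd part as a module over the even part. -/
def paritySubmodule (g : Type*) [AddCommGroup g] [Module ℂ g] [LieSuperalgebra g] (i : ZMod 2) :
    LieSubmodule ℂ (EvenPart g) g where
  toSubmodule := parity i
  lie_mem {a x} hx := by
    have h := bracket_mem 0 i (a : g) a.2 x hx
    rwa [zero_add] at h

/-- A simple Lie superalgebra has no center: the elements with central homogeneous components form a
graded ideal. -/
theorem eq_zero_of_forall_bracket_eq_zero (hg : IsSimple g) {i : ZMod 2} {x : g}
    (hx : x ∈ parity (g := g) i) (h : ∀ y, bracket x y = 0) : x = 0 := by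
  let Z : Submodule ℂ g :=
    { carrier := {x | ∀ i y, bracket (parityProj parity i x) y = 0}
      add_mem' := fun ha hb i y => by rw [map_add, map_add, LinearMap.add_apply, ha, hb, add_zero]
      zero_mem' := fun i y => by simp
      smul_mem' := fun c a ha i y => by simp [ha i y] }
  have hproj : ∀ (i j : ZMod 2) (x : g), parityProj parity j (parityProj parity i x) =
      if i = j then parityProj parity i x else 0 := by
    intro i j x
    split_ifs with hij
    · rw [hij, parityProj_same _ (parityProj_mem _ j x)]
    · rw [parityProj_ne _ hij (parityProj_mem _ i x)]
  have hZ : Z = ⊥ ∨ Z = ⊤ := by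
    refine hg.2 Z (fun i x hx j y => ?_) (fun x y hy => ?_)
    · rw [hproj]
      split_ifs
      · exact hx i y
      · simp
    · have h0 : bracket x y = 0 := by
        have : ∀ i j, bracket (parityProj parity i x) (parityProj parity j y) = 0 := by
          intro i j
          rw [skew i j _ (parityProj_mem _ i x) _ (parityProj_mem _ j y), hy, smul_zero, neg_zero]
        rw [← parityProj_add parity x, ← parityProj_add parity y]
        simp only [map_add, LinearMap.add_apply, this, add_zero]
      rw [h0]
      exact zero_mem Z
  have hxZ : x ∈ Z := by
    intro j y
    by_cases hij : i = j
    · subst hij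
      rw [parityProj_same _ hx, h]
    · rw [parityProj_ne _ hij hx, map_zero, LinearMap.zero_apply]
  rcases hZ with hZ | hZ
  · rwa [hZ, Submodule.mem_bot] at hxZ
  · obtain ⟨x, y, hxy⟩ := hg.1
    refine (hxy ?_).elim
    have hx : ∀ x ∈ Z, bracket x y = 0 := by
      intro x hx
      rw [← parityProj_add parity x, map_add, LinearMap.add_apply, hx 0, hx 1, add_zero]
    exact hx x (hZ ▸ Submodule.mem_top)

/-- The odd part, or the even part if the odd part vanishes, is a faithful completely reducible
module over the even part. -/
theorem exists_isFaithful (hg : IsBasicClassical g) : ∃ i : ZMod 2,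
    ComplementedLattice (LieSubmodule ℂ (EvenPart g) (paritySubmodule g i)) ∧
      LieModule.IsFaithful ℂ (EvenPart g) (paritySubmodule g i) := by
  have hfaith : ∀ i, (∀ a ∈ parity (g := g) 0, (∀ x ∈ parity (g := g) i, bracket a x = 0) → a = 0) →
      LieModule.IsFaithful ℂ (EvenPart g) (paritySubmodule g i) := by
    refine fun i h => ⟨(injective_iff_map_eq_zero _).2 fun a ha => Subtype.ext (h a a.2 ?_)⟩
    intro x hx
    exact congrArg Subtype.val (LinearMap.congr_fun ha (⟨x, hx⟩ : paritySubmodule g i))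
  by_cases hV : parity (g := g) 1 = ⊥
  · have htop : ∀ x : g, x ∈ parity (g := g) 0 := by
      intro x
      have : parityProj parity 1 x = 0 := (Submodule.mem_bot ℂ).1 (hV ▸ parityProj_mem _ 1 x)
      rw [← parityProj_add parity x, this, add_zero]
      exact parityProj_mem _ 0 x
    refine ⟨0, ⟨fun N => ?_⟩, hfaith 0 fun a ha h =>
      eq_zero_of_forall_bracket_eq_zero hg.simple ha fun y => h y (htop y)⟩
    have hN : (N.toSubmodule.map (paritySubmodule g 0).toSubmodule.subtype) = ⊥ ∨
        (N.toSubmodule.map (paritySubmodule g 0).toSubmodule.subtype) = ⊤ := by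
      refine hg.simple.2 _ ?_ ?_
      · rintro i x hx
        rcases zmod_two_cases i with rfl | rfl
        · rwa [parityProj_same _ (htop x)]
        · rw [parityProj_ne _ (by decide) (htop x)]
          exact zero_mem _
      · rintro x _ ⟨y, hy, rfl⟩
        exact ⟨_, N.lie_mem (x := ⟨x, htop x⟩) hy, rfl⟩
    rcases hN with hN | hN
    · refine ⟨⊤, ?_⟩
      have : N = ⊥ := by
        rw [eq_bot_iff]
        intro x hx
        have : (x : g) ∈ (⊥ : Submodule ℂ g) := hN ▸ ⟨x, hx, rfl⟩
        exact (LieSubmodule.mem_bot x).2 (Subtype.ext ((Submodule.mem_bot ℂ).1 this))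
      rw [this]
      exact isCompl_bot_top
    · refine ⟨⊥, ?_⟩
      have : N = ⊤ := by
        rw [eq_top_iff]
        intro x _
        have : (x : g) ∈ N.toSubmodule.map (paritySubmodule g 0).toSubmodule.subtype :=
          hN ▸ Submodule.mem_top
        obtain ⟨y, hy, hxy⟩ := this
        rwa [← Subtype.ext hxy]
      rw [this]
      exact isCompl_top_bot
  · refine ⟨1, ⟨fun N => ?_⟩, hfaith 1 ?_⟩
    · obtain ⟨N', hle, hst, hinf, hsup⟩ := hg.classical
        (N.toSubmodule.map (paritySubmodule g 1).toSubmodule.subtype)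
        (by rintro _ ⟨y, -, rfl⟩; exact y.2)
        (by rintro a ha _ ⟨y, hy, rfl⟩; exact ⟨_, N.lie_mem (x := ⟨a, ha⟩) hy, rfl⟩)
      let N₁ : LieSubmodule ℂ (EvenPart g) (paritySubmodule g 1) :=
        { N'.comap (paritySubmodule g 1).toSubmodule.subtype with
          lie_mem := fun {a x} hx => hst a a.2 x hx }
      have hN₁ : ∀ x, x ∈ N₁ ↔ (x : g) ∈ N' := fun x => Iff.rfl
      refine ⟨N₁, IsCompl.of_eq ?_ ?_⟩
      · rw [eq_bot_iff]
        intro x hx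
        obtain ⟨h1, h2⟩ := (LieSubmodule.mem_inf _ _ _).1 hx
        have : (x : g) ∈ (⊥ : Submodule ℂ g) := hinf ▸ ⟨⟨x, h1, rfl⟩, h2⟩
        exact (LieSubmodule.mem_bot x).2 (Subtype.ext ((Submodule.mem_bot ℂ).1 this))
      · rw [eq_top_iff]
        rintro x -
        have hx : (x : g) ∈ parity (g := g) 1 := x.2
        rw [← hsup] at hx
        obtain ⟨_, ⟨y, hy, rfl⟩, y', hy', hxy⟩ := Submodule.mem_sup.1 hx
        refine (LieSubmodule.mem_sup _ _ _).2 ⟨y, hy, ⟨y', hle hy'⟩, hy', Subtype.ext hxy⟩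
    · let I : Submodule ℂ g :=
        { carrier := {a | a ∈ parity (g := g) 0 ∧ ∀ x ∈ parity (g := g) 1, bracket a x = 0}
          add_mem' := fun ha hb => ⟨add_mem ha.1 hb.1, fun x hx => by
            rw [map_add, LinearMap.add_apply, ha.2 x hx, hb.2 x hx, add_zero]⟩
          zero_mem' := ⟨zero_mem _, fun x _ => by simp⟩
          smul_mem' := fun c a ha => ⟨Submodule.smul_mem _ c ha.1, fun x hx => by
            rw [map_smul, LinearMap.smul_apply, ha.2 x hx, smul_zero]⟩ }
      have hI : I = ⊥ ∨ I = ⊤ := by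
        refine hg.simple.2 I ?_ ?_
        · intro i x hx
          rcases zmod_two_cases i with rfl | rfl
          · rwa [parityProj_same _ hx.1]
          · rw [parityProj_ne _ (by decide) hx.1]
            exact zero_mem _
        · intro y a ha
          have h0 : ∀ y ∈ parity (g := g) 0, bracket y a ∈ I := by
            intro y hy
            refine ⟨by simpa using bracket_mem 0 0 y hy a ha.1, fun x hx => ?_⟩
            have h := bracket_leibniz hy a x
            rw [ha.2 x hx, map_zero, ha.2 _ (by simpa using bracket_mem 0 1 y hy x hx),
              add_zero] at h
            exact h.symm
          have h1 : ∀ y ∈ parity (g := g) 1, bracket y a ∈ I := by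
            intro y hy
            rw [bracket_skew_of_even ha.1, ha.2 y hy, neg_zero]
            exact zero_mem _
          rw [← parityProj_add parity y, map_add, LinearMap.add_apply]
          exact add_mem (h0 _ (parityProj_mem _ 0 y)) (h1 _ (parityProj_mem _ 1 y))
      rcases hI with hI | hI
      · intro a ha h
        have : a ∈ I := ⟨ha, h⟩
        rwa [hI, Submodule.mem_bot] at this
      · refine (hV (eq_bot_iff.2 fun x hx => ?_)).elim
        have : x ∈ I := hI ▸ Submodule.mem_top
        exact (Submodule.mem_bot ℂ).2 (parity_inf_eq_bot parity this.1 hx)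

/-- An odd element killed by the even part is orthogonal to its brackets with odd elements, hence
central, hence zero. -/
theorem eq_zero_of_forall_even_bracket_eq_zero (hg : IsSimple g) {κ : g →ₗ[ℂ] g →ₗ[ℂ] ℂ}
    (hκ : IsBasicForm κ) {x : g} (hx : x ∈ parity (g := g) 1)
    (h : ∀ a ∈ parity (g := g) 0, bracket a x = 0) : x = 0 := by
  have h0 : ∀ a ∈ parity (g := g) 0, bracket x a = 0 := fun a ha => by
    rw [bracket_skew_of_even ha, h a ha, neg_zero]
  have h1 : ∀ v ∈ parity (g := g) 1, bracket x v = 0 := by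
    intro v hv
    refine hκ.nondegenerate _ fun y => ?_
    have hxv : bracket x v ∈ parity (g := g) 0 := bracket_mem 1 1 x hx v hv
    have he : ∀ a ∈ parity (g := g) 0, κ (bracket x v) a = 0 := fun a ha => by
      rw [hκ.invariant, bracket_skew_of_even ha, map_neg, ← hκ.invariant, h0 a ha]
      simp
    rw [← parityProj_add parity y, map_add, he _ (parityProj_mem _ 0 y),
      hκ.even 0 1 (by decide) _ hxv _ (parityProj_mem _ 1 y), add_zero]
  refine eq_zero_of_forall_bracket_eq_zero hg hx fun y => ?_
  rw [← parityProj_add parity y, map_add, h0 _ (parityProj_mem _ 0 y), h1 _ (parityProj_mem _ 1 y),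
    add_zero]

end EvenPart

end LieSuperalgebra

/-! ### Zero is not an odd weight -/

/-- Generalized eigenvalues add up under a bilinear map of which `T` is a derivation. -/
theorem Module.End.apply_mem_maxGenEigenspace_add {K V : Type*} [Field K] [AddCommGroup V]
    [Module K V] {T : Module.End K V} {B : V →ₗ[K] V →ₗ[K] V}
    (hT : ∀ x y, T (B x y) = B (T x) y + B x (T y)) {a b : K} {x y : V}
    (hx : x ∈ T.maxGenEigenspace a) (hy : y ∈ T.maxGenEigenspace b) :
    B x y ∈ T.maxGenEigenspace (a + b) := by
  rw [Module.End.mem_maxGenEigenspace] at hx hy ⊢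
  obtain ⟨k, hx⟩ := hx
  obtain ⟨l, hy⟩ := hy
  refine ⟨k + l, ?_⟩
  generalize hn : k + l = n
  induction n generalizing k l x y with
  | zero =>
    obtain ⟨rfl, rfl⟩ : k = 0 ∧ l = 0 := by omega
    have hx0 : x = 0 := hx
    simp [hx0]
  | succ n ih =>
    have hstep : (T - (a + b) • (1 : Module.End K V)) (B x y) =
        B ((T - a • (1 : Module.End K V)) x) y + B x ((T - b • (1 : Module.End K V)) y) := by
      simp only [LinearMap.sub_apply, LinearMap.smul_apply, Module.End.one_apply, hT, map_sub,
        map_smul, add_smul, LinearMap.add_apply]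
      abel
    rw [pow_succ, Module.End.mul_apply, hstep, map_add]
    have h1 : ((T - (a + b) • (1 : Module.End K V)) ^ n)
        (B ((T - a • (1 : Module.End K V)) x) y) = 0 := by
      rcases k with _ | k
      · have hx0 : x = 0 := hx
        simp [hx0]
      · exact ih k (by rwa [pow_succ, Module.End.mul_apply] at hx) l hy (by omega)
    have h2 : ((T - (a + b) • (1 : Module.End K V)) ^ n)
        (B x ((T - b • (1 : Module.End K V)) y)) = 0 := by
      rcases l with _ | l
      · have hy0 : y = 0 := hy
        simp [hy0]
      · exact ih k hx l (by rwa [pow_succ, Module.End.mul_apply] at hy) (by omega)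
    rw [h1, h2, add_zero]

namespace LieSuperalgebra

open LieModule

section Weights

variable {g : Type*} [AddCommGroup g] [Module ℂ g] [LieSuperalgebra g]
  {H : LieSubalgebra ℂ (EvenPart g)} {κ : g →ₗ[ℂ] g →ₗ[ℂ] ℂ} (hκ : IsBasicForm κ)

include hκ in
theorem IsBasicForm.bracket_left {a : g} (ha : a ∈ parity (g := g) 0) (x y : g) :
    κ (bracket a x) y = -κ x (bracket a y) := by
  rw [← neg_neg (bracket a x), ← bracket_skew_of_even ha, map_neg, LinearMap.neg_apply,
    hκ.invariant]

include hκ in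
/-- For weight vectors `x` and `y` of opposite weights `±α` with `κ x y = 1`, the bracket `[x, y]`
is the element of the Cartan subalgebra dual to `α`. -/
theorem IsBasicForm.apply_bracket {α : H → ℂ} {x y : g} (hxα : ∀ h : H, ⁅h, x⁆ = α h • x)
    (hxy : κ x y = 1) (h : H) : κ (h : EvenPart g) (bracket x y) = α h := by
  rw [← hκ.invariant, show bracket ((h : EvenPart g) : g) x = α h • x from hxα h, map_smul,
    LinearMap.smul_apply, hxy, smul_eq_mul, mul_one]

variable (H) in
/-- The inclusion of the even part, as a homomorphism of modules over a subalgebra of it. -/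
def evenIncl : EvenPart g →ₗ⁅ℂ, H⁆ g :=
  { (parity (g := g) 0).subtype with map_lie' := rfl }

theorem evenIncl_injective : Function.Injective (evenIncl H) := Subtype.val_injective

variable [LieRing.IsNilpotent H]

theorem bracket_mem_genWeightSpace {χ ψ : H → ℂ} {x y : g} (hx : x ∈ genWeightSpace g χ)
    (hy : y ∈ genWeightSpace g ψ) : bracket x y ∈ genWeightSpace g (χ + ψ) := by
  rw [mem_genWeightSpace] at hx hy ⊢
  intro h
  exact (Module.End.mem_maxGenEigenspace _ _ _).1 (Module.End.apply_mem_maxGenEigenspace_add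
    (T := toEnd ℂ H g h) (B := bracket) (fun x y => bracket_leibniz h.1.2 x y)
    ((Module.End.mem_maxGenEigenspace _ _ _).2 (hx h))
    ((Module.End.mem_maxGenEigenspace _ _ _).2 (hy h)))

theorem parityProj_mem_genWeightSpace {χ : H → ℂ} {x : g} (hx : x ∈ genWeightSpace g χ)
    (i : ZMod 2) : parityProj parity i x ∈ genWeightSpace g χ := by
  let φ : g →ₗ⁅ℂ, H⁆ g := { parityProj (parity (g := g)) i with
    map_lie' := fun {a x} => parityProj_bracket_even a.1.2 i x }
  exact map_genWeightSpace_le φ (LieSubmodule.mem_map_of_mem hx)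

variable [FiniteDimensional ℂ g]

/-- Even elements of generalized weight zero lie in the Cartan subalgebra. -/
theorem mem_cartan_of_mem_genWeightSpace [H.IsCartanSubalgebra] {x : g}
    (hx : x ∈ parity (g := g) 0) (hx0 : x ∈ genWeightSpace g (0 : H → ℂ)) :
    (⟨x, hx⟩ : EvenPart g) ∈ H := by
  have h : (⟨x, hx⟩ : EvenPart g) ∈ genWeightSpace (EvenPart g) (0 : H → ℂ) := by
    rw [← comap_genWeightSpace_eq_of_injective evenIncl_injective]
    exact hx0
  exact (LieAlgebra.rootSpace_zero_eq ℂ (EvenPart g) H).le h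

theorem mem_genWeightSpace_zero_of_mem_cartan [H.IsCartanSubalgebra] {a : EvenPart g}
    (ha : a ∈ H) : (a : g) ∈ genWeightSpace g (0 : H → ℂ) := by
  have h := (LieAlgebra.rootSpace_zero_eq ℂ (EvenPart g) H).ge ha
  exact map_genWeightSpace_le (evenIncl H) (LieSubmodule.mem_map_of_mem h)

include hκ

/-- The form is non-degenerate on a Cartan subalgebra of the even part. -/
theorem IsBasicForm.eq_zero_of_mem_cartan [H.IsCartanSubalgebra] {t : EvenPart g} (ht : t ∈ H)
    (h : ∀ s ∈ H, κ t s = 0) : t = 0 := by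
  refine Subtype.ext (hκ.nondegenerate _ fun y => ?_)
  have hy : y ∈ genWeightSpace g (0 : H → ℂ) ⊔ posFittingComp ℂ H g := by
    rw [(isCompl_genWeightSpace_zero_posFittingComp ℂ H g).sup_eq_top]
    exact LieSubmodule.mem_top y
  obtain ⟨y₀, hy₀, y₁, hy₁, rfl⟩ := (LieSubmodule.mem_sup _ _ _).1 hy
  have h0 : κ t (parityProj parity 0 y₀) = 0 := h ⟨_, parityProj_mem _ 0 y₀⟩
    (mem_cartan_of_mem_genWeightSpace _ (parityProj_mem_genWeightSpace hy₀ 0))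
  rw [map_add, eq_zero_of_mem_genWeightSpace_mem_posFitting ℂ H g (B := κ)
    (fun a x y => hκ.bracket_left a.1.2 x y) (mem_genWeightSpace_zero_of_mem_cartan ht) hy₁,
    ← parityProj_add parity y₀, map_add, h0,
    hκ.even 0 1 (by decide) _ t.2 _ (parityProj_mem _ 1 y₀), add_zero, add_zero]

/-- Every weight vector has a dual vector of the opposite weight. -/
theorem IsBasicForm.exists_apply_eq_one {α : H → ℂ} {i : ZMod 2} {x : g}
    (hx : x ∈ parity (g := g) i) (hx0 : x ≠ 0) (hxα : ∀ h : H, ⁅h, x⁆ = α h • x) :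
    ∃ y ∈ parity (g := g) i, y ∈ genWeightSpace g (-α) ∧ κ x y = 1 := by
  -- a weight space pairing non-trivially with `x` has weight `-α`
  obtain ⟨χ, y, hy, hxy⟩ : ∃ χ : H → ℂ, ∃ y ∈ genWeightSpace g χ, κ x y ≠ 0 := by
    by_contra! hcon
    refine hx0 (hκ.nondegenerate x fun y => ?_)
    have hy : y ∈ ⨆ χ : H → ℂ, genWeightSpace g χ := by
      rw [iSup_genWeightSpace_eq_top ℂ H g]
      exact LieSubmodule.mem_top y
    induction hy using LieSubmodule.iSup_induction' with
    | mem χ y hy => exact hcon χ y hy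
    | zero => exact map_zero _
    | add y z _ _ hy hz => rw [map_add, hy, hz, add_zero]
  have hχ : χ = -α := by
    funext h
    obtain ⟨k, hk⟩ := (mem_genWeightSpace _ _ _).1 hy h
    have hpow : ∀ k : ℕ, ∀ y, κ x (((toEnd ℂ H g h - χ h • 1) ^ k) y) =
        (-α h - χ h) ^ k * κ x y := by
      intro k
      induction k with
      | zero => simp
      | succ k ih =>
        intro y
        have h1 : κ x ⁅h, y⁆ = -(α h * κ x y) := by
          have := hκ.bracket_left h.1.2 x y
          change κ ⁅h, x⁆ y = -κ x ⁅h, y⁆ at this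
          rw [hxα, map_smul, LinearMap.smul_apply, smul_eq_mul] at this
          rw [this, neg_neg]
        rw [pow_succ, Module.End.mul_apply, ih, LinearMap.sub_apply, map_sub, toEnd_apply_apply, h1]
        simp
        ring
    have h0 := hpow k y
    rw [hk, map_zero, eq_comm, mul_eq_zero, or_iff_left hxy] at h0
    exact (sub_eq_zero.1 (eq_zero_of_pow_eq_zero h0)).symm
  subst hχ
  have hproj : κ x (parityProj parity i y) = κ x y := by
    have hne : ∀ j, i ≠ j → κ x (parityProj parity j y) = 0 := fun j hij =>
      hκ.even i j hij x hx _ (parityProj_mem _ j y)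
    conv_rhs => rw [← parityProj_add parity y, map_add]
    rcases zmod_two_cases i with rfl | rfl
    · rw [hne 1 (by decide), add_zero]
    · rw [hne 0 (by decide), zero_add]
  refine ⟨(κ x y)⁻¹ • parityProj parity i y, Submodule.smul_mem _ _ (parityProj_mem _ i y), ?_, ?_⟩
  · exact SMulMemClass.smul_mem _ (parityProj_mem_genWeightSpace hy i)
  · rw [map_smul, hproj, smul_eq_mul, inv_mul_cancel₀ hxy]

omit hκ in
/-- A weight of a submodule over a nilpotent Lie algebra has a weight vector in the submodule. -/
theorem exists_weight_vector {L N : Type*} [LieRing L] [LieAlgebra ℂ L] [LieRing.IsNilpotent L]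
    [AddCommGroup N] [Module ℂ N] [LieRingModule L N] [LieModule ℂ L N] [FiniteDimensional ℂ N]
    (W : LieSubmodule ℂ L N) {χ : L → ℂ} {x : N} (hxW : x ∈ W) (hxχ : x ∈ genWeightSpace N χ)
    (hx : x ≠ 0) : ∃ m ∈ W, m ≠ 0 ∧ ∀ h : L, ⁅h, m⁆ = χ h • m := by
  have hne : genWeightSpace W χ ≠ ⊥ := by
    rw [← comap_genWeightSpace_eq_of_injective (f := W.incl) W.injective_incl]
    intro h
    have hmem : (⟨x, hxW⟩ : W) ∈ (genWeightSpace N χ).comap W.incl := hxχ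
    rw [h, LieSubmodule.mem_bot] at hmem
    exact hx (congrArg Subtype.val hmem)
  obtain ⟨m, hm, h⟩ := exists_forall_lie_eq_smul ℂ L W ⟨χ, hne⟩
  exact ⟨m, m.2, fun h0 => hm (Subtype.ext h0), fun y => congrArg Subtype.val (h y)⟩

/-- Let `T` be a derivation of `g` vanishing on the even part. Then zero is not a weight of a Cartan
subalgebra on the generalized eigenspace of `T` in the odd part for an eigenvalue `c ≠ 0`.
Otherwise a root `α` is a weight of this eigenspace as well. A vector `w` of weight `α` satisfies
`[w, w] = 0`, so that the Jacobi identity forces `α` to be isotropic, while a root of the even part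
is not. -/
theorem IsBasicForm.eq_zero_of_mem_genWeightSpace_zero (hg : IsSimple g) [H.IsCartanSubalgebra]
    {i : ZMod 2} [ComplementedLattice (LieSubmodule ℂ (EvenPart g) (paritySubmodule g i))]
    [IsFaithful ℂ (EvenPart g) (paritySubmodule g i)] {T : Module.End ℂ g}
    (hT : ∀ x y, T (bracket x y) = bracket (T x) y + bracket x (T y))
    (hT0 : ∀ a ∈ parity (g := g) 0, T a = 0) {c : ℂ} (hc : c ≠ 0) {x : g}
    (hx : x ∈ parity (g := g) 1) (hx0 : x ∈ genWeightSpace g (0 : H → ℂ))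
    (hxc : x ∈ T.maxGenEigenspace c) : x = 0 := by
  by_contra hxne
  have hlie : ∀ (a : EvenPart g), ∀ w ∈ parity (g := g) 1 ⊓ T.maxGenEigenspace c,
      ⁅a, w⁆ ∈ parity (g := g) 1 ⊓ T.maxGenEigenspace c := by
    rintro a w ⟨hw, hwc⟩
    refine ⟨(paritySubmodule g 1).lie_mem hw, ?_⟩
    have ha : (a : g) ∈ T.maxGenEigenspace 0 :=
      (Module.End.mem_maxGenEigenspace _ _ _).2 ⟨1, by simp [hT0 a a.2]⟩
    have h := Module.End.apply_mem_maxGenEigenspace_add hT ha hwc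
    rwa [zero_add] at h
  let W : LieSubmodule ℂ H g :=
    { parity (g := g) 1 ⊓ T.maxGenEigenspace c with lie_mem := fun {h w} hw => hlie h w hw }
  obtain ⟨m, hmW, hm0, hm⟩ := exists_weight_vector W (x := x) ⟨hx, hxc⟩ hx0 hxne
  have hmG : m ∈ genWeightSpace g (0 : H → ℂ) := by
    rw [mem_genWeightSpace]
    exact fun h => ⟨1, by simp [hm h]⟩
  -- some root vector does not kill `m`
  obtain ⟨α, hα, a, ha, ham⟩ : ∃ α : H → ℂ, α ≠ 0 ∧
      ∃ a ∈ genWeightSpace (EvenPart g) α, ⁅a, m⁆ ≠ 0 := by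
    by_contra! hcon
    refine hm0 (eq_zero_of_forall_even_bracket_eq_zero hg hκ hmW.1 fun a ha => ?_)
    have hmem : ∀ b : EvenPart g, b ∈ ⨆ χ : H → ℂ, genWeightSpace (EvenPart g) χ := fun b => by
      rw [iSup_genWeightSpace_eq_top ℂ H (EvenPart g)]
      exact LieSubmodule.mem_top _
    change ⁅(⟨a, ha⟩ : EvenPart g), m⁆ = 0
    generalize (⟨a, ha⟩ : EvenPart g) = b
    have hb := hmem b
    clear hmem
    induction hb using LieSubmodule.iSup_induction' with
    | mem χ y hy =>
      by_cases hχ : χ = 0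
      · subst hχ
        have hyH : y ∈ H := (LieAlgebra.rootSpace_zero_eq ℂ (EvenPart g) H).le hy
        have h := hm ⟨y, hyH⟩
        rwa [Pi.zero_apply, zero_smul] at h
      · exact hcon χ hχ y hy
    | zero => exact zero_lie m
    | add y z _ _ hy hz => rw [add_lie, hy, hz, add_zero]
  have haG : (a : g) ∈ genWeightSpace g α :=
    map_genWeightSpace_le (evenIncl H) (LieSubmodule.mem_map_of_mem ha)
  have hamG : ⁅a, m⁆ ∈ genWeightSpace g α := by
    have h := bracket_mem_genWeightSpace haG hmG
    rwa [add_zero] at h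
  obtain ⟨w, hwW, hw0, hw⟩ := exists_weight_vector W (x := ⁅a, m⁆) (hlie a m hmW) hamG ham
  obtain ⟨e, -, he0, he⟩ := exists_weight_vector (⊤ : LieSubmodule ℂ H (EvenPart g)) (x := a)
    (LieSubmodule.mem_top a) ha (by rintro rfl; exact ham (zero_lie m))
  have hgen : ∀ {y : g}, (∀ h : H, ⁅h, y⁆ = α h • y) → y ∈ genWeightSpace g α := by
    intro y hy
    rw [mem_genWeightSpace]
    exact fun h => ⟨1, by simp [hy h]⟩
  have he' : ∀ h : H, ⁅h, (e : g)⁆ = α h • (e : g) := fun h => congrArg Subtype.val (he h)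
  obtain ⟨y, hy, hyα, hwy⟩ := hκ.exists_apply_eq_one hwW.1 hw0 hw
  obtain ⟨f, hf, hfα, hef⟩ := hκ.exists_apply_eq_one e.2 (fun h => he0 (Subtype.ext h)) he'
  -- the elements `[w, y]` and `[e, f]` of the Cartan subalgebra are both dual to `α`
  have hwyp : bracket w y ∈ parity (g := g) 0 := bracket_mem 1 1 w hwW.1 y hy
  have hefp : bracket (e : g) f ∈ parity (g := g) 0 := bracket_mem 0 0 _ e.2 f hf
  have hwyH := mem_cartan_of_mem_genWeightSpace (H := H) hwyp (by
    have h := bracket_mem_genWeightSpace (hgen hw) hyα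
    rwa [add_neg_cancel] at h)
  have hefH := mem_cartan_of_mem_genWeightSpace (H := H) hefp (by
    have h := bracket_mem_genWeightSpace (hgen he') hfα
    rwa [add_neg_cancel] at h)
  have hsymm : ∀ s t : EvenPart g, κ s t = κ t s := fun s t => by
    rw [hκ.symm 0 0 _ s.2 _ t.2, superSign_zero_left, one_mul]
  have heq : (⟨bracket w y, hwyp⟩ : EvenPart g) = ⟨bracket (e : g) f, hefp⟩ := by
    rw [← sub_eq_zero]
    refine hκ.eq_zero_of_mem_cartan (H.sub_mem hwyH hefH) fun s hs => ?_
    rw [hsymm]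
    have h1 := hκ.apply_bracket hw hwy ⟨s, hs⟩
    have h2 := hκ.apply_bracket he' hef ⟨s, hs⟩
    change κ s (bracket w y - bracket (e : g) f) = 0
    rw [map_sub, h1, h2, sub_self]
  have hww : bracket w w = 0 := by
    have h := Module.End.apply_mem_maxGenEigenspace_add hT hwW.2 hwW.2
    obtain ⟨k, hk⟩ := (Module.End.mem_maxGenEigenspace _ _ _).1 h
    have hwwp : bracket w w ∈ parity (g := g) 0 := bracket_mem 1 1 w hwW.1 w hwW.1
    have hpow : ∀ k : ℕ, ((T - (c + c) • 1) ^ k) (bracket w w) = (-(c + c)) ^ k • bracket w w := by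
      intro k
      induction k with
      | zero => simp
      | succ k ih =>
        rw [pow_succ', Module.End.mul_apply, ih, map_smul, LinearMap.sub_apply, hT0 _ hwwp,
          zero_sub, LinearMap.smul_apply, Module.End.one_apply, ← neg_smul, smul_smul, pow_succ]
    rw [hpow] at hk
    refine (smul_eq_zero.1 hk).resolve_left (pow_ne_zero _ (neg_ne_zero.2 ?_))
    rw [← two_mul]
    exact mul_ne_zero two_ne_zero hc
  have hαt : α ⟨_, hwyH⟩ = 0 := by
    have h1 : bracket w (bracket w y) = 0 := by
      have h := jacobi 1 1 w hwW.1 w hwW.1 y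
      rw [hww, superSign_one_one, map_zero, LinearMap.zero_apply, zero_add, neg_one_smul,
        eq_neg_iff_add_eq_zero, ← two_smul ℂ, smul_eq_zero, or_iff_right two_ne_zero] at h
      exact h
    rw [bracket_skew_of_even hwyp, neg_eq_zero] at h1
    have h2 : (⁅(⟨_, hwyH⟩ : H), w⁆ : g) = 0 := h1
    rw [hw, smul_eq_zero, or_iff_left hw0] at h2
    exact h2
  have ht : (⟨_, hwyH⟩ : H) = 0 := by
    refine eq_zero_of_mem_corootSpace (paritySubmodule g i) hα ?_ hαt
    rw [LieAlgebra.mem_corootSpace]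
    refine Submodule.subset_span ⟨e, ?_, ⟨f, hf⟩, ?_, heq.symm⟩
    · rw [LieAlgebra.rootSpace, mem_genWeightSpace]
      exact fun h => ⟨1, by simp [he h]⟩
    · rw [LieAlgebra.rootSpace, ← comap_genWeightSpace_eq_of_injective evenIncl_injective]
      exact hfα
  refine hα (funext fun h => ?_)
  have h1 := hκ.apply_bracket hw hwy h
  have h2 : bracket w y = 0 := congrArg (fun s : H => ((s : EvenPart g) : g)) ht
  rw [h2, map_zero] at h1
  exact h1.symm

end Weights

end LieSuperalgebra

/-! ### An even element of degree zero acting invertibly in positive degrees -/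

namespace LieSuperalgebra

open LieModule

namespace IsGoodGrading

variable {g : Type*} [AddCommGroup g] [Module ℂ g] [LieSuperalgebra g]
  {Γ : ℤ → Submodule ℂ g} {f : g} (hΓ : IsGoodGrading Γ f)

include hΓ

theorem hom_ext {V : Type*} [AddCommGroup V] [Module ℂ V] {φ ψ : g →ₗ[ℂ] V}
    (h : ∀ n, ∀ x ∈ Γ n, φ x = ψ x) : φ = ψ := by
  refine LinearMap.ext fun x => ?_
  have hx : x ∈ ⨆ n, Γ n := by
    rw [hΓ.internal.submodule_iSup_eq_top]
    exact Submodule.mem_top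
  induction hx using Submodule.iSup_induction' with
  | mem n x hx => exact h n x hx
  | zero => rw [map_zero, map_zero]
  | add x y _ _ hx hy => rw [map_add, map_add, hx, hy]

/-- The decomposition of `g` into its homogeneous components. -/
def decompose : g ≃ₗ[ℂ] DirectSum ℤ fun n => Γ n :=
  (LinearEquiv.ofBijective (DirectSum.coeLinearMap Γ) hΓ.internal).symm

theorem decompose_apply {n : ℤ} {x : g} (hx : x ∈ Γ n) :
    hΓ.decompose x = DirectSum.lof ℂ ℤ (fun m => Γ m) n ⟨x, hx⟩ := by
  refine (LinearEquiv.symm_apply_eq _).2 ?_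
  exact (DirectSum.coeLinearMap_lof (A := Γ) n ⟨x, hx⟩).symm

/-- The projection onto the component `Γ n`. -/
def proj (n : ℤ) : g →ₗ[ℂ] g :=
  (Γ n).subtype ∘ₗ DirectSum.component ℂ ℤ (fun m => Γ m) n ∘ₗ hΓ.decompose.toLinearMap

theorem proj_mem (n : ℤ) (x : g) : hΓ.proj n x ∈ Γ n := Subtype.property _

theorem proj_same {n : ℤ} {x : g} (hx : x ∈ Γ n) : hΓ.proj n x = x := by
  simp only [proj, LinearMap.comp_apply, LinearEquiv.coe_coe, hΓ.decompose_apply hx,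
    DirectSum.component.lof_self, Submodule.subtype_apply]

theorem proj_ne {m n : ℤ} (hmn : m ≠ n) {x : g} (hx : x ∈ Γ m) : hΓ.proj n x = 0 := by
  simp only [proj, LinearMap.comp_apply, LinearEquiv.coe_coe, hΓ.decompose_apply hx,
    DirectSum.component.of, dif_neg hmn, map_zero]

theorem eq_zero_of_forall_proj_eq_zero {x : g} (hx : ∀ n, hΓ.proj n x = 0) : x = 0 := by
  rw [← LinearEquiv.map_eq_zero_iff hΓ.decompose]
  exact DFinsupp.ext fun n => Subtype.ext (hx n)

theorem proj_bracket {m n : ℤ} (x : g) {b : g} (hb : b ∈ Γ n) :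
    hΓ.proj (m + n) (bracket x b) = bracket (hΓ.proj m x) b := by
  refine LinearMap.congr_fun (f := hΓ.proj (m + n) ∘ₗ bracket.flip b)
    (g := bracket.flip b ∘ₗ hΓ.proj m) (hΓ.hom_ext fun k x hx => ?_) x
  simp only [LinearMap.comp_apply, LinearMap.flip_apply]
  by_cases hk : k = m
  · subst hk
    rw [hΓ.proj_same hx, hΓ.proj_same (hΓ.bracket_mem _ _ x hx b hb)]
  · rw [hΓ.proj_ne hk hx, hΓ.proj_ne (by omega) (hΓ.bracket_mem _ _ x hx b hb), map_zero,
      LinearMap.zero_apply]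

theorem proj_parityProj (n : ℤ) (i : ZMod 2) (x : g) :
    hΓ.proj n (parityProj parity i x) = parityProj parity i (hΓ.proj n x) := by
  refine LinearMap.congr_fun (f := hΓ.proj n ∘ₗ parityProj parity i)
    (g := parityProj parity i ∘ₗ hΓ.proj n) (hΓ.hom_ext fun k x hx => ?_) x
  simp only [LinearMap.comp_apply]
  by_cases hk : k = n
  · subst hk
    rw [hΓ.proj_same hx, hΓ.proj_same (hΓ.homogeneous _ _ x hx)]
  · rw [hΓ.proj_ne hk hx, hΓ.proj_ne hk (hΓ.homogeneous _ _ x hx), map_zero]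

theorem proj_mem_parity (n : ℤ) {i : ZMod 2} {x : g} (hx : x ∈ parity (g := g) i) :
    hΓ.proj n x ∈ parity (g := g) i := by
  rw [← parityProj_same parity hx, proj_parityProj]
  exact parityProj_mem _ i _

/-- The degree derivation, equal to `n` on `Γ n`. -/
def degree : g →ₗ[ℂ] g :=
  DirectSum.toModule ℂ ℤ g (fun n => (n : ℂ) • (Γ n).subtype) ∘ₗ hΓ.decompose.toLinearMap

theorem degree_apply {n : ℤ} {x : g} (hx : x ∈ Γ n) : hΓ.degree x = (n : ℂ) • x := by
  simp only [degree, LinearMap.comp_apply, LinearEquiv.coe_coe, hΓ.decompose_apply hx,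
    DirectSum.toModule_lof, LinearMap.smul_apply, Submodule.subtype_apply]

theorem degree_bracket (x y : g) :
    hΓ.degree (bracket x y) = bracket (hΓ.degree x) y + bracket x (hΓ.degree y) := by
  have h : ∀ m, ∀ x ∈ Γ m, ∀ y,
      hΓ.degree (bracket x y) = bracket (hΓ.degree x) y + bracket x (hΓ.degree y) := by
    intro m x hx y
    refine LinearMap.congr_fun (f := hΓ.degree ∘ₗ bracket x)
      (g := bracket (hΓ.degree x) + bracket x ∘ₗ hΓ.degree) (hΓ.hom_ext fun n y hy => ?_) y
    simp only [LinearMap.comp_apply, LinearMap.add_apply, hΓ.degree_apply hx, hΓ.degree_apply hy,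
      hΓ.degree_apply (hΓ.bracket_mem m n x hx y hy), map_smul, LinearMap.smul_apply]
    push_cast
    rw [add_smul]
  refine LinearMap.congr_fun (f := hΓ.degree ∘ₗ bracket.flip y)
    (g := bracket.flip y ∘ₗ hΓ.degree + bracket.flip (hΓ.degree y))
    (hΓ.hom_ext fun m x hx => h m x hx y) x

theorem proj_degree (n : ℤ) (x : g) : hΓ.proj n (hΓ.degree x) = (n : ℂ) • hΓ.proj n x := by
  refine LinearMap.congr_fun (f := hΓ.proj n ∘ₗ hΓ.degree)
    (g := (n : ℂ) • hΓ.proj n) (hΓ.hom_ext fun k x hx => ?_) x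
  rw [LinearMap.comp_apply, hΓ.degree_apply hx, map_smul, LinearMap.smul_apply]
  by_cases hk : k = n
  · rw [hk]
  · rw [hΓ.proj_ne hk hx, smul_zero, smul_zero]

theorem degree_mem_parity {i : ZMod 2} {x : g} (hx : x ∈ parity (g := g) i) :
    hΓ.degree x ∈ parity (g := g) i := by
  have h : parityProj parity i (hΓ.degree x) = hΓ.degree (parityProj parity i x) := by
    refine LinearMap.congr_fun (f := parityProj parity i ∘ₗ hΓ.degree)
      (g := hΓ.degree ∘ₗ parityProj parity i) (hΓ.hom_ext fun k x hx => ?_) x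
    simp only [LinearMap.comp_apply, hΓ.degree_apply hx,
      hΓ.degree_apply (hΓ.homogeneous k i x hx), map_smul]
  rw [← parityProj_same parity hx, ← h]
  exact parityProj_mem _ i _

theorem mem_of_degree_pow_eq_zero {k : ℕ} {x : g} (hx : (hΓ.degree ^ k) x = 0) : x ∈ Γ 0 := by
  have hpow : ∀ (n : ℤ) (k : ℕ), hΓ.proj n ((hΓ.degree ^ k) x) = (n : ℂ) ^ k • hΓ.proj n x := by
    intro n k
    induction k with
    | zero => simp
    | succ k ih => rw [pow_succ', Module.End.mul_apply, proj_degree, ih, smul_smul, pow_succ']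
  have h : x - hΓ.proj 0 x = 0 := by
    refine hΓ.eq_zero_of_forall_proj_eq_zero fun n => ?_
    by_cases hn : n = 0
    · rw [hn, map_sub, hΓ.proj_same (hΓ.proj_mem 0 x), sub_self]
    · have h0 := hpow n k
      rw [hx, map_zero, eq_comm, smul_eq_zero, or_iff_right (pow_ne_zero _ (by exact_mod_cast hn))]
        at h0
      rw [map_sub, h0, hΓ.proj_ne (Ne.symm hn) (hΓ.proj_mem 0 x), sub_zero]
  rw [sub_eq_zero.1 h]
  exact hΓ.proj_mem 0 x

variable [FiniteDimensional ℂ g]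

/-- Bracketing with an element of non-zero degree is nilpotent. -/
theorem exists_bracket_pow_eq_zero {n : ℤ} (hn : n ≠ 0) {a : g} (ha : a ∈ Γ n) :
    ∃ k : ℕ, (bracket a : Module.End ℂ g) ^ k = 0 := by
  have hfin := WellFoundedGT.finite_ne_bot_of_iSupIndep hΓ.internal.submodule_iSupIndep
  obtain ⟨N, hN⟩ : ∃ N : ℕ, ∀ m, Γ m ≠ ⊥ → |m| < N := by
    obtain ⟨b, hb⟩ := (hfin.image fun m => |m|).bddAbove
    exact ⟨(b + 1).toNat, fun m hm => by have := hb ⟨m, hm, rfl⟩; simp only at this; omega⟩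
  have hpow : ∀ (k : ℕ) (m : ℤ), ∀ x ∈ Γ m,
      ((bracket a : Module.End ℂ g) ^ k) x ∈ Γ (k * n + m) := by
    intro k m x hx
    induction k with
    | zero => simpa using hx
    | succ k ih =>
      rw [pow_succ', Module.End.mul_apply]
      have h := hΓ.bracket_mem _ _ a ha _ ih
      convert h using 2
      push_cast
      ring
  refine ⟨2 * N, hΓ.hom_ext fun m x hx => ?_⟩
  by_contra hne
  have hx0 : x ≠ 0 := by
    rintro rfl
    exact hne (by simp)
  have h1 := hN m fun h => hx0 ((Submodule.mem_bot ℂ).1 (h ▸ hx))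
  have h2 := hN _ fun h => hne ((Submodule.mem_bot ℂ).1 (h ▸ hpow (2 * N) m x hx))
  rw [abs_lt] at h1 h2
  push_cast at h2
  rcases lt_or_gt_of_ne hn with hn | hn <;> nlinarith

/-- On the even part, the grading is inner. -/
theorem exists_degree_eq_bracket {i : ZMod 2}
    [ComplementedLattice (LieSubmodule ℂ (EvenPart g) (paritySubmodule g i))]
    [IsFaithful ℂ (EvenPart g) (paritySubmodule g i)] :
    ∃ z ∈ parity (g := g) 0, z ∈ Γ 0 ∧ ∀ a ∈ parity (g := g) 0, hΓ.degree a = bracket z a := by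
  let d : EvenPart g → EvenPart g := fun a => ⟨hΓ.degree a, hΓ.degree_mem_parity a.2⟩
  let D : Module.End ℂ (paritySubmodule g i) :=
    hΓ.degree.restrict (p := parity i) (q := parity i) fun x hx => hΓ.degree_mem_parity hx
  obtain ⟨z, hz⟩ := exists_forall_traceForm_sub_lie_eq_zero (paritySubmodule g i) (d := d) (T := D)
    fun a m => Subtype.ext (hΓ.degree_bracket a m)
  have hcent : ∀ a b : EvenPart g, ⁅d a - ⁅z, a⁆, b⁆ = 0 := fun a b =>
    lie_eq_zero_of_traceForm_eq_zero (K := ℂ) (paritySubmodule g i) (hz a) b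
  let z₀ : EvenPart g := ⟨hΓ.proj 0 z, hΓ.proj_mem_parity 0 z.2⟩
  refine ⟨z₀, z₀.2, hΓ.proj_mem 0 z, ?_⟩
  -- the discrepancy is central, being a homogeneous component of a central element
  have hhom : ∀ m : ℤ, ∀ a : EvenPart g, (a : g) ∈ Γ m → d a - ⁅z₀, a⁆ = 0 := by
    intro m a ha
    have hda : hΓ.degree (a : g) = (m : ℂ) • (a : g) := hΓ.degree_apply ha
    have hz₀a : bracket (hΓ.proj 0 z) (a : g) ∈ Γ m := by
      have h := hΓ.bracket_mem 0 m _ (hΓ.proj_mem 0 z) _ ha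
      rwa [zero_add] at h
    have hmem : ((d a - ⁅z₀, a⁆ : EvenPart g) : g) ∈ Γ m := by
      change hΓ.degree (a : g) - bracket (hΓ.proj 0 z) (a : g) ∈ Γ m
      rw [hda]
      exact sub_mem (Submodule.smul_mem _ _ ha) hz₀a
    have hproj : hΓ.proj m ((d a - ⁅z, a⁆ : EvenPart g) : g) =
        ((d a - ⁅z₀, a⁆ : EvenPart g) : g) := by
      change hΓ.proj m (hΓ.degree (a : g) - bracket (z : g) (a : g)) =
        hΓ.degree (a : g) - bracket (hΓ.proj 0 z) (a : g)
      have h := hΓ.proj_bracket (m := 0) (z : g) ha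
      rw [zero_add] at h
      rw [map_sub, h, hda, map_smul, hΓ.proj_same ha]
    have hc : ∀ b : EvenPart g, ⁅d a - ⁅z₀, a⁆, b⁆ = 0 := by
      intro b
      refine Subtype.ext ?_
      change bracket ((d a - ⁅z₀, a⁆ : EvenPart g) : g) (b : g) = 0
      rw [← hproj]
      have hb : ∀ n, ∀ b ∈ Γ n, parityProj parity 0 b = b →
          bracket (hΓ.proj m ((d a - ⁅z, a⁆ : EvenPart g) : g)) b = 0 := by
        intro n b hb hb0
        rw [← hΓ.proj_bracket _ hb]
        have h := congrArg Subtype.val (hcent a ⟨b, hb0 ▸ parityProj_mem _ 0 b⟩)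
        change bracket ((d a - ⁅z, a⁆ : EvenPart g) : g) b = 0 at h
        rw [h, map_zero]
      have h := hΓ.hom_ext
        (φ := bracket (hΓ.proj m ((d a - ⁅z, a⁆ : EvenPart g) : g)) ∘ₗ parityProj parity 0) (ψ := 0)
        fun n x hx => hb n _ (hΓ.homogeneous n 0 x hx) (parityProj_same _ (parityProj_mem _ 0 x))
      have h2 := LinearMap.congr_fun h (b : g)
      rwa [LinearMap.comp_apply, parityProj_same _ b.2] at h2
    by_cases hm : m = 0
    · -- in degree zero it is a commutator
      subst hm
      refine eq_zero_of_mem_radical_of_mem_lie (K := ℂ) (paritySubmodule g i)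
        (LieAlgebra.center_le_radical ℂ _
          ((LieModule.mem_maxTrivSubmodule ℂ _ _ _).2 fun b => ?_)) ?_
      · rw [← lie_skew, hc, neg_zero]
      · have hd0 : d a = 0 := Subtype.ext (by
          change hΓ.degree (a : g) = 0
          rw [hda, Int.cast_zero, zero_smul])
        rw [hd0, zero_sub]
        exact neg_mem (LieSubmodule.lie_mem_lie (LieSubmodule.mem_top _) (LieSubmodule.mem_top _))
    · -- in degrees other than zero it acts nilpotently
      obtain ⟨k, hk⟩ := hΓ.exists_bracket_pow_eq_zero hm hmem
      refine eq_zero_of_central_of_isNilpotent (K := ℂ) (M := paritySubmodule g i) hc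
        ⟨k, LinearMap.ext fun x => Subtype.ext ?_⟩
      have hpow : ∀ k : ℕ,
          (((toEnd ℂ (EvenPart g) (paritySubmodule g i) (d a - ⁅z₀, a⁆)) ^ k) x : g) =
          ((bracket ((d a - ⁅z₀, a⁆ : EvenPart g) : g) : Module.End ℂ g) ^ k) x := by
        intro k
        induction k with
        | zero => rfl
        | succ k ih =>
          rw [pow_succ', pow_succ', Module.End.mul_apply, Module.End.mul_apply, ← ih]
          rfl
      rw [hpow, hk]
      rfl
  intro a ha
  have h := hΓ.hom_ext (φ := (hΓ.degree - bracket (hΓ.proj 0 z)) ∘ₗ parityProj parity 0) (ψ := 0)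
    fun n x hx => congrArg Subtype.val
      (hhom n ⟨_, parityProj_mem parity 0 x⟩ (hΓ.homogeneous n 0 x hx))
  have h2 := LinearMap.congr_fun h a
  rw [LinearMap.comp_apply, parityProj_same _ ha, LinearMap.sub_apply, LinearMap.zero_apply,
    sub_eq_zero] at h2
  exact h2

end IsGoodGrading

/-- An element of a nilpotent Lie algebra on which no non-zero weight of `M` vanishes has as kernel
on `M` only vectors of generalized weight zero. -/
theorem exists_forall_mem_genWeightSpace_zero (L N : Type*) [LieRing L] [LieAlgebra ℂ L]
    [LieRing.IsNilpotent L] [AddCommGroup N] [Module ℂ N] [LieRingModule L N] [LieModule ℂ L N]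
    [FiniteDimensional ℂ N] :
    ∃ z : L, ∀ x : N, ⁅z, x⁆ = 0 → x ∈ genWeightSpace N (0 : L → ℂ) := by
  obtain ⟨z, hz⟩ := Module.Dual.exists_forall_ne_zero_of_forall_exists
    (fun χ : {χ : Weight ℂ L N // χ.IsNonZero} => (χ : Weight ℂ L N).toLinear ℂ L N) fun χ => by
      by_contra! h
      exact χ.2 (funext h)
  refine ⟨z, fun x hx => ?_⟩
  have hmem : x ∈ genWeightSpaceOf N (0 : ℂ) z := by
    rw [mem_genWeightSpaceOf]
    exact ⟨1, by simp [hx]⟩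
  rw [eq_iSup_inf_genWeightSpace ℂ L N (genWeightSpaceOf N (0 : ℂ) z)] at hmem
  refine (iSup_le fun χ => ?_ : _ ≤ genWeightSpace N (0 : L → ℂ)) hmem
  by_cases hχ : χ.IsZero
  · rw [hχ.eq]
    exact inf_le_right
  · have hχz : χ z ≠ 0 := hz ⟨χ, hχ⟩
    rw [((disjoint_genWeightSpaceOf ℂ L N hχz.symm).mono_right
      (genWeightSpace_le_genWeightSpaceOf N z χ)).eq_bot]
    exact bot_le

/-- A generic element of a Cartan subalgebra containing and centralizing the element that induces
the grading of the even part acts injectively on every component of positive degree. -/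
theorem exists_injective_bracket {g : Type*} [AddCommGroup g] [Module ℂ g] [LieSuperalgebra g]
    (hg : IsBasicClassical g) {Γ : ℤ → Submodule ℂ g} {f : g} (hΓ : IsGoodGrading Γ f) :
    ∃ z ∈ parity (g := g) 0, z ∈ Γ 0 ∧ ∀ n : ℤ, 1 ≤ n → ∀ x ∈ Γ n, bracket z x = 0 → x = 0 := by
  have := hg.finite
  obtain ⟨κ, hκ⟩ := hg.basic
  obtain ⟨i, hi, hi'⟩ := exists_isFaithful hg
  obtain ⟨z₀, hz₀, hz₀Γ, hz₀D⟩ := hΓ.exists_degree_eq_bracket (i := i)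
  let ζ : EvenPart g := ⟨z₀, hz₀⟩
  have hpow : ∀ (k : ℕ) (a : EvenPart g), (((LieAlgebra.ad ℂ (EvenPart g) ζ) ^ k) a : g) =
      (hΓ.degree ^ k) a := by
    intro k a
    induction k with
    | zero => rfl
    | succ k ih =>
      rw [pow_succ', pow_succ', Module.End.mul_apply, Module.End.mul_apply, ← ih,
        hz₀D _ (Subtype.property _)]
      rfl
  obtain ⟨H, hH, hζH, hζ⟩ := LieAlgebra.exists_isCartanSubalgebra_of_engel (K := ℂ) (z := ζ)
    fun a ha => by
      rw [LieSubalgebra.mem_engel_iff] at ha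
      obtain ⟨k, hk⟩ := ha
      refine Subtype.ext ?_
      have h0 : (a : g) ∈ Γ 0 := hΓ.mem_of_degree_pow_eq_zero (k := k) (by rw [← hpow, hk]; rfl)
      change bracket z₀ (a : g) = 0
      rw [← hz₀D _ a.2, hΓ.degree_apply h0, Int.cast_zero, zero_smul]
  have hHΓ : ∀ a ∈ H, (a : g) ∈ Γ 0 := fun a ha =>
    hΓ.mem_of_degree_pow_eq_zero (k := 1) (by
      rw [pow_one, hz₀D _ a.2]
      exact congrArg Subtype.val (hζ a ha))
  obtain ⟨z, hz⟩ := exists_forall_mem_genWeightSpace_zero H g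
  refine ⟨z, z.1.2, hHΓ z z.2, fun n hn x hx hzx => ?_⟩
  have hn0 : (n : ℂ) ≠ 0 := by exact_mod_cast (show n ≠ 0 by omega)
  have hx0 : x ∈ genWeightSpace g (0 : H → ℂ) := hz x hzx
  have heven : parityProj parity 0 x = 0 := by
    have h0 : parityProj parity 0 x ∈ Γ 0 := hHΓ _ (mem_cartan_of_mem_genWeightSpace
      (parityProj_mem parity 0 x) (parityProj_mem_genWeightSpace hx0 0))
    have h1 := hΓ.degree_apply h0
    rw [hΓ.degree_apply (hΓ.homogeneous n 0 x hx), Int.cast_zero, zero_smul, smul_eq_zero] at h1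
    exact h1.resolve_left hn0
  have hodd : parityProj parity 1 x = 0 := by
    set y := parityProj parity 1 x
    have hy0 : y ∈ genWeightSpace g (0 : H → ℂ) := parityProj_mem_genWeightSpace hx0 1
    -- `y` is an eigenvector, in the generalized sense, of the outer part of the degree derivation
    refine hκ.eq_zero_of_mem_genWeightSpace_zero (i := i) (T := hΓ.degree - bracket z₀) (c := n)
      hg.simple (fun x y => ?_) (fun a ha => ?_) hn0 (parityProj_mem _ 1 x) hy0 ?_
    · simp only [LinearMap.sub_apply, hΓ.degree_bracket, bracket_leibniz hz₀, map_sub]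
      abel
    · rw [LinearMap.sub_apply, hz₀D a ha, sub_self]
    · obtain ⟨k, hk⟩ := (mem_genWeightSpace _ _ _).1 hy0 ⟨ζ, hζH⟩
      rw [Module.End.mem_maxGenEigenspace]
      refine ⟨k, ?_⟩
      have hT : ∀ k : ℕ, ((hΓ.degree - bracket z₀ - (n : ℂ) • 1) ^ k) y =
          (-1 : ℂ) ^ k • ((toEnd ℂ H g ⟨ζ, hζH⟩) ^ k) y ∧ ((toEnd ℂ H g ⟨ζ, hζH⟩) ^ k) y ∈ Γ n := by
        intro k
        induction k with
        | zero => exact ⟨by simp, hΓ.homogeneous n 1 x hx⟩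
        | succ k ih =>
          rw [pow_succ' (_ - _), pow_succ' (toEnd ℂ H g _), Module.End.mul_apply,
            Module.End.mul_apply, ih.1]
          refine ⟨?_, ?_⟩
          · rw [map_smul, LinearMap.sub_apply, LinearMap.sub_apply, hΓ.degree_apply ih.2]
            change (-1 : ℂ) ^ k • ((n : ℂ) • _ - bracket z₀ _ - (n : ℂ) • _) =
              (-1 : ℂ) ^ (k + 1) • bracket z₀ _
            rw [Module.End.one_apply, sub_sub_cancel_left, pow_succ, mul_neg_one, neg_smul,
              smul_neg]
          · have h := hΓ.bracket_mem 0 n _ hz₀Γ _ ih.2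
            rw [zero_add] at h
            exact h
      rw [(hT k).1]
      rw [Pi.zero_apply, zero_smul, sub_zero] at hk
      rw [hk, smul_zero]
  rw [← parityProj_add parity x, heven, hodd, add_zero]

end LieSuperalgebra

end

open LieSuperalgebra

theorem mainTheorem3 {g : Type u} [AddCommGroup g] [Module ℂ g] [FiniteDimensional ℂ g]
    [LieSuperalgebra g] (hg : IsBasicClassical g)
    (Γ : ℤ → Submodule ℂ g) (e h f : g)
    (hf_even : f ∈ parity (g := g) 0) (hf_ne : f ≠ 0)
    (hf_nilp : IsNilpotent (bracket f : Module.End ℂ g))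
    (hΓ : IsGoodGrading Γ f) (htriple : IsGradedSl2Triple Γ e h f) :
    ∃ (hS : centralizer e ≤ gGe Γ)
      (Φ : invariants Γ f ≃ₐ[ℂ] CoordRing (centralizer e)),
      (∀ F, Φ F = restrictInvariants Γ f hS F) ∧
      Function.Injective (finiteMiura Γ e f Φ) := by
  obtain ⟨z, hz0, hz, hinj⟩ := exists_injective_bracket hg hΓ
  exact ⟨centralizer_le_gGe hΓ htriple,
    AlgEquiv.ofBijective (restrictInvariants Γ f (centralizer_le_gGe hΓ htriple))
      ⟨restrictInvariants_slodowy_injective hΓ htriple,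
        restrictInvariants_slodowy_surjective hΓ htriple⟩,
    fun _ => rfl, (restrictInvariants_initial_injective hΓ hf_even hz0 hz hinj).comp
      (AlgEquiv.injective _)⟩
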